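/- **Setting.** Let $A\neq 0$ be a unital C*-algebra and let $\mathcal A\subseteq A$ be a dense unital $*$-subalgebra. *Spectral triples.* An (odd) spectral triple $(\mathcal A,H,D)$ on $A$ consists of such an $\mathcal A$, a unital representation $\pi:A\to\mathbb B(H)$ on a Hilbert space and a densely defined self-adjoint operator $D$ on $H$ such that $(1+D^2)^{-1/2}$ is compact and, for all $a\in\mathcal A$, $\pi(a)\operatorname{Dom}D\subseteq\operatorname{Dom}D$ and $[D,\pi(a)]$ extends to a bounded operator. It is even if there is in addition a self-adjoint $\chi\in\mathbb B(H)$ with $\chi^2=1$, $\chi\pi(a)=\pi(a)\chi$ for all $a\in A$, $\chi\operatorname{Dom}D\subseteq\operatorname{Dom}D$ and $D\chi=-\chi D$; then $H=H^+\oplus H^-$, $\pi=\pi^+\oplus\pi^-$ and $D=\begin{pmatrix}0&D^-\\D^+&0\end{pmatrix}$. It is non-degenerate if $\pi$ is faithful and, for $a\in\mathcal A$, $[D,\pi(a)]=0$ if and only if $a\in\mathbb C1$. Put $\zeta_D(t)=\operatorname{Tr}((1+D^2)^{-t/2})$; the triple is finitely summable if $\zeta_D(t)<\infty$ for some $t>0$,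 and then $\operatorname{abs}(\zeta_D)=\inf\{t>0:\zeta_D(t)<\infty\}$. *Twisted actions.* Let $G$ be a discrete group and $(\rho,\sigma)$ a twisted action of $G$ on $A$: maps $\rho:G\to\operatorname{Aut}(A)$ and $\sigma:G\times G\to U(A)$ with $\rho_x(\sigma_{y,z})=\sigma_{x,y}\sigma_{xy,z}\sigma_{x,yz}^*$, $\rho_x\rho_y=\operatorname{Ad}(\sigma_{x,y})\rho_{xy}$, $\sigma_{x,e}=\sigma_{e,x}=1$ and $\rho_e=\operatorname{id}$. For a representation $\pi$ of $A$ on $H$, the left regular representation of the finitely supported functions $C_c(G,A)$ on $H\otimes\ell^2(G)$ is $$\Pi_\pi(a\delta_x)(\xi\otimes\delta_y)=\pi(\rho_{y^{-1}x^{-1}}(a)\sigma_{y^{-1}x^{-1},x})\xi\otimes\delta_{xy}.$$ For faithful $\pi$ the reduced twisted crossed product $A\rtimes_r^{\rho,\sigma}G$ is the norm closure of $\Pi_\pi(C_c(G,A))$. The action is smooth if it restricts to $\mathcal A$, i.e. $\rho_x(\mathcal A)=\mathcal A$ and $\sigma_{x,y}\in\mathcal A$ for all $x,y\in G$; then $C_c(G,\mathcal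 A)$ is a $*$-subalgebra of $A\rtimes_r^{\rho,\sigma}G$. *Length functions.* Let $V\ne0$ be a finite dimensional complex Hilbert space and $\ell:G\to\mathbb B_h(V)$ a map into the self-adjoint operators. It is translation bounded if $x\mapsto\ell(x)-\ell(y^{-1}x)$ is bounded for every $y\in G$. It is proper if $\ell(g)=0$ exactly for $g=e$, the set $\mathcal S=\bigcup_{x}\operatorname{Sp}\ell(x)$ has no accumulation point in $\mathbb R$, and for every $t\in\mathcal S$ there are only finitely many $x$ with $t\in\operatorname{Sp}\ell(x)$. Let $M_\ell(\delta_x\otimes v)=\delta_x\otimes\ell(x)v$ on $\ell^2(G)\otimes V$ and $B_n=\{g\in G:\min\operatorname{Sp}|\ell(g)|\le n\}$. $G$ has polynomial growth with respect to $\ell$ if $\#B_n$ grows at most polynomially, and then $d_G=\limsup_n\frac{\log\#B_n}{\log n}$. **Theorem.** Let $(\mathcal A,H,D)$ be a spectral triple on $A$ with faithful representation $\pi$, $(\rho,\sigma)$ a smooth twisted action of $G$ on $A$ with $$\sup_{x\in G}\|[D,\pi(\rho_x(a)\sigma_{x,y})]\|<\infty\qquad(a\in\mathcal A,\ y\in G),$$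 and $\ell:G\to\mathbb B_h(V)$ proper and translation bounded. (1a) If the triple is odd, then $(C_c(G,\mathcal A),\widetilde H,\widetilde D)$ with $\widetilde H=(H\otimes\ell^2(G)\otimes V)\oplus(H\otimes\ell^2(G)\otimes V)$, representation $\Pi\oplus\Pi$, where $\Pi$ is the extension of $\Pi_{\pi\otimes1_V}$ to $A\rtimes_r^{\rho,\sigma}G$, grading $1\oplus(-1)$ and $$\widetilde D=\begin{pmatrix}0&D\otimes1\otimes1-i\,1\otimes M_\ell\\D\otimes1\otimes1+i\,1\otimes M_\ell&0\end{pmatrix}$$ is an even spectral triple on $A\rtimes_r^{\rho,\sigma}G$. It is non-degenerate if $(\mathcal A,H,D)$ is. (1b) If the triple is even, then $(C_c(G,\mathcal A),\widetilde H,\widetilde D)$ with $\widetilde H=(H^+\otimes\ell^2(G)\otimes V)\oplus(H^-\otimes\ell^2(G)\otimes V)$, the representation of $A\rtimes_r^{\rho,\sigma}G$ which extends $\Pi_{\pi^+\otimes1_V}\oplus\Pi_{\pi^-\otimes1_V}$ and $$\widetilde D=\begin{pmatrix}1\otimes M_\ell&D^-\otimes1\otimes1\\D^+\otimes1\otimes1&-1\otimes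 M_\ell\end{pmatrix}$$ is an odd spectral triple on $A\rtimes_r^{\rho,\sigma}G$. It is non-degenerate if $(\mathcal A,H,D)$ is. (2) In both cases, if $(\mathcal A,H,D)$ is finitely summable and $G$ has polynomial growth with respect to $\ell$, then the new triple is finitely summable and $$\operatorname{abs}(\zeta_{\widetilde D})\le\operatorname{abs}(\zeta_D)+d_G,$$ with equality if $\lim_n\frac{\log\#B_n}{\log n}$ exists. -/

import Mathlib

open scoped TensorProduct ENNReal
open Filter Topology

noncomputable section

namespace TwistedTriple

/-! ### Unbounded operators, resolvents and traces -/

section Operators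

variable {H : Type*} [NormedAddCommGroup H] [InnerProductSpace ℂ H]

/-- The bounded operator `S` maps the domain of `D` to itself and the commutator `[D, S]`, defined
on the domain of `D`, is the restriction of the bounded operator `T`. -/
def IsCommutator (D : H →ₗ.[ℂ] H) (S T : H →L[ℂ] H) : Prop :=
  ∀ ξ : D.domain, ∃ h : S ξ ∈ D.domain, D ⟨S ξ, h⟩ - S (D ξ) = T ξ

/-- `R` is the bounded inverse of `1 + D²`: for every `η`, the vector `R η` lies in the domain of
`D`, its image `D (R η)` lies in the domain of `D`, and `R η + D (D (R η)) = η`. -/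
def IsInvOneAddSq (D : H →ₗ.[ℂ] H) (R : H →L[ℂ] H) : Prop :=
  ∀ η : H, ∃ ζ : H, (R η, ζ) ∈ D.graph ∧ (ζ, η - R η) ∈ D.graph

open Classical in
/-- The bounded operator `(1 + D²)⁻¹`; it exists for each self-adjoint `D`, see
`isInvOneAddSq_invOneAddSq`. -/
def invOneAddSq (D : H →ₗ.[ℂ] H) : H →L[ℂ] H :=
  if h : ∃ R, IsInvOneAddSq D R then h.choose else 0

theorem isInvOneAddSq_invOneAddSq [CompleteSpace H] {D : H →ₗ.[ℂ] H} (hD : IsSelfAdjoint D) :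
    IsInvOneAddSq D (invOneAddSq D) := by
  suffices h : ∃ R, IsInvOneAddSq D R by
    rw [invOneAddSq, dif_pos h]
    exact h.choose_spec
  let e := WithLp.prodContinuousLinearEquiv 2 ℂ H H
  let Γ : Submodule ℂ (WithLp 2 (H × H)) := D.graph.comap (e : WithLp 2 (H × H) →ₗ[ℂ] H × H)
  have hcl : IsClosed (Γ : Set (WithLp 2 (H × H))) := hD.isClosed.preimage e.continuous
  have : CompleteSpace Γ := hcl.completeSpace_coe
  refine ⟨(ContinuousLinearMap.fst ℂ H H) ∘L (e : WithLp 2 (H × H) →L[ℂ] H × H) ∘L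
    Γ.starProjection ∘L (e.symm : H × H →L[ℂ] WithLp 2 (H × H)) ∘L
    (ContinuousLinearMap.inl ℂ H H), fun η => ?_⟩
  set p : WithLp 2 (H × H) := Γ.starProjection (e.symm (η, 0)) with hp
  have hpΓ : (p.fst, p.snd) ∈ D.graph := by
    have : p ∈ Γ := Submodule.starProjection_apply_mem Γ _
    exact this
  refine ⟨p.snd, hpΓ, ?_⟩
  change (p.snd, η - p.fst) ∈ D.graph
  have horth : e.symm (η, 0) - p ∈ Γᗮ := Submodule.sub_starProjection_mem_orthogonal _
  have hgr : D.graph = D.graph.adjoint := by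
    conv_lhs => rw [← LinearPMap.isSelfAdjoint_def.mp hD]
    exact LinearPMap.adjoint_graph_eq_graph_adjoint hD.dense_domain
  rw [hgr, Submodule.mem_adjoint_iff]
  intro a b hab
  have h1 := horth (e.symm (a, b)) hab
  rw [WithLp.prod_inner_apply] at h1
  change inner ℂ a (η - p.fst) + inner ℂ b (0 - p.snd) = 0 at h1
  rw [zero_sub, inner_neg_right] at h1
  change inner ℂ b p.snd - inner ℂ a (η - p.fst) = 0
  linear_combination -h1

/-- The trace of a positive bounded operator, `∑ᵢ ⟨bᵢ, T bᵢ⟩ ∈ [0, ∞]` along a Hilbert basis; for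
positive `T` it does not depend on the basis. -/
def posTrace [CompleteSpace H] (T : H →L[ℂ] H) : ℝ≥0∞ :=
  let b := (exists_hilbertBasis ℂ H).choose_spec.choose
  ∑' i, ENNReal.ofReal (inner ℂ (b i) (T (b i))).re

/-- `ζ_D(t) = Tr ((1 + D²)^(-t/2)) ∈ [0, ∞]`. -/
def zeta [CompleteSpace H] (D : H →ₗ.[ℂ] H) (t : ℝ) : ℝ≥0∞ :=
  posTrace (invOneAddSq D ^ (t / 2))

/-- Finite summability. For complex `t` the operator `(1 + D²)^(-t/2)` is trace class if and only
if `(1 + D²)^(-Re t/2)` is, so that it is enough to look at real exponents; and if a non-positive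
exponent is a summability exponent, then `H` is finite dimensional and so is any positive one. -/
def FinitelySummable [CompleteSpace H] (D : H →ₗ.[ℂ] H) : Prop :=
  ∃ t : ℝ, 0 < t ∧ zeta D t < ∞

/-- The abscissa of convergence of `ζ_D`. -/
def abscissa [CompleteSpace H] (D : H →ₗ.[ℂ] H) : ℝ :=
  sInf {t : ℝ | 0 < t ∧ zeta D t < ∞}

end Operators

/-! ### Spectral triples -/

section Triples

variable {A : Type*} [CStarAlgebra A]
  {H : Type*} [NormedAddCommGroup H] [InnerProductSpace ℂ H] [CompleteSpace H]

/-- `(𝒜, H, D)` is an (odd) spectral triple on the C*-algebra `A`, with representation `π`. -/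
structure IsSpectralTriple (𝒜 : StarSubalgebra ℂ A) (π : A →⋆ₐ[ℂ] (H →L[ℂ] H))
    (D : H →ₗ.[ℂ] H) : Prop where
  dense : Dense (𝒜 : Set A)
  dense_domain : Dense (D.domain : Set H)
  isSelfAdjoint : IsSelfAdjoint D
  compact : IsCompactOperator (invOneAddSq D ^ (1 / 2 : ℝ))
  commutator : ∀ a ∈ 𝒜, ∃ T : H →L[ℂ] H, IsCommutator D (π a) T

/-- `(𝒜, H, D)` is an even spectral triple with grading operator `χ`. -/
structure IsEvenSpectralTriple (𝒜 : StarSubalgebra ℂ A) (π : A →⋆ₐ[ℂ] (H →L[ℂ] H))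
    (D : H →ₗ.[ℂ] H) (χ : H →L[ℂ] H) : Prop extends IsSpectralTriple 𝒜 π D where
  grading_selfAdjoint : IsSelfAdjoint χ
  grading_sq : χ * χ = 1
  grading_comm : ∀ a : A, π a * χ = χ * π a
  grading_anticomm : ∀ ξ : D.domain, ∃ h : χ ξ ∈ D.domain, D ⟨χ ξ, h⟩ = -χ (D ξ)

/-- Non-degeneracy: `π` is faithful and `[D, π(a)] = 0` exactly for the scalars `a ∈ 𝒜`. -/
def IsNondegenerate (𝒜 : StarSubalgebra ℂ A) (π : A →⋆ₐ[ℂ] (H →L[ℂ] H))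
    (D : H →ₗ.[ℂ] H) : Prop :=
  Function.Injective π ∧
    ∀ a ∈ 𝒜, IsCommutator D (π a) 0 ↔ ∃ c : ℂ, a = algebraMap ℂ A c

end Triples

/-! ### Direct sums of two Hilbert spaces -/

section DirectSum

variable {E F : Type*} [NormedAddCommGroup E] [InnerProductSpace ℂ E]
  [NormedAddCommGroup F] [InnerProductSpace ℂ F]

/-- The bounded operator `S ⊕ T` on the Hilbert space `E ⊕ F`. -/
def dsum (S : E →L[ℂ] E) (T : F →L[ℂ] F) : WithLp 2 (E × F) →L[ℂ] WithLp 2 (E × F) :=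
  ((WithLp.prodContinuousLinearEquiv 2 ℂ E F).symm : E × F →L[ℂ] WithLp 2 (E × F)) ∘L
    (S.prodMap T) ∘L (WithLp.prodContinuousLinearEquiv 2 ℂ E F : WithLp 2 (E × F) →L[ℂ] E × F)

/-- The representation `π₁ ⊕ π₂` on `E ⊕ F`. -/
def repSum {A : Type*} [CStarAlgebra A] [CompleteSpace E] [CompleteSpace F]
    (π₁ : A →⋆ₐ[ℂ] (E →L[ℂ] E)) (π₂ : A →⋆ₐ[ℂ] (F →L[ℂ] F)) :
    A →⋆ₐ[ℂ] (WithLp 2 (E × F) →L[ℂ] WithLp 2 (E × F)) where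
  toFun a := dsum (π₁ a) (π₂ a)
  map_one' := by rw [map_one, map_one]; rfl
  map_mul' a b := by rw [map_mul, map_mul]; rfl
  map_zero' := by rw [map_zero, map_zero]; rfl
  map_add' a b := by rw [map_add, map_add]; rfl
  commutes' c := by rw [AlgHomClass.commutes, AlgHomClass.commutes]; rfl
  map_star' a := by
    rw [map_star, map_star, ContinuousLinearMap.star_eq_adjoint, ContinuousLinearMap.star_eq_adjoint,
      ContinuousLinearMap.star_eq_adjoint, ContinuousLinearMap.eq_adjoint_iff]
    intro x y
    rw [WithLp.prod_inner_apply, WithLp.prod_inner_apply]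
    change inner ℂ (ContinuousLinearMap.adjoint (π₁ a) x.fst) y.fst
        + inner ℂ (ContinuousLinearMap.adjoint (π₂ a) x.snd) y.snd
      = inner ℂ x.fst (π₁ a y.fst) + inner ℂ x.snd (π₂ a y.snd)
    rw [ContinuousLinearMap.adjoint_inner_left, ContinuousLinearMap.adjoint_inner_left]

/-- The domain `(dom a ∩ dom c) ⊕ (dom b ∩ dom d)` of the block matrix `(a b; c d)`. -/
def blockDomain (a : E →ₗ.[ℂ] E) (b : F →ₗ.[ℂ] E) (c : E →ₗ.[ℂ] F) (d : F →ₗ.[ℂ] F) :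
    Submodule ℂ (WithLp 2 (E × F)) :=
  ((a.domain ⊓ c.domain).prod (b.domain ⊓ d.domain)).comap
    (WithLp.linearEquiv 2 ℂ (E × F) : WithLp 2 (E × F) →ₗ[ℂ] E × F)

/-- The unbounded operator on `E ⊕ F` with block matrix `(a b; c d)`, that is
`(ξ, η) ↦ (a ξ + b η, c ξ + d η)`, on its natural domain. -/
def blockOp (a : E →ₗ.[ℂ] E) (b : F →ₗ.[ℂ] E) (c : E →ₗ.[ℂ] F) (d : F →ₗ.[ℂ] F) :
    WithLp 2 (E × F) →ₗ.[ℂ] WithLp 2 (E × F) :=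
  let p : blockDomain a b c d →ₗ[ℂ] E × F :=
    (WithLp.linearEquiv 2 ℂ (E × F) : WithLp 2 (E × F) →ₗ[ℂ] E × F).domRestrict _
  let p₁ := LinearMap.fst ℂ E F ∘ₗ p
  let p₂ := LinearMap.snd ℂ E F ∘ₗ p
  { domain := blockDomain a b c d
    toFun := ((WithLp.linearEquiv 2 ℂ (E × F)).symm : E × F →ₗ[ℂ] WithLp 2 (E × F)) ∘ₗ
      ((a.toFun ∘ₗ p₁.codRestrict a.domain fun x => x.2.1.1)
        + b.toFun ∘ₗ p₂.codRestrict b.domain fun x => x.2.2.1).prod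
      ((c.toFun ∘ₗ p₁.codRestrict c.domain fun x => x.2.1.2)
        + d.toFun ∘ₗ p₂.codRestrict d.domain fun x => x.2.2.2) }

end DirectSum

/-! ### Tensoring with a finite dimensional Hilbert space -/

section Tensor

variable {H : Type*} [NormedAddCommGroup H] [InnerProductSpace ℂ H]
  (V : Type*) [NormedAddCommGroup V] [InnerProductSpace ℂ V]

/-- As `V` is finite dimensional, the algebraic tensor product `H ⊗ V` is a Hilbert space. -/
instance completeSpace_tensor [CompleteSpace H] [FiniteDimensional ℂ V] :
    CompleteSpace (H ⊗[ℂ] V) := by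
  let b := stdOrthonormalBasis ℂ V
  let n := Module.finrank ℂ V
  let f : (Fin n → H) →L[ℂ] H ⊗[ℂ] V :=
    ∑ i, ((TensorProduct.mkL ℂ H V).flip (b i)) ∘L ContinuousLinearMap.proj i
  let g : H ⊗[ℂ] V →L[ℂ] (Fin n → H) := ContinuousLinearMap.pi fun i =>
    ((TensorProduct.ridIsometry ℂ H).toContinuousLinearEquiv : H ⊗[ℂ] ℂ →L[ℂ] H) ∘L
      (ContinuousLinearMap.lTensor H (innerSL ℂ (b i)))
  have hgf : Function.LeftInverse g f := by
    intro x
    ext i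
    simp [f, g, b.inner_eq_ite, Finset.sum_ite_eq]
  have hfg : Function.RightInverse g f := by
    intro x
    induction x using TensorProduct.induction_on with
    | zero => simp
    | add x y hx hy => rw [map_add, map_add, hx, hy]
    | tmul h v =>
      conv_rhs => rw [← b.sum_repr' v]
      simp [f, g, TensorProduct.tmul_sum]
  let e : (Fin n → H) ≃L[ℂ] H ⊗[ℂ] V := ContinuousLinearEquiv.equivOfInverse f g hgf hfg
  exact (completeSpace_congr (e := e.toEquiv) e.isUniformEmbedding).mp inferInstance

/-- The amplification `π ⊗ 1_V` of a representation. -/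
def ampl {A : Type*} [CStarAlgebra A] [CompleteSpace H] [FiniteDimensional ℂ V] [CompleteSpace V]
    (π : A →⋆ₐ[ℂ] (H →L[ℂ] H)) : A →⋆ₐ[ℂ] (H ⊗[ℂ] V →L[ℂ] H ⊗[ℂ] V) where
  toFun a := (π a).rTensor V
  map_one' := by simp
  map_mul' a b := by rw [map_mul, ContinuousLinearMap.rTensor_mul]
  map_zero' := by simp
  map_add' a b := by simp
  commutes' c := by
    rw [AlgHomClass.commutes, Algebra.algebraMap_eq_smul_one, Algebra.algebraMap_eq_smul_one]
    simp
  map_star' a := by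
    rw [map_star, ContinuousLinearMap.star_eq_adjoint, ContinuousLinearMap.star_eq_adjoint,
      ContinuousLinearMap.adjoint_rTensor]

/-- The unbounded operator `D ⊗ 1_V` with domain `dom D ⊗ V`, given by its graph. -/
def tensorOp {K : Type*} [NormedAddCommGroup K] [InnerProductSpace ℂ K] (D : H →ₗ.[ℂ] K) :
    H ⊗[ℂ] V →ₗ.[ℂ] K ⊗[ℂ] V :=
  (Submodule.span ℂ {p : (H ⊗[ℂ] V) × (K ⊗[ℂ] V) |
    ∃ (ξ : D.domain) (v : V), p = ((ξ : H) ⊗ₜ[ℂ] v, D ξ ⊗ₜ[ℂ] v)}).toLinearPMap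

end Tensor

/-! ### Operators on `ℓ²(G, K)` -/

/-- The Hilbert space `ℓ²(G, K) = K ⊗ ℓ²(G)`. -/
abbrev L2 (G K : Type*) [NormedAddCommGroup K] : Type _ := lp (fun _ : G => K) 2

section EllTwo

variable {G : Type*} {K : Type*} [NormedAddCommGroup K] [InnerProductSpace ℂ K]
  {K' : Type*} [NormedAddCommGroup K'] [InnerProductSpace ℂ K']

/-- The direct sum over `G` of a family of unbounded operators: `(T ξ)(y) = T_y (ξ(y))`, on the
domain of all `ξ ∈ ℓ²(G, K)` with `ξ(y) ∈ dom T_y` and `(T_y (ξ(y)))_y ∈ ℓ²(G, K')`. -/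
def diagOp (T : G → K →ₗ.[ℂ] K') : L2 G K →ₗ.[ℂ] L2 G K' :=
  Submodule.toLinearPMap
    { carrier := {p : L2 G K × L2 G K' | ∀ y, (p.1 y, p.2 y) ∈ (T y).graph}
      add_mem' := fun hp hq y => (T y).graph.add_mem (hp y) (hq y)
      zero_mem' := fun y => (T y).graph.zero_mem
      smul_mem' := fun z _ hp y => (T y).graph.smul_mem z (hp y) }

variable [Group G]

theorem summable_shift (x : G) (ξ : L2 G K) : Summable fun y : G => ‖ξ (x⁻¹ * y)‖ ^ 2 := by
  have h := (memℓp_gen_iff (p := 2) (by norm_num)).1 (lp.memℓp ξ)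
  have h' : Summable fun y : G => ‖ξ y‖ ^ 2 := by simpa using h
  exact (Equiv.mulLeft x⁻¹).summable_iff (f := fun y => ‖ξ y‖ ^ 2) |>.2 h'

theorem wshift_le (x : G) (T : G → K →L[ℂ] K) (C : ℝ) (hT : ∀ y, ‖T y‖ ≤ C) (ξ : L2 G K) (y : G) :
    ‖T y (ξ (x⁻¹ * y))‖ ^ 2 ≤ C ^ 2 * ‖ξ (x⁻¹ * y)‖ ^ 2 := by
  rw [← mul_pow]
  gcongr
  exact (T y).le_of_opNorm_le (hT y) _

theorem summable_wshift (x : G) (T : G → K →L[ℂ] K) (C : ℝ) (hT : ∀ y, ‖T y‖ ≤ C) (ξ : L2 G K) :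
    Summable fun y : G => ‖T y (ξ (x⁻¹ * y))‖ ^ 2 :=
  Summable.of_nonneg_of_le (fun _ => by positivity) (wshift_le x T C hT ξ)
    ((summable_shift x ξ).mul_left (C ^ 2))

theorem memℓp_wshift (x : G) (T : G → K →L[ℂ] K) (C : ℝ) (hT : ∀ y, ‖T y‖ ≤ C) (ξ : L2 G K) :
    Memℓp (fun y : G => T y (ξ (x⁻¹ * y))) 2 :=
  memℓp_gen (by simpa using summable_wshift x T C hT ξ)

theorem norm_wshift_le (x : G) (T : G → K →L[ℂ] K) (C : ℝ) (hT : ∀ y, ‖T y‖ ≤ C) (ξ : L2 G K) :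
    ‖(⟨_, memℓp_wshift x T C hT ξ⟩ : L2 G K)‖ ≤ C * ‖ξ‖ := by
  have hC : 0 ≤ C := (norm_nonneg _).trans (hT 1)
  refine lp.norm_le_of_tsum_le (p := 2) (by norm_num) (by positivity) ?_
  have h2 : ‖ξ‖ ^ 2 = ∑' y, ‖ξ y‖ ^ 2 := by
    simpa using lp.norm_rpow_eq_tsum (p := 2) (by norm_num) ξ
  have h3 : ∑' y, ‖ξ (x⁻¹ * y)‖ ^ 2 = ∑' y, ‖ξ y‖ ^ 2 :=
    (Equiv.mulLeft x⁻¹).tsum_eq fun y => ‖ξ y‖ ^ 2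
  have h4 : ∑' y, ‖T y (ξ (x⁻¹ * y))‖ ^ 2 ≤ (C * ‖ξ‖) ^ 2 := by
    rw [mul_pow, h2, ← h3, ← tsum_mul_left]
    exact (summable_wshift x T C hT ξ).tsum_le_tsum (wshift_le x T C hT ξ)
      ((summable_shift x ξ).mul_left (C ^ 2))
  simpa using h4

/-- The bounded operator `ξ ⊗ δ_y ↦ T_{xy} ξ ⊗ δ_{xy}` on `ℓ²(G, K)`, for a bounded family `T`. -/
def wshift (x : G) (T : G → K →L[ℂ] K) (C : ℝ) (hT : ∀ y, ‖T y‖ ≤ C) : L2 G K →L[ℂ] L2 G K :=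
  LinearMap.mkContinuous
    { toFun := fun ξ => ⟨fun y => T y (ξ (x⁻¹ * y)), memℓp_wshift x T C hT ξ⟩
      map_add' := fun ξ η => by ext y; exact (T y).map_add _ _
      map_smul' := fun z ξ => by ext y; exact (T y).map_smul _ _ }
    C (norm_wshift_le x T C hT)

theorem wshift_apply (x : G) (T : G → K →L[ℂ] K) (C : ℝ) (hT : ∀ y, ‖T y‖ ≤ C) (ξ : L2 G K)
    (y : G) : wshift x T C hT ξ y = T y (ξ (x⁻¹ * y)) := rfl

end EllTwo

/-! ### Twisted actions and reduced twisted crossed products -/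

/-- A twisted action (twisting pair) of the discrete group `G` on the C*-algebra `A`. -/
structure TwistedAction (G A : Type*) [Group G] [CStarAlgebra A] where
  ρ : G → (A ≃⋆ₐ[ℂ] A)
  σ : G → G → unitary A
  cocycle : ∀ x y z : G,
    ρ x (σ y z : A) = (σ x y : A) * (σ (x * y) z : A) * star (σ x (y * z) : A)
  twist : ∀ (x y : G) (a : A), ρ x (ρ y a) = (σ x y : A) * ρ (x * y) a * star (σ x y : A)
  σ_right : ∀ x : G, σ x 1 = 1
  σ_left : ∀ x : G, σ 1 x = 1
  ρ_one : ∀ a : A, ρ 1 a = a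

section Crossed

variable {G A : Type*} [Group G] [CStarAlgebra A] (α : TwistedAction G A)
  {K : Type*} [NormedAddCommGroup K] [InnerProductSpace ℂ K] [CompleteSpace K]
  (π : A →⋆ₐ[ℂ] (K →L[ℂ] K))

/-- The twisted action is smooth: it restricts to a twisted action on `𝒜`. -/
structure TwistedAction.IsSmooth (𝒜 : StarSubalgebra ℂ A) : Prop where
  ρ_mem_iff : ∀ (x : G) (a : A), α.ρ x a ∈ 𝒜 ↔ a ∈ 𝒜
  σ_mem : ∀ x y : G, (α.σ x y : A) ∈ 𝒜

theorem TwistedAction.isSmooth_top : α.IsSmooth ⊤ := ⟨fun _ _ => by simp, fun _ _ => by simp⟩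

theorem norm_coeff_le (a : A) (x y : G) :
    ‖π (α.ρ y⁻¹ a * (α.σ y⁻¹ x : A))‖ ≤ ‖a‖ := by
  refine (NonUnitalStarAlgHom.norm_apply_le π _).trans ?_
  rw [CStarRing.norm_mul_coe_unitary]
  exact NonUnitalStarAlgHom.norm_apply_le (α.ρ y⁻¹) a

/-- The operator `Π(a δ_x)` of the left regular representation induced by `π`:
`Π(a δ_x)(ξ ⊗ δ_y) = π(ρ_{y⁻¹x⁻¹}(a) σ_{y⁻¹x⁻¹,x}) ξ ⊗ δ_{xy}`. -/
def regSingle (x : G) (a : A) : L2 G K →L[ℂ] L2 G K :=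
  wshift x (fun y => π (α.ρ y⁻¹ a * (α.σ y⁻¹ x : A))) ‖a‖ (norm_coeff_le α π a x)

theorem regSingle_apply (x : G) (a : A) (ξ : L2 G K) (y : G) :
    regSingle α π x a ξ y = π (α.ρ y⁻¹ a * (α.σ y⁻¹ x : A)) (ξ (x⁻¹ * y)) := rfl

/-- `Π(f) = ∑ₓ Π(f(x) δ_x)` for a finitely supported function `f : G → A`. -/
def regRep (f : G →₀ A) : L2 G K →L[ℂ] L2 G K := f.sum fun x a => regSingle α π x a

theorem regSingle_zero (x : G) : regSingle α π x 0 = 0 := by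
  ext ξ y
  rw [regSingle_apply]
  simp

theorem regSingle_add (x : G) (a b : A) :
    regSingle α π x (a + b) = regSingle α π x a + regSingle α π x b := by
  ext ξ y
  change π _ _ = π _ _ + π _ _
  rw [map_add, add_mul, map_add]
  rfl

theorem regSingle_smul (x : G) (c : ℂ) (a : A) :
    regSingle α π x (c • a) = c • regSingle α π x a := by
  ext ξ y
  change π _ _ = c • π _ _
  rw [map_smul, smul_mul_assoc, map_smul]
  rfl

theorem regSingle_algebraMap (c : ℂ) :
    regSingle α π 1 (algebraMap ℂ A c) = algebraMap ℂ (L2 G K →L[ℂ] L2 G K) c := by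
  ext ξ y
  rw [regSingle_apply, α.σ_right, AlgHomClass.commutes, inv_one, one_mul,
    Algebra.algebraMap_eq_smul_one]
  simp

/-- `Π` turns the twisted convolution `(a δ_x) ⋆ (b δ_y) = a ρ_x(b) σ_{x,y} δ_{xy}` into the
product of operators. -/
theorem regSingle_mul (x y : G) (a b : A) :
    regSingle α π x a * regSingle α π y b
      = regSingle α π (x * y) (a * α.ρ x b * (α.σ x y : A)) := by
  ext ξ z
  have h1 : star (α.σ z⁻¹ x : A) * (α.σ z⁻¹ x : A) = 1 := Unitary.coe_star_mul_self _
  have h2 : star (α.σ z⁻¹ (x * y) : A) * (α.σ z⁻¹ (x * y) : A) = 1 := Unitary.coe_star_mul_self _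
  have hc : α.ρ z⁻¹ (a * α.ρ x b * (α.σ x y : A)) * (α.σ z⁻¹ (x * y) : A)
      = α.ρ z⁻¹ a * (α.σ z⁻¹ x : A) * (α.ρ (x⁻¹ * z)⁻¹ b * (α.σ (x⁻¹ * z)⁻¹ y : A)) := by
    rw [mul_inv_rev, inv_inv, map_mul, map_mul, α.twist, α.cocycle]
    simp only [mul_assoc, h2, mul_one]
    rw [← mul_assoc (star (α.σ z⁻¹ x : A)), h1, one_mul]
  have hi : (x * y)⁻¹ * z = y⁻¹ * (x⁻¹ * z) := by group
  rw [regSingle_apply, hc, hi, map_mul]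
  rfl

/-- `Π` turns the involution `(a δ_x)* = σ_{x⁻¹,x}* ρ_{x⁻¹}(a*) δ_{x⁻¹}` into the adjoint. -/
theorem regSingle_star (x : G) (a : A) :
    star (regSingle α π x a)
      = regSingle α π x⁻¹ (star (α.σ x⁻¹ x : A) * α.ρ x⁻¹ (star a)) := by
  symm
  rw [ContinuousLinearMap.star_eq_adjoint, ContinuousLinearMap.eq_adjoint_iff]
  intro η ξ
  have hc : ∀ y : G, α.ρ y⁻¹ (star (α.σ x⁻¹ x : A) * α.ρ x⁻¹ (star a)) * (α.σ y⁻¹ x⁻¹ : A)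
      = star (α.ρ (x * y)⁻¹ a * (α.σ (x * y)⁻¹ x : A)) := fun y => by
    have h1 : star (α.σ y⁻¹ x⁻¹ : A) * (α.σ y⁻¹ x⁻¹ : A) = 1 := Unitary.coe_star_mul_self _
    rw [map_mul, map_star, α.cocycle, α.twist, inv_mul_cancel, α.σ_right, mul_inv_rev, map_star]
    simp only [star_mul, star_star, mul_assoc, h1, mul_one, OneMemClass.coe_one, one_mul]
    rw [← mul_assoc (star (α.σ y⁻¹ x⁻¹ : A)), h1, one_mul]
  rw [lp.inner_eq_tsum, lp.inner_eq_tsum,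
    ← (Equiv.mulLeft x).tsum_eq fun y => inner ℂ (η y) (regSingle α π x a ξ y)]
  refine tsum_congr fun y => ?_
  rw [regSingle_apply, regSingle_apply, hc, map_star, ContinuousLinearMap.star_eq_adjoint,
    ContinuousLinearMap.adjoint_inner_left, inv_inv, Equiv.coe_mulLeft]
  change inner ℂ (η (x * y)) (π _ (ξ y)) = inner ℂ (η (x * y)) (π _ (ξ (x⁻¹ * (x * y))))
  rw [inv_mul_cancel_left]

theorem regRep_single (x : G) (a : A) :
    regRep α π (Finsupp.single x a) = regSingle α π x a :=
  Finsupp.sum_single_index (regSingle_zero α π x)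

theorem regRep_add (f g : G →₀ A) : regRep α π (f + g) = regRep α π f + regRep α π g :=
  Finsupp.sum_add_index' (regSingle_zero α π) (regSingle_add α π)

/-- The `*`-algebra of all operators `Π(f)`, where `f` runs through the twisted convolution algebra
`C_c(G, 𝒜)` of finitely supported functions from `G` to `𝒜`. -/
def convAlgebra (𝒜 : StarSubalgebra ℂ A) (h : α.IsSmooth 𝒜) :
    StarSubalgebra ℂ (L2 G K →L[ℂ] L2 G K) where
  carrier := {T | ∃ f : G →₀ A, (∀ x, f x ∈ 𝒜) ∧ T = regRep α π f}
  add_mem' := by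
    rintro _ _ ⟨f, hf, rfl⟩ ⟨g, hg, rfl⟩
    exact ⟨f + g, fun x => add_mem (hf x) (hg x), (regRep_add α π f g).symm⟩
  algebraMap_mem' c := by
    classical
    refine ⟨Finsupp.single 1 (algebraMap ℂ A c), fun x => ?_, ?_⟩
    · rw [Finsupp.single_apply]
      split_ifs
      exacts [algebraMap_mem 𝒜 c, zero_mem 𝒜]
    · rw [regRep_single, regSingle_algebraMap]
  mul_mem' := by
    classical
    rintro _ _ ⟨f, hf, rfl⟩ ⟨g, hg, rfl⟩
    refine ⟨∑ x ∈ f.support, ∑ y ∈ g.support,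
      Finsupp.single (x * y) (f x * α.ρ x (g y) * (α.σ x y : A)), fun z => ?_, ?_⟩
    · rw [Finsupp.finsetSum_apply]
      refine sum_mem fun x _ => ?_
      rw [Finsupp.finsetSum_apply]
      refine sum_mem fun y _ => ?_
      rw [Finsupp.single_apply]
      split_ifs
      exacts [mul_mem (mul_mem (hf x) ((h.ρ_mem_iff x _).2 (hg y))) (h.σ_mem x y), zero_mem 𝒜]
    · have hs : ∀ (s : Finset G) (F : G → G →₀ A),
          regRep α π (∑ x ∈ s, F x) = ∑ x ∈ s, regRep α π (F x) := fun s F =>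
        map_sum (AddMonoidHom.mk' (regRep α π) (regRep_add α π)) F s
      simp only [hs, regRep_single, ← regSingle_mul]
      simp only [regRep, Finsupp.sum, Finset.sum_mul_sum]
  star_mem' := by
    classical
    rintro _ ⟨f, hf, rfl⟩
    refine ⟨∑ x ∈ f.support,
      Finsupp.single x⁻¹ (star (α.σ x⁻¹ x : A) * α.ρ x⁻¹ (star (f x))), fun z => ?_, ?_⟩
    · rw [Finsupp.finsetSum_apply]
      refine sum_mem fun x _ => ?_
      rw [Finsupp.single_apply]
      split_ifs
      exacts [mul_mem (star_mem (h.σ_mem _ _)) ((h.ρ_mem_iff _ _).2 (star_mem (hf x))), zero_mem 𝒜]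
    · have hs : ∀ (s : Finset G) (F : G → G →₀ A),
          regRep α π (∑ x ∈ s, F x) = ∑ x ∈ s, regRep α π (F x) := fun s F =>
        map_sum (AddMonoidHom.mk' (regRep α π) (regRep_add α π)) F s
      simp only [hs, regRep_single, ← regSingle_star]
      simp only [regRep, Finsupp.sum, star_sum]

/-- The reduced twisted crossed product `A ⋊_r G`: the C*-algebra of operators on `ℓ²(G, K)`
generated by the left regular representation induced by the (faithful) representation `π`. -/
def crossedProduct : StarSubalgebra ℂ (L2 G K →L[ℂ] L2 G K) :=
  (convAlgebra α π ⊤ α.isSmooth_top).topologicalClosure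

instance isClosed_crossedProduct :
    IsClosed (crossedProduct α π : Set (L2 G K →L[ℂ] L2 G K)) :=
  StarSubalgebra.isClosed_topologicalClosure _

theorem regRep_mem_crossedProduct (f : G →₀ A) : regRep α π f ∈ crossedProduct α π :=
  StarSubalgebra.le_topologicalClosure _ ⟨f, fun _ => by simp, rfl⟩

/-- The element of the reduced twisted crossed product given by `f ∈ C_c(G, A)`. -/
def toCrossed (f : G →₀ A) : crossedProduct α π := ⟨regRep α π f, regRep_mem_crossedProduct α π f⟩

/-- The smooth subalgebra `C_c(G, 𝒜)` of the reduced twisted crossed product. -/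
def smoothCrossed (𝒜 : StarSubalgebra ℂ A) (h : α.IsSmooth 𝒜) :
    StarSubalgebra ℂ (crossedProduct α π) :=
  (convAlgebra α π 𝒜 h).comap (crossedProduct α π).subtype

/-- The uniform boundedness condition `sup_x ‖[D, π(ρ_x(a) σ_{x,y})]‖ < ∞` for all `a ∈ 𝒜` and
`y ∈ G`. -/
def UniformlyBounded (𝒜 : StarSubalgebra ℂ A) (D : K →ₗ.[ℂ] K) : Prop :=
  ∀ a ∈ 𝒜, ∀ y : G, ∃ C : ℝ, ∀ x : G, ∃ T : K →L[ℂ] K,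
    IsCommutator D (π (α.ρ x a * (α.σ x y : A))) T ∧ ‖T‖ ≤ C

end Crossed

/-! ### Matrix-valued length functions -/

section Length

variable {G : Type*} [Group G]
  {V : Type*} [NormedAddCommGroup V] [InnerProductSpace ℂ V] [CompleteSpace V]
  (ℓ : G → selfAdjoint (V →L[ℂ] V))

def TranslationBounded : Prop :=
  ∀ y : G, ∃ C : ℝ, ∀ x : G, ‖(ℓ x : V →L[ℂ] V) - (ℓ (y⁻¹ * x) : V →L[ℂ] V)‖ ≤ C

/-- The union of the spectra of the operators `ℓ(x)`. -/
def spectra : Set ℝ := ⋃ x : G, spectrum ℝ (ℓ x : V →L[ℂ] V)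

/-- Properness; "discrete set in `ℝ`" means that there are no accumulation points in `ℝ`. -/
structure IsProperLength : Prop where
  eq_zero_iff : ∀ g : G, ℓ g = 0 ↔ g = 1
  discrete : ∀ t : ℝ, ¬ AccPt t (𝓟 (spectra ℓ))
  finite_fiber : ∀ t ∈ spectra ℓ, {x : G | t ∈ spectrum ℝ (ℓ x : V →L[ℂ] V)}.Finite

/-- `B_n = {g : min Sp |ℓ(g)| ≤ n}`. -/
def ball (n : ℕ) : Set G :=
  {g | sInf (spectrum ℝ (CFC.abs (ℓ g : V →L[ℂ] V))) ≤ n}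

/-- `#B_n` grows at most polynomially. -/
def PolynomialGrowth : Prop :=
  ∃ (C : ℝ) (k : ℕ), ∀ n : ℕ, 1 ≤ n → (ball ℓ n).Finite ∧ ((ball ℓ n).ncard : ℝ) ≤ C * (n : ℝ) ^ k

/-- The growth `d_G = limsup_n log #B_n / log n`. -/
def growth : ℝ := limsup (fun n : ℕ => Real.log (ball ℓ n).ncard / Real.log n) atTop

end Length

/-! ### The Dirac operators on the crossed product -/

section Dirac

variable {G : Type*} [Group G]
  {V : Type*} [NormedAddCommGroup V] [InnerProductSpace ℂ V] [CompleteSpace V]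
  (ℓ : G → selfAdjoint (V →L[ℂ] V))

/-- The operator `D ⊗ 1_{ℓ²(G)} ⊗ 1_V` from `H ⊗ ℓ²(G) ⊗ V` to `K ⊗ ℓ²(G) ⊗ V`. -/
def liftOp (G V : Type*) [NormedAddCommGroup V] [InnerProductSpace ℂ V]
    {H K : Type*} [NormedAddCommGroup H] [InnerProductSpace ℂ H]
    [NormedAddCommGroup K] [InnerProductSpace ℂ K] (D : H →ₗ.[ℂ] K) :
    L2 G (H ⊗[ℂ] V) →ₗ.[ℂ] L2 G (K ⊗[ℂ] V) :=
  diagOp fun _ : G => tensorOp V D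

/-- The operator `1_H ⊗ M_ℓ` on `H ⊗ ℓ²(G) ⊗ V`: `ξ ⊗ δ_y ⊗ v ↦ ξ ⊗ δ_y ⊗ ℓ(y) v`. -/
def lengthOp (H : Type*) [NormedAddCommGroup H] [InnerProductSpace ℂ H] :
    L2 G (H ⊗[ℂ] V) →ₗ.[ℂ] L2 G (H ⊗[ℂ] V) :=
  diagOp fun y : G =>
    (((ℓ y : V →L[ℂ] V).lTensor H : H ⊗[ℂ] V →L[ℂ] H ⊗[ℂ] V) :
      H ⊗[ℂ] V →ₗ[ℂ] H ⊗[ℂ] V).toPMap ⊤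

/-- The Dirac operator of the odd-to-even case,
`(0, D ⊗ 1 ⊗ 1 - i 1 ⊗ M_ℓ; D ⊗ 1 ⊗ 1 + i 1 ⊗ M_ℓ, 0)`. -/
def diracOddToEven {H : Type*} [NormedAddCommGroup H] [InnerProductSpace ℂ H] (D : H →ₗ.[ℂ] H) :
    WithLp 2 (L2 G (H ⊗[ℂ] V) × L2 G (H ⊗[ℂ] V)) →ₗ.[ℂ]
      WithLp 2 (L2 G (H ⊗[ℂ] V) × L2 G (H ⊗[ℂ] V)) :=
  blockOp 0 (liftOp G V D - Complex.I • lengthOp ℓ H)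
    (liftOp G V D + Complex.I • lengthOp ℓ H) 0

/-- The Dirac operator of the even-to-odd case,
`(1 ⊗ M_ℓ, D⁻ ⊗ 1 ⊗ 1; D⁺ ⊗ 1 ⊗ 1, -1 ⊗ M_ℓ)`. -/
def diracEvenToOdd {Hp Hm : Type*} [NormedAddCommGroup Hp] [InnerProductSpace ℂ Hp]
    [NormedAddCommGroup Hm] [InnerProductSpace ℂ Hm]
    (Dp : Hp →ₗ.[ℂ] Hm) (Dm : Hm →ₗ.[ℂ] Hp) :
    WithLp 2 (L2 G (Hp ⊗[ℂ] V) × L2 G (Hm ⊗[ℂ] V)) →ₗ.[ℂ]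
      WithLp 2 (L2 G (Hp ⊗[ℂ] V) × L2 G (Hm ⊗[ℂ] V)) :=
  blockOp (lengthOp ℓ Hp) (liftOp G V Dm) (liftOp G V Dp) (-lengthOp ℓ Hm)

end Dirac

end TwistedTriple

end

/-!
Write `M_ℓ` for multiplication by the length function. After a unitary identification both Dirac
operators are of the form `D ⊗ 1 + J ⊗ M_ℓ`, where `J` is a self-adjoint unitary anticommuting with
`D`; an odd triple is first doubled to `(0, D; D, 0)`, with `J = (0, -i; i, 0)`. Anticommutation
kills the cross terms of the square, which is `D² ⊗ 1 + 1 ⊗ M_ℓ²` and hence diagonal in a basis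
`e_i ⊗ δ_y ⊗ v_{y,j}` with eigenvalues `κ_i + λ_{y,j}²`. This yields self-adjointness, compactness
of the resolvent, and `ζ(t) = ∑ (1 + κ_i + λ_{y,j}²)^(-t/2)`, whose abscissa of convergence is found
by summing over dyadic shells of the balls `B_n`.

The amplified regular representation is a finite multiple of the one that defines the crossed
product, so it extends. On elementary functions its commutator with the Dirac operator is bounded
because translation boundedness controls the `M_ℓ` part and the uniform bound on
`[D, π(ρ_x(a) σ_{x,y})]` the `D` part.
-/

noncomputable section

namespace TwistedTriple

/-! ### Bounded operators which are diagonal in a Hilbert basis -/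

section Diagonal

variable {𝕜 E ι : Type*} [RCLike 𝕜] [NormedAddCommGroup E] [InnerProductSpace 𝕜 E]

theorem hasSum_norm_inner_sq (w : HilbertBasis ι 𝕜 E) (x : E) :
    HasSum (fun k => ‖inner 𝕜 (w k) x‖ ^ 2) (‖x‖ ^ 2) := by
  simpa [HilbertBasis.repr_apply_apply] using lp.hasSum_norm (p := 2) (by norm_num) (w.repr x)

theorem dense_span_hilbertBasis (w : HilbertBasis ι 𝕜 E) :
    Dense (Submodule.span 𝕜 (Set.range w) : Set E) :=
  Submodule.dense_iff_topologicalClosure_eq_top.2 w.dense_span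

/-- The bounded operator `S` is diagonal in the Hilbert basis `w`, with eigenvalues `t`. -/
def IsDiagonal (w : HilbertBasis ι 𝕜 E) (t : ι → 𝕜) (S : E →L[𝕜] E) : Prop :=
  ∀ k, S (w k) = t k • w k

theorem isCompactOperator_smulRight (φ : E →L[𝕜] 𝕜) (x : E) :
    IsCompactOperator (φ.smulRight x) :=
  ((isCompactOperator_id (E := 𝕜)).comp_clm φ).clm_comp (ContinuousLinearMap.toSpanSingleton 𝕜 x)

theorem isCompactOperator_sum_smulRight (s : Finset ι) (φ : ι → E →L[𝕜] 𝕜) (x : ι → E) :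
    IsCompactOperator (∑ k ∈ s, (φ k).smulRight (x k) : E →L[𝕜] E) :=
  sum_mem (S := compactOperator (RingHom.id 𝕜) E E)
    fun k _ => isCompactOperator_smulRight (φ k) (x k)

theorem sum_smulRight_apply_hilbertBasis [DecidableEq ι] (w : HilbertBasis ι 𝕜 E) (t : ι → 𝕜)
    (s : Finset ι) (j : ι) :
    (∑ k ∈ s, (innerSL 𝕜 (w k)).smulRight (t k • w k)) (w j) = if j ∈ s then t j • w j else 0 := by
  simp only [sum_apply, ContinuousLinearMap.smulRight_apply, innerSL_apply_apply,
    orthonormal_iff_ite.1 w.orthonormal, ite_smul, one_smul, zero_smul, Finset.sum_ite_eq']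

namespace IsDiagonal

variable {w : HilbertBasis ι 𝕜 E} {t : ι → 𝕜} {S : E →L[𝕜] E}

theorem inner_apply (hS : IsDiagonal w t S) (k : ι) (x : E) :
    inner 𝕜 (w k) (S x) = t k * inner 𝕜 (w k) x := by
  have : innerSL 𝕜 (w k) ∘L S = t k • innerSL 𝕜 (w k) := by
    refine ContinuousLinearMap.ext_on (dense_span_hilbertBasis w) ?_
    rintro _ ⟨j, rfl⟩
    rcases eq_or_ne k j with rfl | hkj
    · simp [hS k]
    · simp [hS j, w.orthonormal.2 hkj]
  simpa using congrArg (fun f => f x) this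

theorem opNorm_le (hS : IsDiagonal w t S) {ε : ℝ} (hε : 0 ≤ ε) (ht : ∀ k, ‖t k‖ ≤ ε) :
    ‖S‖ ≤ ε := by
  refine S.opNorm_le_bound hε fun x => ?_
  rw [← sq_le_sq₀ (by positivity) (by positivity), mul_pow]
  refine hasSum_le (fun k => ?_) (hasSum_norm_inner_sq w (S x))
    ((hasSum_norm_inner_sq w x).mul_left (ε ^ 2))
  rw [hS.inner_apply, norm_mul, mul_pow]
  gcongr
  exact ht k

theorem isCompactOperator [CompleteSpace E] (hS : IsDiagonal w t S)
    (ht : Tendsto t cofinite (𝓝 0)) : IsCompactOperator S := by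
  classical
  let F : Finset ι → E →L[𝕜] E := fun s => ∑ k ∈ s, (innerSL 𝕜 (w k)).smulRight (t k • w k)
  suffices hF : Tendsto F atTop (𝓝 S) from
    isCompactOperator_of_tendsto hF
      (Eventually.of_forall fun s => isCompactOperator_sum_smulRight s _ _)
  rw [Metric.tendsto_atTop]
  intro ε hε
  have hfin : {k | ¬ ‖t k‖ < ε / 2}.Finite := by
    simpa using Metric.tendsto_nhds.1 ht (ε / 2) (half_pos hε)
  refine ⟨hfin.toFinset, fun s hs => ?_⟩
  have hdiff : IsDiagonal w (fun k => if k ∈ s then 0 else t k) (S - F s) := fun j => by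
    rw [sub_apply, hS, sum_smulRight_apply_hilbertBasis]
    by_cases hj : j ∈ s <;> simp [hj]
  rw [dist_eq_norm, norm_sub_rev]
  refine (hdiff.opNorm_le (half_pos hε).le fun k => ?_).trans_lt (half_lt_self hε)
  split_ifs with hk
  · simpa using (half_pos hε).le
  · by_contra hlt
    exact hk (hs (hfin.mem_toFinset.2 fun hlt' => hlt hlt'.le))

theorem norm_sub_apply_sq (hS : IsDiagonal w t S) {i j : ι} (hij : i ≠ j) :
    ‖S (w i) - S (w j)‖ ^ 2 = ‖t i‖ ^ 2 + ‖t j‖ ^ 2 := by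
  rw [hS, hS, @norm_sub_sq 𝕜, inner_smul_left, inner_smul_right, w.orthonormal.2 hij, norm_smul,
    norm_smul, w.orthonormal.1, w.orthonormal.1]
  simp

theorem tendsto_zero (hS : IsDiagonal w t S) (hc : IsCompactOperator S) :
    Tendsto t cofinite (𝓝 0) := by
  rw [Metric.tendsto_nhds]
  intro ε hε
  by_contra hinf
  have hinf : {k | ¬ dist (t k) 0 < ε}.Infinite := hinf
  let f := hinf.natEmbedding
  obtain ⟨K, hK, hSK⟩ := hc.image_closedBall_subset_compact (𝕜₁ := 𝕜) (𝕜₂ := 𝕜) 1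
  have hmem : ∀ n, S (w (f n)) ∈ K := fun n => hSK ⟨w (f n), by simp [w.orthonormal.1], rfl⟩
  obtain ⟨_, -, φ, hφ, hlim⟩ := hK.tendsto_subseq hmem
  obtain ⟨N, hN⟩ := Metric.cauchySeq_iff.1 hlim.cauchySeq ε hε
  have hne : (f (φ N) : ι) ≠ f (φ (N + 1)) := fun h =>
    N.lt_succ_self.ne (hφ.injective (f.injective (Subtype.ext h)))
  have hlt : ‖S (w (f (φ N))) - S (w (f (φ (N + 1))))‖ < ε := by
    simpa [dist_eq_norm] using hN N le_rfl (N + 1) N.le_succ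
  have hle : ε ≤ ‖t (f (φ N))‖ := by simpa using (f (φ N)).2
  have hsq := hS.norm_sub_apply_sq hne
  nlinarith [norm_nonneg (S (w (f (φ N))) - S (w (f (φ (N + 1))))), sq_nonneg ‖t (f (φ (N + 1)))‖]

theorem isCompactOperator_iff [CompleteSpace E] (hS : IsDiagonal w t S) :
    IsCompactOperator S ↔ Tendsto t cofinite (𝓝 0) :=
  ⟨hS.tendsto_zero, hS.isCompactOperator⟩

end IsDiagonal

/-! ### Eigenbases -/

theorem mem_orthogonal_of_hilbertBasis (F : Submodule 𝕜 E) (b : HilbertBasis ι 𝕜 F) {x : E}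
    (hx : ∀ i, inner 𝕜 x (b i : E) = 0) : x ∈ Fᗮ := by
  have hzero : innerSL 𝕜 x ∘L F.subtypeL = 0 := by
    refine ContinuousLinearMap.ext_on (dense_span_hilbertBasis b) ?_
    rintro _ ⟨i, rfl⟩
    simpa using hx i
  rw [Submodule.mem_orthogonal']
  intro u hu
  simpa using congrArg (fun f => f ⟨u, hu⟩) hzero

end Diagonal

theorem exists_hilbertBasis_of_orthogonalFamily.{u, v} {𝕜 : Type*} [RCLike 𝕜] {E : Type u}
    [NormedAddCommGroup E] [InnerProductSpace 𝕜 E] [CompleteSpace E] {κ : Type v}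
    {F : κ → Submodule 𝕜 E} [∀ μ, CompleteSpace (F μ)]
    (hF : OrthogonalFamily 𝕜 (fun μ => F μ) fun μ => (F μ).subtypeₗᵢ) (hperp : (⨆ μ, F μ)ᗮ = ⊥) :
    ∃ (ι : Type max u v) (w : HilbertBasis ι 𝕜 E), ∀ k, ∃ μ, w k ∈ F μ := by
  choose s b _ using fun μ => exists_hilbertBasis 𝕜 (F μ)
  have horth : Orthonormal 𝕜 fun a : (Σ μ, s μ) => ((b a.1 a.2 : F a.1) : E) :=
    hF.orthonormal_sigma_orthonormal fun μ => (b μ).orthonormal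
  have hbot : (Submodule.span 𝕜 (Set.range fun a : (Σ μ, s μ) => ((b a.1 a.2 : F a.1) : E)))ᗮ
      = ⊥ := by
    rw [eq_bot_iff, ← hperp]
    intro x hx
    rw [← Submodule.iInf_orthogonal, Submodule.mem_iInf]
    exact fun μ => mem_orthogonal_of_hilbertBasis (F μ) (b μ) fun i =>
      (Submodule.mem_orthogonal' _ _).1 hx _ (Submodule.subset_span ⟨⟨μ, i⟩, rfl⟩)
  refine ⟨_, HilbertBasis.mkOfOrthogonalEqBot horth hbot, fun a => ⟨a.1, ?_⟩⟩
  rw [HilbertBasis.coe_mkOfOrthogonalEqBot]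
  exact (b a.1 a.2).2

theorem exists_hilbertBasis_isDiagonal.{u, v} {𝕜 : Type v} [RCLike 𝕜] {E : Type u}
    [NormedAddCommGroup E] [InnerProductSpace 𝕜 E] [CompleteSpace E] {R : E →L[𝕜] E}
    (hc : IsCompactOperator R) (hR : IsSelfAdjoint R) :
    ∃ (ι : Type max u v) (w : HilbertBasis ι 𝕜 E) (r : ι → ℝ),
      IsDiagonal w (fun k => (r k : 𝕜)) R := by
  have hsymm : (R : E →ₗ[𝕜] E).IsSymmetric := hR.isSymmetric
  have hmem : ∀ μ x, x ∈ Module.End.eigenspace (R : E →ₗ[𝕜] E) μ ↔ R x = μ • x := fun μ x =>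
    Module.End.mem_eigenspace_iff
  have : ∀ μ, CompleteSpace (Module.End.eigenspace (R : E →ₗ[𝕜] E) μ) := fun μ => by
    have hclosed : IsClosed {x | R x = μ • x} :=
      isClosed_eq R.continuous (continuous_const_smul μ)
    rw [← show (Module.End.eigenspace (R : E →ₗ[𝕜] E) μ : Set E) = {x | R x = μ • x} from
      Set.ext fun x => hmem μ x] at hclosed
    exact hclosed.completeSpace_coe
  obtain ⟨ι, w, hw⟩ := exists_hilbertBasis_of_orthogonalFamily hsymm.orthogonalFamily_eigenspaces
    (ContinuousLinearMap.orthogonalComplement_iSup_eigenspaces_eq_bot hc hsymm)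
  choose μ hμ using hw
  refine ⟨ι, w, fun k => RCLike.re (μ k), fun k => ?_⟩
  have hval : Module.End.HasEigenvalue (R : E →ₗ[𝕜] E) (μ k) :=
    Module.End.hasEigenvalue_of_hasEigenvector
      (Module.End.hasEigenvector_iff.2 ⟨hμ k, w.orthonormal.ne_zero k⟩)
  have hreal := RCLike.conj_eq_iff_re.1 (hsymm.conj_eigenvalue_eq_self hval)
  simpa only [hreal] using (hmem _ _).1 (hμ k)

/-! ### Traces and powers of diagonal operators -/

theorem mem_spectrum_of_apply_eq_smul {E : Type*} [NormedAddCommGroup E] [InnerProductSpace ℂ E]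
    {a : E →L[ℂ] E} {r : ℝ} {v : E} (hv : a v = (r : ℂ) • v) (hv0 : v ≠ 0) :
    r ∈ spectrum ℝ a := by
  rw [spectrum.mem_iff]
  rintro ⟨u, hu⟩
  have hker : (u : E →L[ℂ] E) v = 0 := by
    rw [hu, sub_apply, hv, Algebra.algebraMap_eq_smul_one]
    simp
  refine hv0 ?_
  calc v = ((↑u⁻¹ * ↑u : E →L[ℂ] E)) v := by rw [Units.inv_mul]; rfl
    _ = 0 := by rw [mul_apply_eq_comp, hker, map_zero]

section Complex

variable {E : Type*} [NormedAddCommGroup E] [InnerProductSpace ℂ E] [CompleteSpace E]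

theorem IsDiagonal.posTrace_eq {ι : Type*} {w : HilbertBasis ι ℂ E} {t : ι → ℝ} {S : E →L[ℂ] E}
    (hS : IsDiagonal w (fun k => (t k : ℂ)) S) (ht : ∀ k, 0 ≤ t k) :
    posTrace S = ∑' k, ENNReal.ofReal (t k) := by
  have hexpand : ∀ x : E, ENNReal.ofReal (inner ℂ x (S x)).re
      = ∑' k, ENNReal.ofReal (t k) * ENNReal.ofReal (‖inner ℂ x (w k)‖ ^ 2) := fun x => by
    have hsum := Complex.hasSum_re (w.hasSum_inner_mul_inner x (S x))
    have hterm : ∀ k, (inner ℂ x (w k) * inner ℂ (w k) (S x)).re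
        = t k * ‖inner ℂ x (w k)‖ ^ 2 := fun k => by
      rw [hS.inner_apply, ← inner_conj_symm (w k) x, mul_left_comm, Complex.mul_conj,
        Complex.normSq_eq_norm_sq]
      norm_cast
    simp only [hterm] at hsum
    rw [← hsum.tsum_eq, ENNReal.ofReal_tsum_of_nonneg
      (fun k => mul_nonneg (ht k) (by positivity)) hsum.summable]
    exact tsum_congr fun k => ENNReal.ofReal_mul (ht k)
  rw [posTrace]
  simp only [hexpand]
  rw [ENNReal.tsum_comm]
  refine tsum_congr fun k => ?_
  rw [ENNReal.tsum_mul_left, ← ENNReal.ofReal_tsum_of_nonneg (fun _ => by positivity)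
    (hasSum_norm_inner_sq _ (w k)).summable, (hasSum_norm_inner_sq _ (w k)).tsum_eq,
    w.orthonormal.1]
  simp

theorem cfcHom_apply_of_apply_eq_smul {a : E →L[ℂ] E} (ha : IsSelfAdjoint a)
    (r : spectrum ℝ a) {v : E} (hv : a v = ((r : ℝ) : ℂ) • v) (g : C(spectrum ℝ a, ℝ)) :
    cfcHom ha g v = (g r : ℂ) • v := by
  induction g using ContinuousMap.induction_on_of_compact with
  | const c =>
    rw [show ContinuousMap.const (spectrum ℝ a) c = algebraMap ℝ _ c from rfl,
      AlgHomClass.commutes, Algebra.algebraMap_eq_smul_one]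
    simp
  | id => rw [cfcHom_id]; exact hv
  | star_id => rw [map_star, cfcHom_id, ha.star_eq]; exact hv
  | add f g hf hg =>
    rw [map_add, add_apply, hf, hg, ContinuousMap.add_apply, Complex.ofReal_add, add_smul]
  | mul f g hf hg =>
    rw [map_mul, mul_apply_eq_comp, hg, map_smul, hf, ContinuousMap.mul_apply,
      Complex.ofReal_mul, smul_smul, mul_comm]
  | frequently f h =>
    have hclosed : IsClosed {g : C(spectrum ℝ a, ℝ) | cfcHom ha g v = (g r : ℂ) • v} :=
      isClosed_eq
        ((ContinuousLinearMap.apply ℂ E v).continuous.comp (cfcHom_continuous ha))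
        ((Complex.continuous_ofReal.comp (continuous_eval_const _)).smul continuous_const)
    exact hclosed.closure_subset (mem_closure_iff_frequently.2 h)

theorem cfc_apply_of_apply_eq_smul {a : E →L[ℂ] E} (ha : IsSelfAdjoint a) {r : ℝ} {v : E}
    (hv : a v = (r : ℂ) • v) {f : ℝ → ℝ} (hf : ContinuousOn f (spectrum ℝ a)) :
    cfc f a v = (f r : ℂ) • v := by
  rcases eq_or_ne v 0 with rfl | hv0
  · simp
  rw [cfc_apply f a ha hf]
  exact cfcHom_apply_of_apply_eq_smul ha ⟨r, mem_spectrum_of_apply_eq_smul hv hv0⟩ hv _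

theorem rpow_apply_of_apply_eq_smul {a : E →L[ℂ] E} (ha : 0 ≤ a) {r : ℝ} {v : E}
    (hv : a v = (r : ℂ) • v) {s : ℝ} (hs : 0 ≤ s) : (a ^ s) v = ((r ^ s : ℝ) : ℂ) • v := by
  rw [CFC.rpow_eq_cfc_real ha]
  exact cfc_apply_of_apply_eq_smul (IsSelfAdjoint.of_nonneg ha) hv
    (Real.continuous_rpow_const hs).continuousOn

end Complex

/-! ### Symmetric operators -/

section Symmetric

theorem inner_eq_of_mem_graph {𝕜 E : Type*} [RCLike 𝕜] [NormedAddCommGroup E]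
    [InnerProductSpace 𝕜 E] {T : E →ₗ.[𝕜] E} (hT : T.IsFormalAdjoint T) {x x' y y' : E}
    (hx : (x, x') ∈ T.graph) (hy : (y, y') ∈ T.graph) : inner 𝕜 x' y = inner 𝕜 x y' := by
  obtain ⟨a, rfl, rfl⟩ := (LinearPMap.mem_graph_iff T).1 hx
  obtain ⟨b, rfl, rfl⟩ := (LinearPMap.mem_graph_iff T).1 hy
  exact hT a b

theorem isFormalAdjoint_of_forall_mem_graph {𝕜 E : Type*} [RCLike 𝕜] [NormedAddCommGroup E]
    [InnerProductSpace 𝕜 E] {T : E →ₗ.[𝕜] E}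
    (hT : ∀ x x' y y', (x, x') ∈ T.graph → (y, y') ∈ T.graph → inner 𝕜 x' y = inner 𝕜 x y') :
    T.IsFormalAdjoint T :=
  fun x y => hT x (T x) y (T y) (T.mem_graph x) (T.mem_graph y)

theorem isFormalAdjoint_of_isSelfAdjoint {𝕜 E : Type*} [RCLike 𝕜] [NormedAddCommGroup E]
    [InnerProductSpace 𝕜 E] [CompleteSpace E] {T : E →ₗ.[𝕜] E} (hT : IsSelfAdjoint T) :
    T.IsFormalAdjoint T := by
  have h := LinearPMap.adjoint_isFormalAdjoint hT.dense_domain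
  rwa [LinearPMap.isSelfAdjoint_def.1 hT] at h

variable {E : Type*} [NormedAddCommGroup E] [InnerProductSpace ℂ E] {T : E →ₗ.[ℂ] E}

theorem IsInvOneAddSq.apply_eq {R : E →L[ℂ] E} (hR : IsInvOneAddSq T R)
    (hT : T.IsFormalAdjoint T) {x u η : E} (hxu : (x, u) ∈ T.graph)
    (hux : (u, η - x) ∈ T.graph) : R η = x := by
  obtain ⟨ζ, hRζ, hζR⟩ := hR η
  have hfst : (R η - x, ζ - u) ∈ T.graph := T.graph.sub_mem hRζ hxu
  have hsnd : (ζ - u, -(R η - x)) ∈ T.graph := by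
    simpa using T.graph.sub_mem hζR hux
  have hinner := inner_eq_of_mem_graph hT hfst hsnd
  rw [inner_neg_right, inner_self_eq_norm_sq_to_K, inner_self_eq_norm_sq_to_K] at hinner
  have hnorm : ‖ζ - u‖ ^ 2 = -‖R η - x‖ ^ 2 := by exact_mod_cast hinner
  have hzero : ‖R η - x‖ ^ 2 = 0 := by nlinarith [sq_nonneg ‖ζ - u‖, sq_nonneg ‖R η - x‖]
  exact sub_eq_zero.1 (norm_eq_zero.1 (pow_eq_zero_iff two_ne_zero |>.1 hzero))

theorem IsInvOneAddSq.nonneg [CompleteSpace E] {R : E →L[ℂ] E} (hR : IsInvOneAddSq T R)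
    (hT : T.IsFormalAdjoint T) : 0 ≤ R := by
  rw [ContinuousLinearMap.nonneg_iff_isPositive]
  refine ⟨fun η θ => ?_, fun η => ?_⟩
  · obtain ⟨z, hRz, hzR⟩ := hR η
    obtain ⟨s, hRs, hsR⟩ := hR θ
    have hzs := inner_eq_of_mem_graph hT hRz hsR
    have hsz := inner_eq_of_mem_graph hT hzR hRs
    rw [inner_sub_right] at hzs
    rw [inner_sub_left] at hsz
    change inner ℂ (R η) θ = inner ℂ η (R θ)
    linear_combination -hsz - hzs
  · obtain ⟨z, hRz, hzR⟩ := hR η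
    have hinner := inner_eq_of_mem_graph hT hRz hzR
    rw [inner_sub_right, inner_self_eq_norm_sq_to_K, inner_self_eq_norm_sq_to_K] at hinner
    have hsum : inner ℂ (R η) η = ((‖z‖ ^ 2 + ‖R η‖ ^ 2 : ℝ) : ℂ) := by
      push_cast
      linear_combination -hinner
    rw [ContinuousLinearMap.reApplyInnerSelf_apply, hsum]
    change 0 ≤ ‖z‖ ^ 2 + ‖R η‖ ^ 2
    positivity

theorem norm_eq_one_of_mul_self_eq_neg_one {c : ℂ} (hc : c * c = -1) : ‖c‖ = 1 := by
  have h := congrArg norm hc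
  rw [norm_mul, norm_neg, norm_one] at h
  nlinarith [norm_nonneg c]

theorem conj_eq_neg_of_mul_self_eq_neg_one {c : ℂ} (hc : c * c = -1) :
    (starRingEnd ℂ) c = -c := by
  rw [← Complex.inv_eq_conj (norm_eq_one_of_mul_self_eq_neg_one hc)]
  exact inv_eq_of_mul_eq_one_right (by rw [mul_neg, hc, neg_neg])

theorem norm_add_smul_sq_of_mem_graph (hT : T.IsFormalAdjoint T) {c : ℂ} (hc : c * c = -1)
    {x x' : E} (hx : (x, x') ∈ T.graph) : ‖x' + c • x‖ ^ 2 = ‖x'‖ ^ 2 + ‖x‖ ^ 2 := by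
  have hconj : (starRingEnd ℂ) (c * inner ℂ x' x) = -(c * inner ℂ x' x) := by
    rw [map_mul, conj_eq_neg_of_mul_self_eq_neg_one hc, inner_conj_symm,
      ← inner_eq_of_mem_graph hT hx hx, neg_mul]
  have hre : RCLike.re (c * inner ℂ x' x) = 0 := by
    have h := congrArg Complex.re hconj
    rw [Complex.conj_re, Complex.neg_re] at h
    exact self_eq_neg.1 h
  rw [@norm_add_sq ℂ, inner_smul_right, hre, norm_smul, norm_eq_one_of_mul_self_eq_neg_one hc]
  ring

/-- The operator `T + c` as a bounded operator on the graph of `T`, `(x, T x) ↦ T x + c x`. -/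
def graphAddSMul (T : E →ₗ.[ℂ] E) (c : ℂ) : T.graph →L[ℂ] E :=
  (ContinuousLinearMap.snd ℂ E E + c • ContinuousLinearMap.fst ℂ E E) ∘L T.graph.subtypeL

theorem graphAddSMul_apply (c : ℂ) (p : T.graph) :
    graphAddSMul T c p = (p : E × E).2 + c • (p : E × E).1 := rfl

theorem norm_le_norm_graphAddSMul (hT : T.IsFormalAdjoint T) {c : ℂ} (hc : c * c = -1)
    (p : T.graph) : ‖p‖ ≤ ‖graphAddSMul T c p‖ := by
  have hsq := norm_add_smul_sq_of_mem_graph hT hc p.2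
  refine max_le ?_ ?_ <;> rw [← sq_le_sq₀ (norm_nonneg _) (norm_nonneg _), graphAddSMul_apply, hsq]
  · exact le_add_of_nonneg_left (sq_nonneg _)
  · exact le_add_of_nonneg_right (sq_nonneg _)

theorem isClosed_range_graphAddSMul [CompleteSpace E] (hT : T.IsFormalAdjoint T)
    (hcl : T.IsClosed) {c : ℂ} (hc : c * c = -1) : IsClosed (Set.range (graphAddSMul T c)) := by
  have : CompleteSpace T.graph := IsClosed.completeSpace_coe (hs := hcl)
  have hanti : AntilipschitzWith 1 (graphAddSMul T c) :=
    AddMonoidHomClass.antilipschitz_of_bound _ fun p => by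
      simpa using norm_le_norm_graphAddSMul hT hc p
  exact hanti.isClosed_range (graphAddSMul T c).uniformContinuous

theorem isSelfAdjoint_of_surjective_graphAddSMul [CompleteSpace E] (hT : T.IsFormalAdjoint T)
    (hd : Dense (T.domain : Set E)) (hI : Function.Surjective (graphAddSMul T Complex.I))
    (hnegI : Function.Surjective (graphAddSMul T (-Complex.I))) : IsSelfAdjoint T := by
  rw [LinearPMap.isSelfAdjoint_def]
  refine le_antisymm (LinearPMap.le_of_le_graph ?_) (hT.le_adjoint hd)
  rw [LinearPMap.adjoint_graph_eq_graph_adjoint hd]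
  rintro ⟨y, y'⟩ hy
  obtain ⟨⟨⟨x, x'⟩, hx⟩, hxy : x' + Complex.I • x = y' + Complex.I • y⟩ := hI (y' + Complex.I • y)
  obtain ⟨⟨⟨a, a'⟩, ha⟩, haz : a' + -Complex.I • a = y - x⟩ := hnegI (y - x)
  have hyx : y = x := by
    have hadj : inner ℂ a' y = inner ℂ a y' :=
      sub_eq_zero.1 ((Submodule.mem_adjoint_iff _ _).1 hy a a' ha)
    have hsymm := inner_eq_of_mem_graph hT ha hx
    rw [eq_sub_of_add_eq hxy, inner_sub_right, inner_add_right, inner_smul_right,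
      inner_smul_right] at hsymm
    rw [← sub_eq_zero, ← inner_self_eq_zero (𝕜 := ℂ)]
    nth_rewrite 1 [← haz]
    rw [inner_add_left, inner_smul_left, inner_sub_right, inner_sub_right]
    simp only [map_neg, Complex.conj_I, neg_neg]
    linear_combination hadj - hsymm
  subst hyx
  rwa [← add_right_cancel hxy]

end Symmetric

/-! ### Unbounded operators whose square is diagonal in a Hilbert basis -/

/-- The Dirichlet series `∑ (1 + κ_i) ^ (-t / 2)`, which is `ζ_T(t)` when `T²` is diagonal with
eigenvalues `κ`. -/
def zetaSum {ι : Type*} (κ : ι → ℝ) (t : ℝ) : ℝ≥0∞ :=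
  ∑' i, ENNReal.ofReal ((1 + κ i) ^ (-(t / 2)))

section SqDiagonal

variable {E ι : Type*} [NormedAddCommGroup E] [InnerProductSpace ℂ E]

/-- `T` is a closed symmetric operator and `w` is a Hilbert basis with `T² w_k = κ_k w_k`. All
spectral data of `T` needed for a spectral triple depend only on the family `κ`. -/
structure IsSqDiagonal (T : E →ₗ.[ℂ] E) (w : HilbertBasis ι ℂ E) (κ : ι → ℝ) : Prop where
  symm : T.IsFormalAdjoint T
  closed : T.IsClosed
  sq : ∀ k, ∃ u, (w k, u) ∈ T.graph ∧ (u, (κ k : ℂ) • w k) ∈ T.graph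

namespace IsSqDiagonal

variable {T : E →ₗ.[ℂ] E} {w : HilbertBasis ι ℂ E} {κ : ι → ℝ}

theorem nonneg (h : IsSqDiagonal T w κ) (k : ι) : 0 ≤ κ k := by
  obtain ⟨u, hwu, huw⟩ := h.sq k
  have hinner := inner_eq_of_mem_graph h.symm hwu huw
  rw [inner_smul_right, inner_self_eq_norm_sq_to_K, inner_self_eq_norm_sq_to_K,
    w.orthonormal.1] at hinner
  have hnorm : ‖u‖ ^ 2 = κ k := by
    have : ((‖u‖ ^ 2 : ℝ) : ℂ) = κ k := by push_cast; simpa using hinner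
    exact_mod_cast this
  exact hnorm ▸ sq_nonneg ‖u‖

theorem one_add_pos (h : IsSqDiagonal T w κ) (k : ι) : 0 < 1 + κ k := by
  linarith [h.nonneg k]

theorem one_add_ne_zero (h : IsSqDiagonal T w κ) (k : ι) : (1 + κ k : ℂ) ≠ 0 := by
  exact_mod_cast (h.one_add_pos k).ne'

theorem dense_domain (h : IsSqDiagonal T w κ) : Dense (T.domain : Set E) := by
  refine (dense_span_hilbertBasis w).mono ?_
  suffices Submodule.span ℂ (Set.range w) ≤ T.domain from this
  rw [Submodule.span_le]
  rintro _ ⟨k, rfl⟩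
  obtain ⟨u, hwu, -⟩ := h.sq k
  exact LinearPMap.mem_domain_of_mem_graph hwu

-- `(T + c) ((T - c) w_k) = (κ_k - c²) w_k = (1 + κ_k) w_k`.
theorem mem_range_graphAddSMul (h : IsSqDiagonal T w κ) {c : ℂ} (hc : c * c = -1) (k : ι) :
    w k ∈ LinearMap.range (graphAddSMul T c : T.graph →ₗ[ℂ] E) := by
  obtain ⟨u, hwu, huw⟩ := h.sq k
  have hmem : (u - c • w k, (κ k : ℂ) • w k - c • u) ∈ T.graph :=
    T.graph.sub_mem huw (T.graph.smul_mem c hwu)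
  have heq : (κ k : ℂ) • w k - c • u + c • (u - c • w k) = (1 + κ k : ℂ) • w k := by
    rw [smul_sub, smul_smul, hc]
    module
  refine ⟨(1 + κ k : ℂ)⁻¹ • ⟨_, hmem⟩, ?_⟩
  rw [ContinuousLinearMap.coe_coe, map_smul, graphAddSMul_apply, heq,
    inv_smul_smul₀ (h.one_add_ne_zero k)]

variable [CompleteSpace E]

theorem surjective_graphAddSMul (h : IsSqDiagonal T w κ) {c : ℂ} (hc : c * c = -1) :
    Function.Surjective (graphAddSMul T c) := by
  have hle : Submodule.span ℂ (Set.range w) ≤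
      LinearMap.range (graphAddSMul T c : T.graph →ₗ[ℂ] E) := by
    rw [Submodule.span_le]
    rintro _ ⟨k, rfl⟩
    exact h.mem_range_graphAddSMul hc k
  rw [← Set.range_eq_univ, ← (isClosed_range_graphAddSMul h.symm h.closed hc).closure_eq]
  exact ((dense_span_hilbertBasis w).mono hle).closure_eq

theorem isSelfAdjoint (h : IsSqDiagonal T w κ) : IsSelfAdjoint T :=
  isSelfAdjoint_of_surjective_graphAddSMul h.symm h.dense_domain
    (h.surjective_graphAddSMul Complex.I_mul_I) (h.surjective_graphAddSMul (by simp))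

theorem isInvOneAddSq (h : IsSqDiagonal T w κ) : IsInvOneAddSq T (invOneAddSq T) :=
  isInvOneAddSq_invOneAddSq h.isSelfAdjoint

theorem isDiagonal_invOneAddSq (h : IsSqDiagonal T w κ) :
    IsDiagonal w (fun k => (((1 + κ k)⁻¹ : ℝ) : ℂ)) (invOneAddSq T) := by
  intro k
  obtain ⟨u, hwu, huw⟩ := h.sq k
  refine h.isInvOneAddSq.apply_eq h.symm (T.graph.smul_mem _ hwu) ?_
  have hk := h.one_add_ne_zero k
  have hsub : w k - (((1 + κ k)⁻¹ : ℝ) : ℂ) • w k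
      = (((1 + κ k)⁻¹ : ℝ) : ℂ) • (κ k : ℂ) • w k := by
    rw [smul_smul, ← sub_eq_zero]
    match_scalars
    field_simp
    ring
  rw [hsub]
  exact T.graph.smul_mem _ huw

theorem isDiagonal_rpow (h : IsSqDiagonal T w κ) {s : ℝ} (hs : 0 ≤ s) :
    IsDiagonal w (fun k => (((1 + κ k) ^ (-s) : ℝ) : ℂ)) (invOneAddSq T ^ s) := fun k => by
  rw [rpow_apply_of_apply_eq_smul (h.isInvOneAddSq.nonneg h.symm) (h.isDiagonal_invOneAddSq k) hs,
    Real.inv_rpow (h.one_add_pos k).le, ← Real.rpow_neg (h.one_add_pos k).le]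

theorem zeta_eq (h : IsSqDiagonal T w κ) {t : ℝ} (ht : 0 < t) :
    zeta T t = zetaSum κ t :=
  (h.isDiagonal_rpow (by positivity)).posTrace_eq fun k => Real.rpow_nonneg (h.one_add_pos k).le _

theorem isCompactOperator_iff (h : IsSqDiagonal T w κ) :
    IsCompactOperator (invOneAddSq T ^ (1 / 2 : ℝ)) ↔ Tendsto κ cofinite atTop := by
  rw [(h.isDiagonal_rpow (by positivity)).isCompactOperator_iff]
  have hval : ∀ k, (1 + κ k) ^ (-(1 / 2) : ℝ) = (√(1 + κ k))⁻¹ := fun k => by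
    rw [Real.rpow_neg (h.one_add_pos k).le, Real.sqrt_eq_rpow]
  simp only [hval, tendsto_zero_iff_norm_tendsto_zero (f := fun k => (((√(1 + κ k))⁻¹ : ℝ) : ℂ)),
    Complex.norm_real, ← tendsto_zero_iff_norm_tendsto_zero]
  constructor
  · intro hlim
    have hpos : ∀ᶠ k in cofinite, (√(1 + κ k))⁻¹ ∈ Set.Ioi (0 : ℝ) :=
      Eventually.of_forall fun k => inv_pos.2 (Real.sqrt_pos.2 (h.one_add_pos k))
    have hsqrt := (tendsto_nhdsWithin_iff.2 ⟨hlim, hpos⟩).inv_tendsto_nhdsGT_zero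
    have hsq := (tendsto_pow_atTop two_ne_zero).comp hsqrt
    refine (tendsto_atTop_add_const_left _ (-1) hsq).congr fun k => ?_
    simp [Real.sq_sqrt (h.one_add_pos k).le]
  · intro hlim
    exact (Real.tendsto_sqrt_atTop.comp
      (tendsto_atTop_add_const_left _ 1 hlim)).inv_tendsto_atTop

end IsSqDiagonal

theorem isCompactOperator_invOneAddSq [CompleteSpace E] {T : E →ₗ.[ℂ] E} (hT : IsSelfAdjoint T)
    (hc : IsCompactOperator (invOneAddSq T ^ (1 / 2 : ℝ))) : IsCompactOperator (invOneAddSq T) := by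
  have hnonneg := (isInvOneAddSq_invOneAddSq hT).nonneg (isFormalAdjoint_of_isSelfAdjoint hT)
  have hsq : invOneAddSq T ^ (1 / 2 : ℝ) * invOneAddSq T ^ (1 / 2 : ℝ) = invOneAddSq T := by
    rw [← CFC.sqrt_eq_rpow, CFC.sqrt_mul_sqrt_self _ hnonneg]
  rw [← hsq]
  exact hc.comp_clm (invOneAddSq T ^ (1 / 2 : ℝ))

theorem IsInvOneAddSq.exists_sq_of_apply_eq_smul {T : E →ₗ.[ℂ] E} {R : E →L[ℂ] E}
    (hR : IsInvOneAddSq T R) {r : ℝ} {v : E} (hv : R v = (r : ℂ) • v) (hv0 : v ≠ 0) :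
    ∃ u, (v, u) ∈ T.graph ∧ (u, ((r⁻¹ - 1 : ℝ) : ℂ) • v) ∈ T.graph := by
  obtain ⟨ζ, hvζ, hζv⟩ := hR v
  rw [hv] at hvζ hζv
  have hr : (r : ℂ) ≠ 0 := by
    intro hr
    rw [hr, zero_smul] at hvζ hζv
    have hζ : ζ = 0 := T.graph_fst_eq_zero_snd hvζ rfl
    rw [hζ, sub_zero] at hζv
    exact hv0 (T.graph_fst_eq_zero_snd hζv rfl)
  refine ⟨(r : ℂ)⁻¹ • ζ, ?_, ?_⟩
  · have hsmul := T.graph.smul_mem (r : ℂ)⁻¹ hvζ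
    rwa [Prod.smul_mk, smul_smul, inv_mul_cancel₀ hr, one_smul] at hsmul
  · have hsmul := T.graph.smul_mem (r : ℂ)⁻¹ hζv
    rw [Prod.smul_mk, smul_sub, smul_smul, inv_mul_cancel₀ hr, one_smul] at hsmul
    push_cast
    rwa [sub_smul, one_smul]

end SqDiagonal

theorem exists_isSqDiagonal.{u} {E : Type u} [NormedAddCommGroup E] [InnerProductSpace ℂ E]
    [CompleteSpace E] {T : E →ₗ.[ℂ] E} (hT : IsSelfAdjoint T)
    (hc : IsCompactOperator (invOneAddSq T ^ (1 / 2 : ℝ))) :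
    ∃ (ι : Type u) (w : HilbertBasis ι ℂ E) (κ : ι → ℝ), IsSqDiagonal T w κ := by
  have hsymm := isFormalAdjoint_of_isSelfAdjoint hT
  have hinv := isInvOneAddSq_invOneAddSq hT
  obtain ⟨ι, w, r, hr⟩ := exists_hilbertBasis_isDiagonal (isCompactOperator_invOneAddSq hT hc)
    (IsSelfAdjoint.of_nonneg (hinv.nonneg hsymm))
  exact ⟨ι, w, fun k => (r k)⁻¹ - 1, hsymm, hT.isClosed, fun k =>
    hinv.exists_sq_of_apply_eq_smul (hr k) (w.orthonormal.ne_zero k)⟩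

/-! ### Slices of tensors and the operator `D ⊗ 1` -/

section Slice

variable {X : Type*} [NormedAddCommGroup X] [InnerProductSpace ℂ X]
  {Y : Type*} [NormedAddCommGroup Y] [InnerProductSpace ℂ Y]
  {V : Type*} [NormedAddCommGroup V] [InnerProductSpace ℂ V]

/-- The slice map `x ⊗ u ↦ ⟨v, u⟩ x`, which reads off the component of a tensor along `v`. -/
def slice (v : V) : X ⊗[ℂ] V →L[ℂ] X :=
  ((TensorProduct.ridIsometry ℂ X).toContinuousLinearEquiv : X ⊗[ℂ] ℂ →L[ℂ] X) ∘L
    (innerSL ℂ v).lTensor X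

@[simp]
theorem slice_tmul (v u : V) (x : X) : slice v (x ⊗ₜ[ℂ] u) = inner ℂ v u • x := by
  simp [slice]

theorem sum_slice_tmul {n : Type*} [Fintype n] (b : OrthonormalBasis n ℂ V) (z : X ⊗[ℂ] V) :
    ∑ i, slice (b i) z ⊗ₜ[ℂ] b i = z := by
  induction z using TensorProduct.induction_on with
  | zero => simp
  | add x y hx hy =>
    simp only [map_add, TensorProduct.add_tmul, Finset.sum_add_distrib, hx, hy]
  | tmul h v =>
    simp only [slice_tmul, TensorProduct.smul_tmul, ← TensorProduct.tmul_sum]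
    rw [b.sum_repr' v]

theorem inner_tmul_left_eq (x : X) (v : V) (z : X ⊗[ℂ] V) :
    inner ℂ (x ⊗ₜ[ℂ] v) z = inner ℂ x (slice v z) := by
  induction z using TensorProduct.induction_on with
  | zero => simp
  | add x y hx hy => simp only [map_add, inner_add_right, hx, hy]
  | tmul y u => rw [TensorProduct.inner_tmul, slice_tmul, inner_smul_right, mul_comm]

theorem inner_eq_sum_slice {n : Type*} [Fintype n] (b : OrthonormalBasis n ℂ V)
    (z z' : X ⊗[ℂ] V) : inner ℂ z z' = ∑ i, inner ℂ (slice (b i) z) (slice (b i) z') := by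
  conv_lhs => rw [← sum_slice_tmul b z]
  rw [sum_inner]
  exact Finset.sum_congr rfl fun i _ => inner_tmul_left_eq _ _ _

theorem slice_rTensor (S : X →L[ℂ] Y) (v : V) (z : X ⊗[ℂ] V) :
    slice v (S.rTensor V z) = S (slice v z) := by
  induction z using TensorProduct.induction_on with
  | zero => simp
  | add x y hx hy => simp only [map_add, hx, hy]
  | tmul y u => rw [ContinuousLinearMap.rTensor_tmul, slice_tmul, slice_tmul, map_smul]

theorem slice_lTensor [CompleteSpace V] (L : V →L[ℂ] V) (v : V) (z : X ⊗[ℂ] V) :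
    slice v (L.lTensor X z) = slice (ContinuousLinearMap.adjoint L v) z := by
  induction z using TensorProduct.induction_on with
  | zero => simp
  | add x y hx hy => simp only [map_add, hx, hy]
  | tmul y u =>
    rw [ContinuousLinearMap.lTensor_tmul, slice_tmul, slice_tmul,
      ContinuousLinearMap.adjoint_inner_left]

theorem rTensor_lTensor_apply (S : X →L[ℂ] Y) (L : V →L[ℂ] V) (z : X ⊗[ℂ] V) :
    S.rTensor V (L.lTensor X z) = L.lTensor Y (S.rTensor V z) :=
  DFunLike.congr_fun ((ContinuousLinearMap.rTensor_comp_lTensor S L).trans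
    (ContinuousLinearMap.lTensor_comp_rTensor L S).symm) z

theorem slice_mem_graph_of_mem_span {D : X →ₗ.[ℂ] Y} {p : (X ⊗[ℂ] V) × (Y ⊗[ℂ] V)}
    (hp : p ∈ Submodule.span ℂ {p : (X ⊗[ℂ] V) × (Y ⊗[ℂ] V) |
      ∃ (ξ : D.domain) (v : V), p = ((ξ : X) ⊗ₜ[ℂ] v, D ξ ⊗ₜ[ℂ] v)}) (v : V) :
    (slice v p.1, slice v p.2) ∈ D.graph := by
  induction hp using Submodule.span_induction with
  | mem p hp =>
    obtain ⟨ξ, u, rfl⟩ := hp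
    simp only [slice_tmul]
    exact D.graph.smul_mem (inner ℂ v u) (D.mem_graph ξ)
  | zero => simp
  | add p q _ _ hp hq => simpa using D.graph.add_mem hp hq
  | smul c p _ hp => simpa using D.graph.smul_mem c hp

variable [FiniteDimensional ℂ V]

theorem eq_zero_of_forall_slice_eq_zero {z : X ⊗[ℂ] V} (hz : ∀ v : V, slice v z = 0) : z = 0 := by
  rw [← sum_slice_tmul (stdOrthonormalBasis ℂ V) z]
  simp [hz]

theorem graph_tensorOp (D : X →ₗ.[ℂ] Y) :
    (tensorOp V D).graph = Submodule.span ℂ {p : (X ⊗[ℂ] V) × (Y ⊗[ℂ] V) |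
      ∃ (ξ : D.domain) (v : V), p = ((ξ : X) ⊗ₜ[ℂ] v, D ξ ⊗ₜ[ℂ] v)} :=
  Submodule.toLinearPMap_graph_eq _ fun _ hp hp0 => eq_zero_of_forall_slice_eq_zero fun v =>
    D.graph_fst_eq_zero_snd (slice_mem_graph_of_mem_span hp v) (by rw [hp0, map_zero])

theorem mem_graph_tensorOp {D : X →ₗ.[ℂ] Y} {p : (X ⊗[ℂ] V) × (Y ⊗[ℂ] V)} :
    p ∈ (tensorOp V D).graph ↔ ∀ v : V, (slice v p.1, slice v p.2) ∈ D.graph := by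
  rw [graph_tensorOp]
  refine ⟨slice_mem_graph_of_mem_span, fun hp => ?_⟩
  let b := stdOrthonormalBasis ℂ V
  have hsum : p = ∑ i, (slice (b i) p.1 ⊗ₜ[ℂ] b i, slice (b i) p.2 ⊗ₜ[ℂ] b i) := by
    refine Prod.ext ?_ ?_
    · rw [Prod.fst_sum, sum_slice_tmul]
    · rw [Prod.snd_sum, sum_slice_tmul]
  rw [hsum]
  refine sum_mem fun i _ => Submodule.subset_span ?_
  obtain ⟨x, hx, hDx⟩ := D.mem_graph_iff.1 (hp (b i))
  exact ⟨x, b i, by rw [hx, hDx]⟩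

theorem tmul_mem_graph_tensorOp {D : X →ₗ.[ℂ] Y} {x : X} {x' : Y} (hx : (x, x') ∈ D.graph)
    (v : V) : (x ⊗ₜ[ℂ] v, x' ⊗ₜ[ℂ] v) ∈ (tensorOp V D).graph := by
  rw [mem_graph_tensorOp]
  intro u
  simp only [slice_tmul]
  exact D.graph.smul_mem _ hx

theorem lTensor_mem_graph_tensorOp [CompleteSpace V] {D : X →ₗ.[ℂ] Y} (L : V →L[ℂ] V)
    {z : X ⊗[ℂ] V} {z' : Y ⊗[ℂ] V} (hz : (z, z') ∈ (tensorOp V D).graph) :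
    (L.lTensor X z, L.lTensor Y z') ∈ (tensorOp V D).graph := by
  rw [mem_graph_tensorOp] at hz ⊢
  intro v
  simpa only [slice_lTensor] using hz (ContinuousLinearMap.adjoint L v)

theorem isClosed_tensorOp {D : X →ₗ.[ℂ] Y} (hD : D.IsClosed) : (tensorOp V D).IsClosed := by
  have hgraph : ((tensorOp V D).graph : Set ((X ⊗[ℂ] V) × (Y ⊗[ℂ] V)))
      = ⋂ v : V, (fun p => (slice v p.1, slice v p.2)) ⁻¹' D.graph := by
    ext p
    rw [Set.mem_iInter]
    exact mem_graph_tensorOp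
  rw [LinearPMap.IsClosed, hgraph]
  exact isClosed_iInter fun v => IsClosed.preimage (by fun_prop) hD

theorem isFormalAdjoint_tensorOp {D : X →ₗ.[ℂ] X} (hD : D.IsFormalAdjoint D) :
    (tensorOp V D).IsFormalAdjoint (tensorOp V D) :=
  isFormalAdjoint_of_forall_mem_graph fun x x' y y' hx hy => by
    rw [inner_eq_sum_slice (stdOrthonormalBasis ℂ V), inner_eq_sum_slice (stdOrthonormalBasis ℂ V)]
    exact Finset.sum_congr rfl fun i _ =>
      inner_eq_of_mem_graph hD (mem_graph_tensorOp.1 hx _) (mem_graph_tensorOp.1 hy _)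

end Slice

/-! ### Pointwise operators on `ℓ²(G, K)` -/

section Pointwise

variable {G : Type*} {K : Type*} [NormedAddCommGroup K]

theorem summable_norm_sq (ξ : L2 G K) : Summable fun y => ‖ξ y‖ ^ 2 := by
  simpa using (memℓp_gen_iff (p := 2) (by norm_num)).1 (lp.memℓp ξ)

theorem norm_sq_eq_tsum (ξ : L2 G K) : ‖ξ‖ ^ 2 = ∑' y, ‖ξ y‖ ^ 2 := by
  simpa using lp.norm_rpow_eq_tsum (p := 2) (by norm_num) ξ

variable [InnerProductSpace ℂ K] {K' : Type*} [NormedAddCommGroup K'] [InnerProductSpace ℂ K']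

theorem memℓp_two_apply (S : K →L[ℂ] K') (ξ : L2 G K) : Memℓp (fun y => S (ξ y)) 2 := by
  have hsum : Summable fun y => ‖S (ξ y)‖ ^ 2 :=
    Summable.of_nonneg_of_le (fun _ => by positivity)
      (fun y => by rw [← mul_pow]; gcongr; exact S.le_opNorm _)
      ((summable_norm_sq ξ).mul_left (‖S‖ ^ 2))
  exact memℓp_gen (by simpa using hsum)

/-- The operator `1 ⊗ S` from `ℓ²(G) ⊗ K = ℓ²(G, K)` to `ℓ²(G, K')`. -/
def lmap (S : K →L[ℂ] K') : L2 G K →L[ℂ] L2 G K' :=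
  LinearMap.mkContinuous
    { toFun := fun ξ => ⟨fun y => S (ξ y), memℓp_two_apply S ξ⟩
      map_add' := fun ξ η => by ext y; exact S.map_add _ _
      map_smul' := fun z ξ => by ext y; exact S.map_smul _ _ }
    ‖S‖ fun ξ => by
      rw [← sq_le_sq₀ (norm_nonneg _) (by positivity), mul_pow, norm_sq_eq_tsum, norm_sq_eq_tsum,
        ← tsum_mul_left]
      refine Summable.tsum_le_tsum (fun y => ?_) (summable_norm_sq _)
        ((summable_norm_sq ξ).mul_left (‖S‖ ^ 2))
      rw [← mul_pow]
      gcongr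
      exact S.le_opNorm _

@[simp]
theorem lmap_apply (S : K →L[ℂ] K') (ξ : L2 G K) (y : G) : lmap S ξ y = S (ξ y) := rfl

theorem inner_lmap [CompleteSpace K] [CompleteSpace K'] (S : K →L[ℂ] K') (ξ : L2 G K)
    (η : L2 G K') :
    inner ℂ (lmap S ξ) η = inner ℂ ξ (lmap (ContinuousLinearMap.adjoint S) η) := by
  rw [lp.inner_eq_tsum, lp.inner_eq_tsum]
  exact tsum_congr fun y => (ContinuousLinearMap.adjoint_inner_right _ _ _).symm

theorem lmap_single [DecidableEq G] (S : K →L[ℂ] K') (y : G) (x : K) :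
    lmap S (lp.single 2 y x : L2 G K) = lp.single 2 y (S x) := by
  ext z
  rw [lmap_apply, lp.single_apply, lp.single_apply]
  by_cases hz : z = y
  · subst hz; simp
  · simp [hz]

end Pointwise

/-! ### Commutators with an unbounded operator -/

section Commutator

variable {H : Type*} [NormedAddCommGroup H] [InnerProductSpace ℂ H] {D : H →ₗ.[ℂ] H}

theorem isCommutator_iff {S T : H →L[ℂ] H} :
    IsCommutator D S T ↔ ∀ x x', (x, x') ∈ D.graph → (S x, S x' + T x) ∈ D.graph := by
  constructor
  · intro hcomm x x' hx
    obtain ⟨y, rfl, rfl⟩ := D.mem_graph_iff.1 hx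
    obtain ⟨hy, hy'⟩ := hcomm y
    rw [← hy', add_sub_cancel]
    exact D.mem_graph ⟨_, hy⟩
  · intro hgraph ξ
    have hSξ := hgraph _ _ (D.mem_graph ξ)
    have hmem : S ξ ∈ D.domain := LinearPMap.mem_domain_of_mem_graph hSξ
    refine ⟨hmem, ?_⟩
    rw [D.mem_graph_snd_inj (D.mem_graph ⟨S ξ, hmem⟩) hSξ rfl, add_sub_cancel_left]

theorem isCommutator_sum {ι : Type*} (s : Finset ι) {S T : ι → H →L[ℂ] H}
    (hcomm : ∀ i ∈ s, IsCommutator D (S i) (T i)) :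
    IsCommutator D (∑ i ∈ s, S i) (∑ i ∈ s, T i) := by
  rw [isCommutator_iff]
  intro x x' hx
  have hsum : ((∑ i ∈ s, S i) x, (∑ i ∈ s, S i) x' + (∑ i ∈ s, T i) x)
      = ∑ i ∈ s, (S i x, S i x' + T i x) := by
    refine Prod.ext ?_ ?_
    · simp [Prod.fst_sum]
    · simp [Prod.snd_sum, Finset.sum_add_distrib]
  rw [hsum]
  exact sum_mem fun i hi => isCommutator_iff.1 (hcomm i hi) _ _ hx

end Commutator

/-! ### The operator `D ⊗ 1 + J ⊗ M_ℓ` -/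

/-- `J` is a self-adjoint unitary which anticommutes with `D`. -/
structure IsAnticommuting {X : Type*} [NormedAddCommGroup X] [InnerProductSpace ℂ X]
    [CompleteSpace X] (D : X →ₗ.[ℂ] X) (J : X →L[ℂ] X) : Prop where
  adjoint : ContinuousLinearMap.adjoint J = J
  sq : ∀ x, J (J x) = x
  anticomm : ∀ x x', (x, x') ∈ D.graph → (J x, -J x') ∈ D.graph

section Model

variable {G : Type*} {X : Type*} [NormedAddCommGroup X] [InnerProductSpace ℂ X]
  {V : Type*} [NormedAddCommGroup V] [InnerProductSpace ℂ V] [CompleteSpace V]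
  {E : Type*} [NormedAddCommGroup E] [InnerProductSpace ℂ E]

/-- The triples `(ξ, (D ⊗ 1) ξ, (1 ⊗ M_ℓ) ξ)` with `ξ` in the domain of both operators. -/
def diracTriples (ℓ : G → selfAdjoint (V →L[ℂ] V)) (D : X →ₗ.[ℂ] X) :
    Submodule ℂ (L2 G (X ⊗[ℂ] V) × L2 G (X ⊗[ℂ] V) × L2 G (X ⊗[ℂ] V)) where
  carrier := {p | (∀ y, (p.1 y, p.2.1 y) ∈ (tensorOp V D).graph) ∧
    ∀ y, p.2.2 y = (ℓ y : V →L[ℂ] V).lTensor X (p.1 y)}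
  add_mem' hp hq := ⟨fun y => (tensorOp V D).graph.add_mem (hp.1 y) (hq.1 y), fun y => by
    change _ + _ = ContinuousLinearMap.lTensor X _ (_ + _)
    rw [map_add, hp.2, hq.2]⟩
  zero_mem' := ⟨fun _ => (tensorOp V D).graph.zero_mem, fun _ => (map_zero _).symm⟩
  smul_mem' c p hp := ⟨fun y => (tensorOp V D).graph.smul_mem c (hp.1 y), fun y => by
    change c • p.2.2 y = ContinuousLinearMap.lTensor X _ (c • p.1 y)
    rw [map_smul, hp.2]⟩

/-- The unitary `U` transforms `T` to the operator `D ⊗ 1 + J ⊗ M_ℓ` on `ℓ²(G, X ⊗ V)`, with domain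
the intersection of the domains of `D ⊗ 1` and `1 ⊗ M_ℓ`. -/
def IsDiracModel (ℓ : G → selfAdjoint (V →L[ℂ] V)) (D : X →ₗ.[ℂ] X) (J : X →L[ℂ] X)
    (T : E →ₗ.[ℂ] E) (U : E ≃ₗᵢ[ℂ] L2 G (X ⊗[ℂ] V)) : Prop :=
  ∀ ξ ξ', (ξ, ξ') ∈ T.graph ↔
    ∃ u m : L2 G (X ⊗[ℂ] V), (U ξ, u, m) ∈ diracTriples ℓ D ∧ U ξ' = u + lmap (J.rTensor V) m

variable {ℓ : G → selfAdjoint (V →L[ℂ] V)} {D : X →ₗ.[ℂ] X} {J : X →L[ℂ] X}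
  {T : E →ₗ.[ℂ] E} {U : E ≃ₗᵢ[ℂ] L2 G (X ⊗[ℂ] V)}

theorem mem_diracTriples {ξ u m : L2 G (X ⊗[ℂ] V)} :
    (ξ, u, m) ∈ diracTriples ℓ D ↔ (∀ y, (ξ y, u y) ∈ (tensorOp V D).graph) ∧
      ∀ y, m y = (ℓ y : V →L[ℂ] V).lTensor X (ξ y) :=
  Iff.rfl

theorem IsDiracModel.single_mem_graph [DecidableEq G] (hT : IsDiracModel ℓ D J T U) (y : G)
    {a b : X ⊗[ℂ] V} (hab : (a, b) ∈ (tensorOp V D).graph) :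
    (U.symm (lp.single 2 y a), U.symm (lp.single 2 y
      (b + J.rTensor V ((ℓ y : V →L[ℂ] V).lTensor X a)))) ∈ T.graph := by
  rw [hT]
  refine ⟨lp.single 2 y b, lp.single 2 y ((ℓ y : V →L[ℂ] V).lTensor X a),
    mem_diracTriples.2 ⟨fun z => ?_, fun z => ?_⟩, ?_⟩
  · rw [U.apply_symm_apply, lp.single_apply, lp.single_apply]
    by_cases hz : z = y
    · subst hz; simpa using hab
    · simp [hz]
  · rw [U.apply_symm_apply, lp.single_apply, lp.single_apply]
    by_cases hz : z = y
    · subst hz; simp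
    · simp [hz]
  · rw [U.apply_symm_apply, lmap_single, lp.single_add]

theorem isClosed_diracTriples [FiniteDimensional ℂ V] (hD : D.IsClosed) :
    IsClosed (diracTriples ℓ D : Set (L2 G (X ⊗[ℂ] V) × L2 G (X ⊗[ℂ] V) × L2 G (X ⊗[ℂ] V))) := by
  have heval (y : G) : Continuous fun ξ : L2 G (X ⊗[ℂ] V) => ξ y :=
    (lp.evalCLM ℂ (fun _ : G => X ⊗[ℂ] V) 2 y).continuous
  simp only [diracTriples, Submodule.coe_set_mk, AddSubmonoid.coe_set_mk, Set.ofPred_and,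
    Set.ofPred_forall]
  refine (isClosed_iInter fun y => ?_).inter (isClosed_iInter fun y => ?_)
  · exact IsClosed.preimage (((heval y).comp continuous_fst).prodMk
      ((heval y).comp (continuous_fst.comp continuous_snd))) (isClosed_tensorOp hD)
  · exact isClosed_eq ((heval y).comp (continuous_snd.comp continuous_snd))
      (((ℓ y : V →L[ℂ] V).lTensor X).continuous.comp ((heval y).comp continuous_fst))

theorem IsDiracModel.graph_eq_range (hT : IsDiracModel ℓ D J T U) :
    (T.graph : Set (E × E)) = Set.range fun p : diracTriples ℓ D =>
      (U.symm p.1.1, U.symm (p.1.2.1 + lmap (J.rTensor V) p.1.2.2)) := by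
  ext ⟨ξ, ξ'⟩
  refine (hT ξ ξ').trans ⟨?_, ?_⟩
  · rintro ⟨u, m, hum, hξ'⟩
    exact ⟨⟨(U ξ, u, m), hum⟩, by simp [← hξ']⟩
  · rintro ⟨⟨⟨ζ, u, m⟩, hum⟩, hp⟩
    obtain ⟨rfl, rfl⟩ := Prod.mk.injEq .. ▸ hp
    exact ⟨u, m, by rwa [U.apply_symm_apply], U.apply_symm_apply _⟩

section Anticommuting

variable [CompleteSpace X] [FiniteDimensional ℂ V]

namespace IsAnticommuting

theorem rTensor_rTensor_apply {V : Type*} [NormedAddCommGroup V] [InnerProductSpace ℂ V]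
    (hJ : IsAnticommuting D J) (z : X ⊗[ℂ] V) : J.rTensor V (J.rTensor V z) = z := by
  induction z using TensorProduct.induction_on with
  | zero => simp
  | add x y hx hy => simp only [map_add, hx, hy]
  | tmul y u => rw [ContinuousLinearMap.rTensor_tmul, ContinuousLinearMap.rTensor_tmul, hJ.sq]

theorem rTensor_mem_graph_tensorOp {V : Type*} [NormedAddCommGroup V] [InnerProductSpace ℂ V]
    [FiniteDimensional ℂ V] (hJ : IsAnticommuting D J) {z z' : X ⊗[ℂ] V}
    (hz : (z, z') ∈ (tensorOp V D).graph) :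
    (J.rTensor V z, -J.rTensor V z') ∈ (tensorOp V D).graph := by
  rw [mem_graph_tensorOp] at hz ⊢
  intro v
  simpa only [map_neg, slice_rTensor] using hJ.anticomm _ _ (hz v)

theorem adjoint_rTensor (hJ : IsAnticommuting D J) :
    ContinuousLinearMap.adjoint (J.rTensor V) = J.rTensor V := by
  rw [ContinuousLinearMap.adjoint_rTensor, hJ.adjoint]

theorem inner_rTensor_lTensor (hJ : IsAnticommuting D J) (L : selfAdjoint (V →L[ℂ] V))
    (z z' : X ⊗[ℂ] V) :
    inner ℂ (J.rTensor V ((L : V →L[ℂ] V).lTensor X z)) z'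
      = inner ℂ z (J.rTensor V ((L : V →L[ℂ] V).lTensor X z')) := by
  have hL : ContinuousLinearMap.adjoint (L : V →L[ℂ] V) = L := L.2
  rw [← ContinuousLinearMap.adjoint_inner_right, hJ.adjoint_rTensor,
    ← ContinuousLinearMap.adjoint_inner_right, ContinuousLinearMap.adjoint_lTensor, hL,
    rTensor_lTensor_apply]

theorem norm_lmap_rTensor (hJ : IsAnticommuting D J) (ξ : L2 G (X ⊗[ℂ] V)) :
    ‖lmap (J.rTensor V) ξ‖ = ‖ξ‖ := by
  have hsq : lmap (J.rTensor V) (lmap (J.rTensor V) ξ) = ξ := by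
    ext y
    exact hJ.rTensor_rTensor_apply _
  rw [← sq_eq_sq₀ (norm_nonneg _) (norm_nonneg _), ← inner_self_eq_norm_sq (𝕜 := ℂ),
    ← inner_self_eq_norm_sq (𝕜 := ℂ), inner_lmap, hJ.adjoint_rTensor, hsq]

theorem inner_lmap_rTensor_eq_neg (hJ : IsAnticommuting D J) (hD : D.IsFormalAdjoint D)
    {ξ u m : L2 G (X ⊗[ℂ] V)} (h : (ξ, u, m) ∈ diracTriples ℓ D) :
    inner ℂ u (lmap (J.rTensor V) m) = -inner ℂ (lmap (J.rTensor V) m) u := by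
  rw [lp.inner_eq_tsum, lp.inner_eq_tsum, ← tsum_neg]
  refine tsum_congr fun y => ?_
  have hgraph := hJ.rTensor_mem_graph_tensorOp
    (lTensor_mem_graph_tensorOp (ℓ y : V →L[ℂ] V) (h.1 y))
  rw [lmap_apply, h.2, inner_eq_of_mem_graph (isFormalAdjoint_tensorOp hD) (h.1 y) hgraph,
    inner_neg_right, hJ.inner_rTensor_lTensor]

theorem norm_add_lmap_rTensor_sq (hJ : IsAnticommuting D J) (hD : D.IsFormalAdjoint D)
    {ξ u m : L2 G (X ⊗[ℂ] V)} (h : (ξ, u, m) ∈ diracTriples ℓ D) :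
    ‖u + lmap (J.rTensor V) m‖ ^ 2 = ‖u‖ ^ 2 + ‖m‖ ^ 2 := by
  have hre : RCLike.re (inner ℂ u (lmap (J.rTensor V) m)) = 0 := by
    have hneg := congrArg RCLike.re (hJ.inner_lmap_rTensor_eq_neg hD h)
    rw [map_neg, inner_re_symm (lmap (J.rTensor V) m) u] at hneg
    linarith
  rw [@norm_add_sq ℂ, hre, hJ.norm_lmap_rTensor]
  ring

end IsAnticommuting

namespace IsDiracModel

theorem isFormalAdjoint (hT : IsDiracModel ℓ D J T U) (hJ : IsAnticommuting D J)
    (hD : D.IsFormalAdjoint D) : T.IsFormalAdjoint T := by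
  refine isFormalAdjoint_of_forall_mem_graph fun x x' y y' hx hy => ?_
  obtain ⟨u, m, hum, hx'⟩ := (hT _ _).1 hx
  obtain ⟨v, n, hvn, hy'⟩ := (hT _ _).1 hy
  rw [← U.inner_map_map, ← U.inner_map_map x, hx', hy', inner_add_left, inner_add_right]
  congr 1 <;> rw [lp.inner_eq_tsum, lp.inner_eq_tsum] <;> refine tsum_congr fun z => ?_
  · exact inner_eq_of_mem_graph (isFormalAdjoint_tensorOp hD) (hum.1 z) (hvn.1 z)
  · rw [lmap_apply, lmap_apply, hum.2, hvn.2]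
    exact hJ.inner_rTensor_lTensor _ _ _

/-- `‖(D ⊗ 1 + J ⊗ M_ℓ) ξ‖² = ‖(D ⊗ 1) ξ‖² + ‖(1 ⊗ M_ℓ) ξ‖²` makes the graph the image of a complete
space under a map that is bounded below. -/
theorem isClosed (hT : IsDiracModel ℓ D J T U) (hJ : IsAnticommuting D J)
    (hD : D.IsFormalAdjoint D) (hDc : D.IsClosed) : T.IsClosed := by
  let L := L2 G (X ⊗[ℂ] V)
  have : CompleteSpace (diracTriples ℓ D) := (isClosed_diracTriples hDc).completeSpace_coe
  let Φ : diracTriples ℓ D →L[ℂ] E × E :=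
    (((U.symm : L →L[ℂ] E) ∘L ContinuousLinearMap.fst ℂ L (L × L)).prod
      ((U.symm : L →L[ℂ] E) ∘L (ContinuousLinearMap.fst ℂ L L
        + lmap (J.rTensor V) ∘L ContinuousLinearMap.snd ℂ L L) ∘L
        ContinuousLinearMap.snd ℂ L (L × L))) ∘L (diracTriples ℓ D).subtypeL
  have hnorm : ∀ p, ‖p‖ ≤ ‖Φ p‖ := by
    rintro ⟨⟨ξ, u, m⟩, h⟩
    have hsq := hJ.norm_add_lmap_rTensor_sq hD h
    change max ‖ξ‖ (max ‖u‖ ‖m‖) ≤ max ‖U.symm ξ‖ ‖U.symm (u + lmap (J.rTensor V) m)‖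
    rw [U.symm.norm_map, U.symm.norm_map]
    refine max_le_max le_rfl (max_le ?_ ?_) <;>
    · rw [← sq_le_sq₀ (norm_nonneg _) (norm_nonneg _), hsq]
      nlinarith [sq_nonneg ‖u‖, sq_nonneg ‖m‖]
  have hanti : AntilipschitzWith 1 Φ :=
    AddMonoidHomClass.antilipschitz_of_bound Φ fun p => by simpa using hnorm p
  rw [LinearPMap.IsClosed, hT.graph_eq_range]
  exact hanti.isClosed_range Φ.uniformContinuous

end IsDiracModel

end Anticommuting

end Model

section Basis

variable {G : Type*} {X : Type*} [NormedAddCommGroup X] [InnerProductSpace ℂ X]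
  {V : Type*} [NormedAddCommGroup V] [InnerProductSpace ℂ V]
  {E : Type*} [NormedAddCommGroup E] [InnerProductSpace ℂ E] {ι n : Type*}

theorem orthonormal_single_tmul [DecidableEq G] {e : ι → X} (he : Orthonormal ℂ e)
    {v : G → n → V} (hv : ∀ y, Orthonormal ℂ (v y)) :
    Orthonormal ℂ fun k : ι × G × n =>
      (lp.single 2 k.2.1 (e k.1 ⊗ₜ[ℂ] v k.2.1 k.2.2) : L2 G (X ⊗[ℂ] V)) := by
  classical
  rw [orthonormal_iff_ite]
  rintro ⟨i, y, j⟩ ⟨i', y', j'⟩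
  simp only [lp.inner_single_left, lp.single_apply]
  by_cases hy : y = y'
  · subst hy
    simp only [Pi.single_eq_same, TensorProduct.inner_tmul, orthonormal_iff_ite.1 he,
      orthonormal_iff_ite.1 (hv y), Prod.mk.injEq, true_and]
    by_cases hi : i = i' <;> by_cases hj : j = j' <;> simp [hi, hj]
  · simp [hy]

theorem eq_zero_of_inner_single_tmul [DecidableEq G] [Fintype n] (e : HilbertBasis ι ℂ X)
    (v : G → OrthonormalBasis n ℂ V) {ξ : L2 G (X ⊗[ℂ] V)}
    (hξ : ∀ i y j, inner ℂ (lp.single 2 y (e i ⊗ₜ[ℂ] v y j) : L2 G (X ⊗[ℂ] V)) ξ = 0) : ξ = 0 := by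
  ext1
  funext y
  change ξ y = 0
  rw [← sum_slice_tmul (v y) (ξ y)]
  refine Finset.sum_eq_zero fun j _ => ?_
  have hrepr : e.repr (slice (v y j) (ξ y)) = 0 := by
    ext i
    rw [e.repr_apply_apply, ← inner_tmul_left_eq]
    exact (lp.inner_single_left y _ ξ).symm.trans (hξ i y j)
  rw [(map_eq_zero_iff _ e.repr.injective).1 hrepr, TensorProduct.zero_tmul]

theorem exists_hilbertBasis_single [DecidableEq G] [CompleteSpace E]
    (U : E ≃ₗᵢ[ℂ] L2 G (X ⊗[ℂ] V)) [Fintype n] (e : HilbertBasis ι ℂ X)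
    (v : G → OrthonormalBasis n ℂ V) :
    ∃ w : HilbertBasis (ι × G × n) ℂ E,
      ∀ i y j, w (i, y, j) = U.symm (lp.single 2 y (e i ⊗ₜ[ℂ] v y j)) := by
  have horth := (orthonormal_single_tmul e.orthonormal fun y =>
    (v y).orthonormal).comp_linearIsometry U.symm.toLinearIsometry
  refine ⟨HilbertBasis.mkOfOrthogonalEqBot horth ?_, fun i y j => ?_⟩
  · rw [eq_bot_iff]
    intro x hx
    rw [Submodule.mem_bot, ← U.map_eq_zero_iff]
    refine eq_zero_of_inner_single_tmul e v fun i y j => ?_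
    rw [← U.symm.inner_map_map, U.symm_apply_apply]
    exact (Submodule.mem_orthogonal _ _).1 hx _ (Submodule.subset_span ⟨(i, y, j), rfl⟩)
  · rw [HilbertBasis.coe_mkOfOrthogonalEqBot]
    rfl

theorem IsDiracModel.exists_isSqDiagonal [CompleteSpace X] [FiniteDimensional ℂ V] [CompleteSpace V]
    [CompleteSpace E] {ℓ : G → selfAdjoint (V →L[ℂ] V)} {D : X →ₗ.[ℂ] X} {J : X →L[ℂ] X}
    {T : E →ₗ.[ℂ] E} {U : E ≃ₗᵢ[ℂ] L2 G (X ⊗[ℂ] V)} (hT : IsDiracModel ℓ D J T U)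
    (hJ : IsAnticommuting D J) [Fintype n] {e : HilbertBasis ι ℂ X} {κ : ι → ℝ}
    (hD : IsSqDiagonal D e κ) {v : G → OrthonormalBasis n ℂ V} {μ : G → n → ℝ}
    (hv : ∀ y j, (ℓ y : V →L[ℂ] V) (v y j) = (μ y j : ℂ) • v y j) :
    ∃ w : HilbertBasis (ι × G × n) ℂ E, IsSqDiagonal T w fun k => κ k.1 + μ k.2.1 k.2.2 ^ 2 := by
  classical
  obtain ⟨w, hw⟩ := exists_hilbertBasis_single U e v
  refine ⟨w, hT.isFormalAdjoint hJ hD.symm, hT.isClosed hJ hD.symm hD.closed, ?_⟩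
  rintro ⟨i, y, j⟩
  rw [hw]
  obtain ⟨u, heu, hue⟩ := hD.sq i
  have hDe := tmul_mem_graph_tensorOp heu (v y j)
  have hDDe := (tensorOp V D).graph.add_mem (tmul_mem_graph_tensorOp hue (v y j))
    (hJ.rTensor_mem_graph_tensorOp (lTensor_mem_graph_tensorOp (ℓ y : V →L[ℂ] V) hDe))
  refine ⟨_, hT.single_mem_graph y hDe, ?_⟩
  convert! hT.single_mem_graph y hDDe using 2
  rw [← map_smul, ← lp.single_smul]
  congr 2
  rw [map_add, map_add, ← rTensor_lTensor_apply, hJ.rTensor_rTensor_apply]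
  simp only [ContinuousLinearMap.lTensor_tmul, ContinuousLinearMap.rTensor_tmul, hv, map_smul,
    TensorProduct.tmul_smul, ← TensorProduct.smul_tmul', smul_smul]
  push_cast
  module

end Basis

/-! ### Commutators of `D ⊗ 1 + J ⊗ M_ℓ` with the crossed product -/

/-- The operator `U⁻¹ S U`, which transports `S` along the unitary `U`. -/
def conjBy {E F : Type*} [NormedAddCommGroup E] [NormedSpace ℂ E] [NormedAddCommGroup F]
    [NormedSpace ℂ F] (U : E ≃ₗᵢ[ℂ] F) (S : F →L[ℂ] F) : E →L[ℂ] E :=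
  (U.symm : F →L[ℂ] E) ∘L S ∘L (U : E →L[ℂ] F)

theorem conjBy_apply {E F : Type*} [NormedAddCommGroup E] [NormedSpace ℂ E]
    [NormedAddCommGroup F] [NormedSpace ℂ F] (U : E ≃ₗᵢ[ℂ] F) (S : F →L[ℂ] F) (ξ : E) :
    conjBy U S ξ = U.symm (S (U ξ)) := rfl

section Commutators

variable {A : Type*} [CStarAlgebra A] {G : Type*} [Group G] {α : TwistedAction G A}

theorem regRep_single_one [DecidableEq G] {K : Type*} [NormedAddCommGroup K]
    [InnerProductSpace ℂ K] [CompleteSpace K] (π : A →⋆ₐ[ℂ] (K →L[ℂ] K)) (f : G →₀ A) (k : K)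
    (y : G) :
    regRep α π f (lp.single 2 1 k) y = π (α.ρ y⁻¹ (f y) * (α.σ y⁻¹ y : A)) k := by
  rw [regRep, Finsupp.sum, sum_apply, lp.coeFn_sum, Finset.sum_apply]
  simp only [regSingle_apply, lp.single_apply]
  rw [Finset.sum_eq_single y]
  · simp
  · intro x _ hx
    have hne : x⁻¹ * y ≠ 1 := fun h => hx (inv_mul_eq_one.1 h)
    rw [Pi.single_eq_of_ne hne, map_zero]
  · intro hy
    rw [Finsupp.notMem_support_iff.1 hy]
    simp

theorem eq_zero_of_ρ_mul_σ_eq_zero {x y z : G} {a : A} (ha : α.ρ x a * (α.σ y z : A) = 0) :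
    a = 0 := by
  have hρ : α.ρ x a = 0 := by
    have hmul : α.ρ x a * (α.σ y z : A) * star (α.σ y z : A) = 0 := by rw [ha, zero_mul]
    have hunit : (α.σ y z : A) * star (α.σ y z : A) = 1 := Unitary.coe_mul_star_self _
    rwa [mul_assoc, hunit, mul_one] at hmul
  exact (map_eq_zero_iff _ (α.ρ x).injective).1 hρ

theorem norm_ampl_coeff_comp_lTensor_le {X V : Type*} [NormedAddCommGroup X]
    [InnerProductSpace ℂ X] [CompleteSpace X] [NormedAddCommGroup V] [InnerProductSpace ℂ V]
    (π : A →⋆ₐ[ℂ] (X →L[ℂ] X)) (x y : G) (a : A) {L : V →L[ℂ] V} {C : ℝ} (hL : ‖L‖ ≤ C) :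
    ‖(π (α.ρ y⁻¹ a * (α.σ y⁻¹ x : A))).rTensor V ∘L L.lTensor X‖ ≤ ‖a‖ * C :=
  (ContinuousLinearMap.opNorm_comp_le _ _).trans <| mul_le_mul
    ((ContinuousLinearMap.norm_rTensor_le _ _).trans (norm_coeff_le α π a x y))
    ((ContinuousLinearMap.norm_lTensor_le _ _).trans hL) (norm_nonneg _) (norm_nonneg _)

variable {X : Type*} [NormedAddCommGroup X] [InnerProductSpace ℂ X]
  {V : Type*} [NormedAddCommGroup V] [InnerProductSpace ℂ V] [FiniteDimensional ℂ V]
  {D : X →ₗ.[ℂ] X} {J : X →L[ℂ] X}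

theorem rTensor_mem_graph_of_isCommutator {S B : X →L[ℂ] X} (hS : IsCommutator D S B)
    {z z' : X ⊗[ℂ] V} (hz : (z, z') ∈ (tensorOp V D).graph) :
    (S.rTensor V z, S.rTensor V z' + B.rTensor V z) ∈ (tensorOp V D).graph := by
  rw [mem_graph_tensorOp] at hz ⊢
  intro v
  simpa only [map_add, slice_rTensor] using isCommutator_iff.1 hS _ _ (hz v)

variable [CompleteSpace X] [CompleteSpace V] {π : A →⋆ₐ[ℂ] (X →L[ℂ] X)}

theorem regSingle_ampl_lmap_rTensor (hπ : ∀ a, π a * J = J * π a) (x : G) (a : A)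
    (ξ : L2 G (X ⊗[ℂ] V)) :
    regSingle α (ampl V π) x a (lmap (J.rTensor V) ξ)
      = lmap (J.rTensor V) (regSingle α (ampl V π) x a ξ) := by
  ext y
  change (π _).rTensor V (J.rTensor V (ξ (x⁻¹ * y))) = J.rTensor V ((π _).rTensor V _)
  rw [← mul_apply_eq_comp, ← mul_apply_eq_comp, ← ContinuousLinearMap.rTensor_mul,
    ← ContinuousLinearMap.rTensor_mul, hπ]

variable {E : Type*} [NormedAddCommGroup E] [InnerProductSpace ℂ E]
  {ℓ : G → selfAdjoint (V →L[ℂ] V)} {T : E →ₗ.[ℂ] E} {U : E ≃ₗᵢ[ℂ] L2 G (X ⊗[ℂ] V)}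

namespace IsDiracModel

theorem exists_isCommutator_regSingle (hT : IsDiracModel ℓ D J T U)
    (hπ : ∀ a, π a * J = J * π a) (hℓ : TranslationBounded ℓ) (x : G) (a : A) {C : ℝ}
    (hC : ∀ y : G, ∃ B : X →L[ℂ] X,
      IsCommutator D (π (α.ρ y a * (α.σ y x : A))) B ∧ ‖B‖ ≤ C) :
    ∃ B : E →L[ℂ] E, IsCommutator T (conjBy U (regSingle α (ampl V π) x a)) B := by
  choose B hB hBC using fun y : G => hC y⁻¹
  obtain ⟨C', hC'⟩ := hℓ x
  let P : G → X →L[ℂ] X := fun y => π (α.ρ y⁻¹ a * (α.σ y⁻¹ x : A))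
  let Δ : G → V →L[ℂ] V := fun y => (ℓ y : V →L[ℂ] V) - (ℓ (x⁻¹ * y) : V →L[ℂ] V)
  let S := regSingle α (ampl V π) x a
  let B₁ := wshift x (fun y => (B y).rTensor V) C
    fun y => (ContinuousLinearMap.norm_rTensor_le _ _).trans (hBC y)
  let B₂ := wshift x (fun y => (P y).rTensor V ∘L (Δ y).lTensor X) (‖a‖ * C')
    fun y => norm_ampl_coeff_comp_lTensor_le π x y a (hC' y)
  refine ⟨conjBy U (B₁ + lmap (J.rTensor V) ∘L B₂), isCommutator_iff.2 fun ξ ξ' hξ => ?_⟩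
  obtain ⟨u, m, hum, hξ'⟩ := (hT _ _).1 hξ
  rw [hT]
  refine ⟨S u + B₁ (U ξ), S m + B₂ (U ξ), mem_diracTriples.2 ⟨fun y => ?_, fun y => ?_⟩, ?_⟩
  · rw [conjBy_apply, U.apply_symm_apply]
    exact rTensor_mem_graph_of_isCommutator (hB y) (hum.1 (x⁻¹ * y))
  · rw [conjBy_apply, U.apply_symm_apply]
    change (P y).rTensor V (m (x⁻¹ * y)) + (P y).rTensor V ((Δ y).lTensor X (U ξ (x⁻¹ * y)))
      = (ℓ y : V →L[ℂ] V).lTensor X ((P y).rTensor V (U ξ (x⁻¹ * y)))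
    rw [hum.2, ← map_add, ← rTensor_lTensor_apply, ContinuousLinearMap.lTensor_sub, sub_apply,
      add_sub_cancel]
  · rw [map_add, conjBy_apply, conjBy_apply, U.apply_symm_apply, U.apply_symm_apply, hξ', map_add,
      regSingle_ampl_lmap_rTensor hπ, map_add]
    simp only [add_apply, ContinuousLinearMap.comp_apply]
    abel

theorem exists_isCommutator_regRep (hT : IsDiracModel ℓ D J T U)
    (hπ : ∀ a, π a * J = J * π a) (hℓ : TranslationBounded ℓ) {𝒜 : StarSubalgebra ℂ A}
    (hub : UniformlyBounded α π 𝒜 D) {f : G →₀ A} (hf : ∀ x, f x ∈ 𝒜) :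
    ∃ B : E →L[ℂ] E, IsCommutator T (conjBy U (regRep α (ampl V π) f)) B := by
  have hsingle (x : G) : ∃ B : E →L[ℂ] E,
      IsCommutator T (conjBy U (regSingle α (ampl V π) x (f x))) B := by
    obtain ⟨C, hC⟩ := hub (f x) (hf x) x
    exact hT.exists_isCommutator_regSingle hπ hℓ x (f x) hC
  choose B hB using hsingle
  have hsum : conjBy U (regRep α (ampl V π) f)
      = ∑ x ∈ f.support, conjBy U (regSingle α (ampl V π) x (f x)) := by
    ext ξ
    simp [conjBy_apply, regRep, Finsupp.sum, sum_apply]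
  exact ⟨∑ x ∈ f.support, B x, hsum ▸ isCommutator_sum _ fun x _ => hB x⟩

/-- Apply the vanishing commutator to `x ⊗ v ⊗ δ_e` and read off the component at `y`: as
`ℓ(e) = 0`, only the `y`-component sees the length function. -/
theorem coeff_tmul_mem_graph (hT : IsDiracModel ℓ D J T U) (hℓ : ℓ 1 = 0) {f : G →₀ A}
    (hf : IsCommutator T (conjBy U (regRep α (ampl V π) f)) 0) (y : G) {c : A}
    (hc : c = α.ρ y⁻¹ (f y) * (α.σ y⁻¹ y : A)) {x x' : X} (hx : (x, x') ∈ D.graph) (v : V) :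
    ((π c x) ⊗ₜ[ℂ] v, (π c x') ⊗ₜ[ℂ] v - (J (π c x)) ⊗ₜ[ℂ] (ℓ y : V →L[ℂ] V) v)
      ∈ (tensorOp V D).graph := by
  classical
  have hsingle := hT.single_mem_graph 1 (tmul_mem_graph_tensorOp hx v)
  rw [hℓ] at hsingle
  obtain ⟨u, m, hum, himage⟩ := (hT _ _).1 (isCommutator_iff.1 hf _ _ hsingle)
  have hfst : U (conjBy U (regRep α (ampl V π) f) (U.symm (lp.single 2 1 (x ⊗ₜ[ℂ] v)))) y
      = (π c x) ⊗ₜ[ℂ] v := by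
    rw [conjBy_apply, U.apply_symm_apply, U.apply_symm_apply, regRep_single_one, hc]
    rfl
  have hsnd : u y = (π c x') ⊗ₜ[ℂ] v - (J (π c x)) ⊗ₜ[ℂ] (ℓ y : V →L[ℂ] V) v := by
    rw [conjBy_apply, U.apply_symm_apply, zero_apply, add_zero, U.apply_symm_apply] at himage
    have hy := congrArg (fun g : L2 G (X ⊗[ℂ] V) => g y) himage
    simp only [ZeroMemClass.coe_zero, ContinuousLinearMap.lTensor_zero, zero_apply, map_zero,
      add_zero] at hy
    rw [regRep_single_one, lp.coeFn_add, Pi.add_apply, lmap_apply, hum.2, hfst, ← hc] at hy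
    exact eq_sub_of_add_eq hy.symm
  simpa only [hfst, hsnd] using hum.1 y

theorem coeff_tmul_length_eq_zero (hT : IsDiracModel ℓ D J T U) (hJ : IsAnticommuting D J)
    (hπ : ∀ a, π a * J = J * π a) (hℓ : ℓ 1 = 0) {f : G →₀ A}
    (hf : IsCommutator T (conjBy U (regRep α (ampl V π) f)) 0) (y : G) {c : A}
    (hc : c = α.ρ y⁻¹ (f y) * (α.σ y⁻¹ y : A)) {x x' : X} (hx : (x, x') ∈ D.graph) (v : V) :
    (π c x) ⊗ₜ[ℂ] (ℓ y : V →L[ℂ] V) v = 0 := by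
  have hcomm (z : X) : π c (J z) = J (π c z) := congrArg (fun S : X →L[ℂ] X => S z) (hπ c)
  have hgraph := hT.coeff_tmul_mem_graph hℓ hf y hc hx v
  have hgraphJ := hJ.rTensor_mem_graph_tensorOp
    (hT.coeff_tmul_mem_graph hℓ hf y hc (hJ.anticomm _ _ hx) v)
  simp only [map_sub, map_neg, ContinuousLinearMap.rTensor_tmul, hcomm, hJ.sq,
    TensorProduct.neg_tmul] at hgraphJ
  have heq := LinearPMap.mem_graph_snd_inj _ hgraph hgraphJ rfl
  have htwo : (2 : ℂ) • ((J (π c x)) ⊗ₜ[ℂ] (ℓ y : V →L[ℂ] V) v) = 0 := by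
    rw [two_smul, ← neg_eq_zero, ← sub_eq_zero.2 heq]
    abel
  have hzero := congrArg (J.rTensor V) ((smul_eq_zero.1 htwo).resolve_left two_ne_zero)
  rwa [ContinuousLinearMap.rTensor_tmul, hJ.sq, map_zero] at hzero

theorem apply_eq_zero_of_isCommutator_zero (hT : IsDiracModel ℓ D J T U)
    (hJ : IsAnticommuting D J) (hπ : ∀ a, π a * J = J * π a) (hinj : Function.Injective π)
    (hdense : Dense (D.domain : Set X)) (hℓ : ℓ 1 = 0) {f : G →₀ A}
    (hf : IsCommutator T (conjBy U (regRep α (ampl V π) f)) 0) {y : G} (hy : ℓ y ≠ 0) :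
    f y = 0 := by
  obtain ⟨v, hv⟩ : ∃ v, (ℓ y : V →L[ℂ] V) v ≠ 0 := by
    by_contra! hall
    exact hy (Subtype.ext (ContinuousLinearMap.ext hall))
  have hzero : π (α.ρ y⁻¹ (f y) * (α.σ y⁻¹ y : A)) = 0 := by
    refine ContinuousLinearMap.ext_on (s := (D.domain : Set X)) (by rwa [Submodule.span_eq])
      fun x hx => ?_
    have hnorm := congrArg norm
      (hT.coeff_tmul_length_eq_zero hJ hπ hℓ hf y rfl (D.mem_graph ⟨x, hx⟩) v)
    rw [TensorProduct.norm_tmul, norm_zero] at hnorm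
    exact norm_eq_zero.1 ((mul_eq_zero.1 hnorm).resolve_right (norm_ne_zero_iff.2 hv))
  exact eq_zero_of_ρ_mul_σ_eq_zero (hinj (by rw [hzero, map_zero]))

theorem isCommutator_apply_one_zero [Nontrivial V] (hT : IsDiracModel ℓ D J T U) (hℓ : ℓ 1 = 0)
    {f : G →₀ A} (hf : IsCommutator T (conjBy U (regRep α (ampl V π) f)) 0) :
    IsCommutator D (π (f 1)) 0 := by
  refine isCommutator_iff.2 fun x x' hx => ?_
  have hcoeff : f 1 = α.ρ 1⁻¹ (f 1) * (α.σ 1⁻¹ 1 : A) := by simp [α.σ_right, α.ρ_one]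
  obtain ⟨v, hv⟩ := exists_ne (0 : V)
  have hgraph := hT.coeff_tmul_mem_graph hℓ hf 1 hcoeff hx v
  rw [hℓ, ZeroMemClass.coe_zero, zero_apply, TensorProduct.tmul_zero, sub_zero,
    mem_graph_tensorOp] at hgraph
  have hslice := D.graph.smul_mem (inner ℂ v v)⁻¹ (hgraph v)
  simp only [slice_tmul, Prod.smul_mk] at hslice
  have hvv : inner ℂ v v ≠ 0 := inner_self_ne_zero.2 hv
  rwa [smul_smul, smul_smul, inv_mul_cancel₀ hvv, one_smul, one_smul, ← add_zero (π (f 1) x'),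
    ← zero_apply (F := X →L[ℂ] X) x] at hslice

end IsDiracModel

end Commutators

/-! ### Spectra of the values of a length function -/

section Spectra

variable {V : Type*} [NormedAddCommGroup V] [InnerProductSpace ℂ V]

theorem exists_eigenbasis [FiniteDimensional ℂ V] [CompleteSpace V]
    (L : selfAdjoint (V →L[ℂ] V)) :
    ∃ (v : OrthonormalBasis (Fin (Module.finrank ℂ V)) ℂ V) (μ : Fin (Module.finrank ℂ V) → ℝ),
      ∀ j, (L : V →L[ℂ] V) (v j) = (μ j : ℂ) • v j := by
  have hL : IsSelfAdjoint (L : V →L[ℂ] V) := L.2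
  have hsymm : ((L : V →L[ℂ] V) : V →ₗ[ℂ] V).IsSymmetric := hL.isSymmetric
  exact ⟨hsymm.eigenvectorBasis rfl, hsymm.eigenvalues rfl,
    fun j => hsymm.apply_eigenvectorBasis rfl j⟩

variable {n : Type*} [Fintype n]

theorem eq_zero_of_apply_eq_smul_of_notMem_range {L : V →L[ℂ] V} {v : OrthonormalBasis n ℂ V}
    {μ : n → ℝ} (hv : ∀ j, L (v j) = (μ j : ℂ) • v j) {r : ℝ} (hr : r ∉ Set.range μ) {x : V}
    (hx : L x = (r : ℂ) • x) : x = 0 := by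
  have := v.toBasis.finiteDimensional_of_finite
  have := FiniteDimensional.complete ℂ V
  have hdiag : IsDiagonal v.toHilbertBasis (fun j => (μ j : ℂ)) L := by simpa [IsDiagonal] using hv
  refine v.toHilbertBasis.repr.injective (lp.ext (funext fun j => ?_))
  have hcoord := hdiag.inner_apply j x
  rw [hx, inner_smul_right, ← sub_eq_zero, ← sub_mul] at hcoord
  have hne : (r : ℂ) - μ j ≠ 0 := sub_ne_zero.2 fun h => hr ⟨j, by exact_mod_cast h.symm⟩
  simpa [HilbertBasis.repr_apply_apply] using (mul_eq_zero.1 hcoord).resolve_left hne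

theorem spectrum_eq_range_of_eigenbasis {L : V →L[ℂ] V} {v : OrthonormalBasis n ℂ V} {μ : n → ℝ}
    (hv : ∀ j, L (v j) = (μ j : ℂ) • v j) : spectrum ℝ L = Set.range μ := by
  have := v.toBasis.finiteDimensional_of_finite
  refine Set.Subset.antisymm (fun r => ?_) ?_
  · contrapose!
    intro hr
    have hinj : Function.Injective ((algebraMap ℝ (V →L[ℂ] V) r - L : V →L[ℂ] V) : V →ₗ[ℂ] V) := by
      refine (injective_iff_map_eq_zero _).2 fun x hx => ?_
      refine eq_zero_of_apply_eq_smul_of_notMem_range hv hr (sub_eq_zero.1 ?_).symm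
      simpa [Algebra.algebraMap_eq_smul_one] using hx
    rw [spectrum.notMem_iff]
    exact ⟨(LinearEquiv.ofInjectiveEndo _ hinj).toContinuousLinearEquiv.toUnit,
      ContinuousLinearMap.ext fun x => rfl⟩
  · rintro _ ⟨j, rfl⟩
    exact mem_spectrum_of_apply_eq_smul (hv j) (v.orthonormal.ne_zero j)

end Spectra

/-- The elements `g` with some `|μ_{g,j}| ≤ N`. If the `μ_{g,j}` are the eigenvalues of `ℓ(g)`, this
is the ball `B_N` of the length function `ℓ`. -/
def eigenBall {G n : Type*} (μ : G → n → ℝ) (N : ℕ) : Set G :=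
  {g | ∃ j, |μ g j| ≤ N}

section Length

variable {V : Type*} [NormedAddCommGroup V] [InnerProductSpace ℂ V] [CompleteSpace V]
  {G : Type*} {ℓ : G → selfAdjoint (V →L[ℂ] V)} {n : Type*} [Fintype n]
  {v : G → OrthonormalBasis n ℂ V} {μ : G → n → ℝ}

theorem ball_eq_eigenBall [FiniteDimensional ℂ V] [Nonempty n]
    (hv : ∀ y j, (ℓ y : V →L[ℂ] V) (v y j) = (μ y j : ℂ) • v y j) (N : ℕ) :
    ball ℓ N = eigenBall μ N := by
  ext g
  have hL : IsSelfAdjoint (ℓ g : V →L[ℂ] V) := (ℓ g).2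
  have habs : spectrum ℝ (CFC.abs (ℓ g : V →L[ℂ] V)) = Set.range fun j => |μ g j| := by
    refine spectrum_eq_range_of_eigenbasis (v := v g) fun j => ?_
    rw [CFC.abs_eq_cfc_norm _ hL]
    exact cfc_apply_of_apply_eq_smul hL (hv g j) continuous_norm.continuousOn
  change sInf _ ≤ (N : ℝ) ↔ _
  rw [habs]
  refine ⟨fun h => ?_, ?_⟩
  · obtain ⟨j, hj⟩ := (Set.range_nonempty fun j => |μ g j|).csInf_mem (Set.finite_range _)
    exact ⟨j, hj.le.trans h⟩
  · rintro ⟨j, hj⟩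
    exact (csInf_le (Set.finite_range _).bddBelow ⟨j, rfl⟩).trans hj

variable [Group G]

theorem IsProperLength.finite_spectra_inter_Icc (hℓ : IsProperLength ℓ) (a b : ℝ) :
    (spectra ℓ ∩ Set.Icc a b).Finite := by
  by_contra hinf
  obtain ⟨t, -, ht⟩ := Set.Infinite.exists_accPt_of_subset_isCompact hinf isCompact_Icc
    Set.inter_subset_right
  exact hℓ.discrete t (ht.mono (principal_mono.2 Set.inter_subset_left))

theorem IsProperLength.tendsto_sq_eigenvalue (hℓ : IsProperLength ℓ)
    (hv : ∀ y j, (ℓ y : V →L[ℂ] V) (v y j) = (μ y j : ℂ) • v y j) :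
    Tendsto (fun k : G × n => μ k.1 k.2 ^ 2) cofinite atTop := by
  refine tendsto_atTop.2 fun C => ?_
  let S : Set ℝ := spectra ℓ ∩ Set.Icc (-√C) √C
  have hfin : (⋃ t ∈ S, {y : G | t ∈ spectrum ℝ (ℓ y : V →L[ℂ] V)}).Finite :=
    (hℓ.finite_spectra_inter_Icc _ _).biUnion fun t ht => hℓ.finite_fiber t ht.1
  refine (hfin.prod (Set.finite_univ (α := n))).subset ?_
  rintro ⟨y, j⟩ hk
  have hle : μ y j ^ 2 ≤ C := (not_le.1 (by simpa using hk)).le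
  have hmem : μ y j ∈ spectrum ℝ (ℓ y : V →L[ℂ] V) := by
    rw [spectrum_eq_range_of_eigenbasis (hv y)]
    exact ⟨j, rfl⟩
  exact ⟨Set.mem_biUnion (x := μ y j)
    ⟨Set.mem_iUnion.2 ⟨y, hmem⟩, abs_le.1 (Real.abs_le_sqrt hle)⟩ hmem, trivial⟩

end Length

/-! ### Dirichlet series of sums -/

theorem tendsto_add_prod_cofinite_atTop {ι K : Type*} {κ : ι → ℝ} {ν : K → ℝ}
    (hκ0 : ∀ i, 0 ≤ κ i) (hν0 : ∀ k, 0 ≤ ν k) (hκ : Tendsto κ cofinite atTop)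
    (hν : Tendsto ν cofinite atTop) :
    Tendsto (fun k : ι × K => κ k.1 + ν k.2) cofinite atTop := by
  rw [← coprod_cofinite, Filter.coprod, tendsto_sup]
  exact ⟨tendsto_atTop_mono (fun k => le_add_of_nonneg_right (hν0 k.2)) (hκ.comp tendsto_comap),
    tendsto_atTop_mono (fun k => le_add_of_nonneg_left (hκ0 k.1)) (hν.comp tendsto_comap)⟩

theorem zetaSum_prod {ι K : Type*} (κ : ι → ℝ) (ν : K → ℝ) (t : ℝ) :
    zetaSum (fun k : ι × K => κ k.1 + ν k.2) t = ∑' i, zetaSum (fun k => κ i + ν k) t :=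
  ENNReal.tsum_prod' (f := fun k : ι × K => ENNReal.ofReal ((1 + (κ k.1 + ν k.2)) ^ (-(t / 2))))

theorem zetaSum_prod_le_mul {ι K : Type*} {κ : ι → ℝ} {ν : K → ℝ} (hκ : ∀ i, 0 ≤ κ i)
    (hν : ∀ k, 0 ≤ ν k) {p q : ℝ} (hp : 0 ≤ p) (hq : 0 ≤ q) :
    zetaSum (fun k : ι × K => κ k.1 + ν k.2) (p + q) ≤ zetaSum κ p * zetaSum ν q := by
  have hterm (i : ι) (k : K) : ENNReal.ofReal ((1 + (κ i + ν k)) ^ (-((p + q) / 2)))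
      ≤ ENNReal.ofReal ((1 + κ i) ^ (-(p / 2))) * ENNReal.ofReal ((1 + ν k) ^ (-(q / 2))) := by
    have hi := hκ i
    have hk := hν k
    rw [← ENNReal.ofReal_mul (by positivity)]
    refine ENNReal.ofReal_le_ofReal ?_
    rw [show -((p + q) / 2) = -(p / 2) + -(q / 2) by ring, Real.rpow_add (by positivity)]
    gcongr ?_ * ?_ <;>
      exact Real.rpow_le_rpow_of_nonpos (by positivity) (by linarith) (by linarith)
  rw [zetaSum_prod, zetaSum, ← ENNReal.tsum_mul_right]
  refine ENNReal.tsum_le_tsum fun i => ?_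
  rw [zetaSum, zetaSum, ← ENNReal.tsum_mul_left]
  exact ENNReal.tsum_le_tsum fun k => hterm i k

section Dyadic

variable {G n : Type*} {μ : G → n → ℝ}

theorem tsum_indicator_const (s : Set G) (c : ℝ≥0∞) :
    ∑' y, s.indicator (fun _ => c) y = s.encard * c :=
  (tsum_subtype s fun _ => c).symm.trans (ENNReal.tsum_set_const s c)

theorem exists_mem_eigenBall_two_pow [Nonempty n] (μ : G → n → ℝ) (y : G) :
    ∃ k : ℕ, y ∈ eigenBall μ (2 ^ k) := by
  let j := Classical.arbitrary n
  obtain ⟨k, hk⟩ := pow_unbounded_of_one_lt |μ y j| (one_lt_two (α := ℝ))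
  exact ⟨k, j, by push_cast; exact hk.le⟩

theorem rpow_le_of_forall_notMem_eigenBall {q : ℝ} (hq : 0 < q) {y : G} {k : ℕ}
    (hk : ∀ m < k, y ∉ eigenBall μ (2 ^ m)) (j : n) :
    (1 + μ y j ^ 2) ^ (-(q / 2)) ≤ (2 : ℝ) ^ q * ((2 : ℝ) ^ (-q)) ^ k := by
  cases k with
  | zero =>
    rw [pow_zero, mul_one]
    refine (Real.rpow_le_one_of_one_le_of_nonpos ?_ ?_).trans (Real.one_le_rpow one_le_two hq.le)
    · nlinarith [sq_nonneg (μ y j)]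
    · linarith
  | succ m =>
    have hlt : (2 : ℝ) ^ m < |μ y j| := by
      by_contra! h
      exact hk m (Nat.lt_succ_self m) ⟨j, by push_cast; exact h⟩
    have hsq : ((2 : ℝ) ^ m) ^ 2 ≤ 1 + μ y j ^ 2 := by
      rw [← sq_abs (μ y j)]
      nlinarith [pow_pos (two_pos (α := ℝ)) m]
    refine (Real.rpow_le_rpow_of_nonpos (by positivity) hsq (by linarith)).trans (le_of_eq ?_)
    rw [← pow_mul, ← Real.rpow_natCast, ← Real.rpow_natCast, ← Real.rpow_mul two_pos.le,
      ← Real.rpow_mul two_pos.le, ← Real.rpow_add two_pos]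
    congr 1
    push_cast
    ring

theorem rpow_le_tsum_indicator_eigenBall [Nonempty n] {q : ℝ} (hq : 0 < q) (y : G) (j : n) :
    ENNReal.ofReal ((1 + μ y j ^ 2) ^ (-(q / 2))) ≤ ∑' k : ℕ, (eigenBall μ (2 ^ k)).indicator
      (fun _ => ENNReal.ofReal ((2 : ℝ) ^ q * ((2 : ℝ) ^ (-q)) ^ k)) y := by
  classical
  have hex := exists_mem_eigenBall_two_pow μ y
  refine le_trans ?_ (ENNReal.le_tsum (Nat.find hex))
  rw [Set.indicator_of_mem (Nat.find_spec hex)]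
  exact ENNReal.ofReal_le_ofReal
    (rpow_le_of_forall_notMem_eigenBall hq (fun m hm => Nat.find_min hex hm) j)

theorem summable_dyadic_of_le_rpow {b : ℕ → ℝ} (hb : ∀ N, 0 ≤ b N) {q q' : ℝ} (hq' : q' < q)
    (hev : ∀ᶠ N : ℕ in atTop, b N ≤ (N : ℝ) ^ q') :
    Summable fun k : ℕ => b (2 ^ k) * ((2 : ℝ) ^ q * ((2 : ℝ) ^ (-q)) ^ k) := by
  have hgeo : Summable fun k : ℕ => (2 : ℝ) ^ q * ((2 : ℝ) ^ (q' - q)) ^ k :=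
    (summable_geometric_of_lt_one (by positivity)
      (Real.rpow_lt_one_of_one_lt_of_neg one_lt_two (by linarith))).mul_left _
  have htend : Tendsto (fun k : ℕ => 2 ^ k) atTop atTop :=
    tendsto_pow_atTop_atTop_of_one_lt one_lt_two
  refine Summable.of_norm_bounded_eventually_nat hgeo ?_
  filter_upwards [htend.eventually hev] with k hk
  rw [Real.norm_of_nonneg (mul_nonneg (hb _) (by positivity))]
  refine (mul_le_mul_of_nonneg_right hk (by positivity)).trans (le_of_eq ?_)
  have hpow : ((2 : ℝ) ^ k) ^ q' = ((2 : ℝ) ^ q') ^ k := by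
    rw [← Real.rpow_natCast, ← Real.rpow_natCast, ← Real.rpow_mul two_pos.le,
      ← Real.rpow_mul two_pos.le, mul_comm]
  push_cast
  rw [hpow, sub_eq_add_neg, Real.rpow_add two_pos, mul_pow]
  ring

theorem zetaSum_sq_lt_top [Finite n] [Nonempty n]
    (hfin : ∀ N, 1 ≤ N → (eigenBall μ N).Finite) {q q' : ℝ} (hq : 0 < q) (hq' : q' < q)
    (hev : ∀ᶠ N : ℕ in atTop, ((eigenBall μ N).ncard : ℝ) ≤ (N : ℝ) ^ q') :
    zetaSum (fun k : G × n => μ k.1 k.2 ^ 2) q < ∞ := by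
  have := Fintype.ofFinite n
  let c : ℕ → ℝ := fun k => (2 : ℝ) ^ q * ((2 : ℝ) ^ (-q)) ^ k
  let F : G → ℝ≥0∞ := fun y =>
    ∑' k, (eigenBall μ (2 ^ k)).indicator (fun _ => ENNReal.ofReal (c k)) y
  have hball (k : ℕ) : (eigenBall μ (2 ^ k)).encard * ENNReal.ofReal (c k)
      = ENNReal.ofReal ((eigenBall μ (2 ^ k)).ncard * c k) := by
    rw [ENNReal.ofReal_mul (Nat.cast_nonneg _), ENNReal.ofReal_natCast,
      ← (hfin _ Nat.one_le_two_pow).cast_ncard_eq]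
    rfl
  calc zetaSum (fun k : G × n => μ k.1 k.2 ^ 2) q
      ≤ ∑' p : G × n, F p.1 :=
        ENNReal.tsum_le_tsum fun p => rpow_le_tsum_indicator_eigenBall hq p.1 p.2
    _ = Fintype.card n * ∑' y, F y := by
        rw [ENNReal.tsum_prod' (f := fun p : G × n => F p.1)]
        simp only [tsum_fintype, Finset.sum_const, Finset.card_univ, nsmul_eq_mul]
        rw [ENNReal.tsum_mul_left]
    _ = Fintype.card n * ∑' k, ENNReal.ofReal ((eigenBall μ (2 ^ k)).ncard * c k) := by
        rw [ENNReal.tsum_comm]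
        simp only [tsum_indicator_const, hball]
    _ < ∞ := ENNReal.mul_lt_top (ENNReal.natCast_lt_top _)
        (summable_dyadic_of_le_rpow (fun _ => Nat.cast_nonneg _) hq' hev).tsum_ofReal_lt_top

theorem ncard_mul_rpow_le_zetaSum (μ : G → n → ℝ) {a t : ℝ} (ha : 0 ≤ a) (ht : 0 ≤ t) (N : ℕ) :
    ENNReal.ofReal ((eigenBall μ N).ncard * (1 + (a + (N : ℝ) ^ 2)) ^ (-(t / 2)))
      ≤ zetaSum (fun k : G × n => a + μ k.1 k.2 ^ 2) t := by
  have hcard : ENNReal.ofReal (eigenBall μ N).ncard ≤ (eigenBall μ N).encard := by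
    rw [ENNReal.ofReal_natCast]
    exact_mod_cast Set.ncard_le_encard _
  rw [ENNReal.ofReal_mul (Nat.cast_nonneg _), zetaSum, ENNReal.tsum_prod' (f := fun k : G × n =>
    ENNReal.ofReal ((1 + (a + μ k.1 k.2 ^ 2)) ^ (-(t / 2))))]
  refine (mul_le_mul_left hcard _).trans ?_
  rw [← tsum_indicator_const]
  refine ENNReal.tsum_le_tsum fun y => Set.indicator_apply_le' ?_ fun _ => zero_le
  rintro ⟨j, hj⟩
  refine le_trans ?_ (ENNReal.le_tsum j)
  refine ENNReal.ofReal_le_ofReal (Real.rpow_le_rpow_of_nonpos (by positivity) ?_ (by linarith))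
  have hsq : μ y j ^ 2 ≤ (N : ℝ) ^ 2 := by
    rw [← sq_abs (μ y j)]
    gcongr
  linarith

theorem rpow_le_mul_rpow_natCeil_sqrt {a t d : ℝ} (ha : 0 ≤ a) (ht : 0 ≤ t) (hd : 0 ≤ d) :
    5 ^ (-(t / 2)) * (1 + a) ^ (-((t - d) / 2))
      ≤ (⌈√(1 + a)⌉₊ : ℝ) ^ d * (1 + (a + (⌈√(1 + a)⌉₊ : ℝ) ^ 2)) ^ (-(t / 2)) := by
  set s := √(1 + a)
  have hs_sq : s ^ 2 = 1 + a := Real.sq_sqrt (by linarith)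
  have hs_one : 1 ≤ s := Real.one_le_sqrt.2 (by linarith)
  have hle_ceil : s ≤ ⌈s⌉₊ := Nat.le_ceil s
  have hceil_le : (⌈s⌉₊ : ℝ) ≤ 2 * s := by
    linarith [(Nat.ceil_lt_add_one (by linarith : 0 ≤ s)).le]
  have hbase : (5 * (1 + a)) ^ (-(t / 2)) ≤ (1 + (a + (⌈s⌉₊ : ℝ) ^ 2)) ^ (-(t / 2)) :=
    Real.rpow_le_rpow_of_nonpos (by positivity) (by nlinarith) (by linarith)
  have hceil : (1 + a) ^ (d / 2) ≤ (⌈s⌉₊ : ℝ) ^ d := by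
    rw [← hs_sq, ← Real.rpow_natCast s 2, ← Real.rpow_mul (by linarith)]
    refine le_trans (le_of_eq ?_) (Real.rpow_le_rpow (by linarith) hle_ceil hd)
    congr 1
    push_cast
    ring
  calc 5 ^ (-(t / 2)) * (1 + a) ^ (-((t - d) / 2))
      = (1 + a) ^ (d / 2) * (5 * (1 + a)) ^ (-(t / 2)) := by
        rw [Real.mul_rpow (by norm_num) (by linarith),
          show -((t - d) / 2) = d / 2 + -(t / 2) by ring, Real.rpow_add (by linarith)]
        ring
    _ ≤ _ := by gcongr

-- The balls of radius `N ≥ √(1 + a)` already contribute about `N ^ d (1 + a) ^ (-t / 2)`.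
theorem rpow_le_zetaSum {a t d c : ℝ} (ha : 0 ≤ a) (ht : 0 ≤ t) (hd : 0 ≤ d) (hc : 0 < c)
    (hlow : ∀ N : ℕ, 1 ≤ N → c * (N : ℝ) ^ d ≤ (eigenBall μ N).ncard) :
    ENNReal.ofReal (c * 5 ^ (-(t / 2))) * ENNReal.ofReal ((1 + a) ^ (-((t - d) / 2)))
      ≤ zetaSum (fun k : G × n => a + μ k.1 k.2 ^ 2) t := by
  refine le_trans ?_ (ncard_mul_rpow_le_zetaSum μ ha ht ⌈√(1 + a)⌉₊)
  have hceil : 1 ≤ ⌈√(1 + a)⌉₊ := Nat.one_le_ceil_iff.2 (Real.sqrt_pos.2 (by linarith))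
  rw [← ENNReal.ofReal_mul (by positivity)]
  refine ENNReal.ofReal_le_ofReal ?_
  rw [mul_assoc]
  refine (mul_le_mul_of_nonneg_left (rpow_le_mul_rpow_natCeil_sqrt ha ht hd) hc.le).trans ?_
  rw [← mul_assoc]
  exact mul_le_mul_of_nonneg_right (hlow _ hceil) (by positivity)

theorem zetaSum_lt_top_of_prod {ι : Type*} {κ : ι → ℝ} (hκ : ∀ i, 0 ≤ κ i) {t d c : ℝ}
    (ht : 0 ≤ t) (hd : 0 ≤ d) (hc : 0 < c)
    (hlow : ∀ N : ℕ, 1 ≤ N → c * (N : ℝ) ^ d ≤ (eigenBall μ N).ncard)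
    (h : zetaSum (fun k : ι × G × n => κ k.1 + μ k.2.1 k.2.2 ^ 2) t < ∞) :
    zetaSum κ (t - d) < ∞ := by
  have hmul : ENNReal.ofReal (c * 5 ^ (-(t / 2))) * zetaSum κ (t - d) < ∞ := by
    refine lt_of_le_of_lt ?_ h
    rw [zetaSum_prod κ fun k : G × n => μ k.1 k.2 ^ 2, zetaSum, ← ENNReal.tsum_mul_left]
    exact ENNReal.tsum_le_tsum fun i => rpow_le_zetaSum (hκ i) ht hd hc hlow
  exact ENNReal.lt_top_of_mul_ne_top_right hmul.ne (ENNReal.ofReal_pos.2 (by positivity)).ne'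

theorem mul_rpow_sub_le {a t : ℝ} (d : ℝ) (ha : 0 ≤ a) (ht : 0 ≤ t) {x : ℝ} (hx : 1 ≤ x) :
    (2 + a) ^ (-(t / 2)) * x ^ (d - t) ≤ x ^ d * (1 + (a + x ^ 2)) ^ (-(t / 2)) := by
  have hx0 : 0 < x := by linarith
  have hx_sq : 1 ≤ x ^ 2 := one_le_pow₀ hx
  have hbase : ((2 + a) * x ^ 2) ^ (-(t / 2)) ≤ (1 + (a + x ^ 2)) ^ (-(t / 2)) :=
    Real.rpow_le_rpow_of_nonpos (by positivity) (by nlinarith) (by linarith)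
  have hpow : (x ^ 2) ^ (-(t / 2)) = x ^ (-t) := by
    rw [← Real.rpow_natCast x 2, ← Real.rpow_mul hx0.le]
    congr 1
    push_cast
    ring
  calc (2 + a) ^ (-(t / 2)) * x ^ (d - t)
      = x ^ d * ((2 + a) * x ^ 2) ^ (-(t / 2)) := by
        rw [Real.mul_rpow (by linarith) (by positivity), hpow, sub_eq_add_neg, Real.rpow_add hx0]
        ring
    _ ≤ _ := by gcongr

theorem le_of_zetaSum_lt_top {a t d : ℝ} (ha : 0 ≤ a) (ht : 0 ≤ t)
    (hlow : ∀ᶠ N : ℕ in atTop, (N : ℝ) ^ d ≤ (eigenBall μ N).ncard)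
    (h : zetaSum (fun k : G × n => a + μ k.1 k.2 ^ 2) t < ∞) : d ≤ t := by
  by_contra! hlt
  set Z := zetaSum (fun k : G × n => a + μ k.1 k.2 ^ 2) t
  have hbound : ∀ᶠ N : ℕ in atTop, (2 + a) ^ (-(t / 2)) * (N : ℝ) ^ (d - t) ≤ Z.toReal := by
    filter_upwards [hlow, eventually_ge_atTop 1] with N hN hone
    refine (mul_rpow_sub_le d ha ht (by exact_mod_cast hone)).trans ?_
    refine (mul_le_mul_of_nonneg_right hN (by positivity)).trans ?_
    exact (ENNReal.ofReal_le_iff_le_toReal h.ne).1 (ncard_mul_rpow_le_zetaSum μ ha ht N)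
  have htend : Tendsto (fun N : ℕ => (2 + a) ^ (-(t / 2)) * (N : ℝ) ^ (d - t)) atTop atTop :=
    ((tendsto_rpow_atTop (by linarith)).comp tendsto_natCast_atTop_atTop).const_mul_atTop
      (by positivity)
  obtain ⟨N, hle, hgt⟩ := (hbound.and (htend.eventually_gt_atTop Z.toReal)).exists
  exact hgt.not_ge hle

end Dyadic

/-! ### Growth and the abscissa of convergence -/

section Exponent

variable {b : ℕ → ℝ} (hb : ∀ N, 1 ≤ N → 1 ≤ b N)

include hb

theorem isBoundedUnder_log_div_log {C : ℝ} {k : ℕ} (hC : ∀ N : ℕ, 1 ≤ N → b N ≤ C * (N : ℝ) ^ k) :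
    IsBoundedUnder (· ≤ ·) atTop fun N : ℕ => Real.log (b N) / Real.log N := by
  have hCpos : 1 ≤ C := by simpa using (hb 1 le_rfl).trans (hC 1 le_rfl)
  have hlog2 : 0 < Real.log 2 := Real.log_pos one_lt_two
  refine ⟨Real.log C / Real.log 2 + k, ?_⟩
  rw [eventually_map]
  filter_upwards [eventually_ge_atTop 2] with N hN
  have hlogN : Real.log 2 ≤ Real.log N := Real.log_le_log two_pos (by exact_mod_cast hN)
  have hlogb : Real.log (b N) ≤ Real.log C + k * Real.log N := by
    rw [← Real.log_pow, ← Real.log_mul (by positivity) (by positivity)]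
    exact Real.log_le_log (by linarith [hb N (by omega)]) (hC N (by omega))
  rw [div_le_iff₀ (by linarith), add_mul]
  refine hlogb.trans (add_le_add_left ?_ _)
  rw [div_mul_eq_mul_div, le_div_iff₀ hlog2]
  exact mul_le_mul_of_nonneg_left hlogN (Real.log_nonneg hCpos)

theorem eventually_log_div_log_nonneg :
    ∀ᶠ N : ℕ in atTop, 0 ≤ Real.log (b N) / Real.log N := by
  filter_upwards [eventually_ge_atTop 1] with N hN
  exact div_nonneg (Real.log_nonneg (hb N hN)) (Real.log_nonneg (by exact_mod_cast hN))

theorem eventually_le_rpow_iff_log_div_log_le (q : ℝ) :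
    ∀ᶠ N : ℕ in atTop, b N ≤ (N : ℝ) ^ q ↔ Real.log (b N) / Real.log N ≤ q := by
  filter_upwards [eventually_ge_atTop 2] with N hN
  have hN' : (1 : ℝ) < N := by exact_mod_cast hN
  have hbN := hb N (by omega)
  rw [div_le_iff₀ (Real.log_pos hN'), ← Real.log_rpow (by linarith),
    Real.log_le_log_iff (by linarith) (by positivity)]

theorem eventually_rpow_le_iff_le_log_div_log (d : ℝ) :
    ∀ᶠ N : ℕ in atTop, (N : ℝ) ^ d ≤ b N ↔ d ≤ Real.log (b N) / Real.log N := by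
  filter_upwards [eventually_ge_atTop 2] with N hN
  have hN' : (1 : ℝ) < N := by exact_mod_cast hN
  have hbN := hb N (by omega)
  rw [le_div_iff₀ (Real.log_pos hN'), ← Real.log_rpow (by linarith),
    Real.log_le_log_iff (by positivity) (by linarith)]

theorem exists_forall_mul_rpow_le {d : ℝ} (hd : 0 ≤ d)
    (hev : ∀ᶠ N : ℕ in atTop, (N : ℝ) ^ d ≤ b N) :
    ∃ c > 0, ∀ N : ℕ, 1 ≤ N → c * (N : ℝ) ^ d ≤ b N := by
  obtain ⟨M, hM⟩ := eventually_atTop.1 hev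
  have hone : (1 : ℝ) ≤ ((M : ℝ) + 1) ^ d := Real.one_le_rpow (by simp) hd
  refine ⟨(((M : ℝ) + 1) ^ d)⁻¹, by positivity, fun N hN => ?_⟩
  rcases le_total M N with hMN | hNM
  · exact (mul_le_of_le_one_left (by positivity) (inv_le_one_of_one_le₀ hone)).trans (hM N hMN)
  · refine le_trans ?_ (hb N hN)
    rw [inv_mul_le_iff₀ (by positivity), mul_one]
    have hNM' : (N : ℝ) ≤ M + 1 := by exact_mod_cast hNM.trans (Nat.le_succ M)
    gcongr

end Exponent

section Growth

variable {G V : Type*} [NormedAddCommGroup V] [InnerProductSpace ℂ V] [CompleteSpace V]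
  {ℓ : G → selfAdjoint (V →L[ℂ] V)}

theorem PolynomialGrowth.finite_ball (hpg : PolynomialGrowth ℓ) {N : ℕ} (hN : 1 ≤ N) :
    (ball ℓ N).Finite := by
  obtain ⟨C, k, h⟩ := hpg
  exact (h N hN).1

variable [Group G] [Nontrivial V]

theorem one_mem_ball (hℓ : IsProperLength ℓ) (N : ℕ) : (1 : G) ∈ ball ℓ N := by
  have hone : (ℓ 1 : V →L[ℂ] V) = 0 := congrArg Subtype.val ((hℓ.eq_zero_iff 1).2 rfl)
  change sInf (spectrum ℝ (CFC.abs (ℓ 1 : V →L[ℂ] V))) ≤ N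
  rw [hone, CFC.abs_zero, spectrum.zero_eq, csInf_singleton]
  exact Nat.cast_nonneg N

theorem one_le_ncard_ball (hℓ : IsProperLength ℓ) (hpg : PolynomialGrowth ℓ) (N : ℕ)
    (hN : 1 ≤ N) : (1 : ℝ) ≤ (ball ℓ N).ncard := by
  have hpos : 0 < (ball ℓ N).ncard :=
    (Set.ncard_pos (hpg.finite_ball hN)).2 ⟨1, one_mem_ball hℓ N⟩
  exact_mod_cast hpos

theorem isBoundedUnder_growth (hℓ : IsProperLength ℓ) (hpg : PolynomialGrowth ℓ) :
    IsBoundedUnder (· ≤ ·) atTop fun N : ℕ => Real.log (ball ℓ N).ncard / Real.log N := by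
  have hone := one_le_ncard_ball hℓ hpg
  obtain ⟨C, k, h⟩ := hpg
  exact isBoundedUnder_log_div_log hone fun N hN => (h N hN).2

theorem growth_nonneg (hℓ : IsProperLength ℓ) (hpg : PolynomialGrowth ℓ) : 0 ≤ growth ℓ :=
  le_limsup_of_frequently_le
    (eventually_log_div_log_nonneg (one_le_ncard_ball hℓ hpg)).frequently
    (isBoundedUnder_growth hℓ hpg)

theorem eventually_ncard_ball_le (hℓ : IsProperLength ℓ) (hpg : PolynomialGrowth ℓ) {q : ℝ}
    (hq : growth ℓ < q) : ∀ᶠ N : ℕ in atTop, ((ball ℓ N).ncard : ℝ) ≤ (N : ℝ) ^ q := by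
  filter_upwards [eventually_lt_of_limsup_lt hq (isBoundedUnder_growth hℓ hpg),
    eventually_le_rpow_iff_log_div_log_le (one_le_ncard_ball hℓ hpg) q] with N hlt hiff
  exact hiff.2 hlt.le

theorem eventually_le_ncard_ball (hℓ : IsProperLength ℓ) (hpg : PolynomialGrowth ℓ) {L d : ℝ}
    (hL : Tendsto (fun N : ℕ => Real.log (ball ℓ N).ncard / Real.log N) atTop (𝓝 L))
    (hd : d < L) : ∀ᶠ N : ℕ in atTop, (N : ℝ) ^ d ≤ (ball ℓ N).ncard := by
  filter_upwards [hL.eventually_const_lt hd,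
    eventually_rpow_le_iff_le_log_div_log (one_le_ncard_ball hℓ hpg) d] with N hlt hiff
  exact hiff.2 hlt.le

end Growth

section Abscissa

variable {E : Type*} [NormedAddCommGroup E] [InnerProductSpace ℂ E] [CompleteSpace E]
  {T : E →ₗ.[ℂ] E}

theorem abscissa_le {t : ℝ} (ht : 0 < t) (hz : zeta T t < ∞) : abscissa T ≤ t :=
  csInf_le ⟨0, fun _ hs => hs.1.le⟩ ⟨ht, hz⟩

theorem FinitelySummable.exists_lt_abscissa_add (hT : FinitelySummable T) {ε : ℝ} (hε : 0 < ε) :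
    ∃ t, 0 < t ∧ zeta T t < ∞ ∧ t < abscissa T + ε := by
  obtain ⟨t, ⟨ht, hz⟩, hlt⟩ := exists_lt_of_csInf_lt hT (lt_add_of_pos_right (abscissa T) hε)
  exact ⟨t, ht, hz, hlt⟩

end Abscissa

theorem nonempty_of_hilbertBasis {X ι : Type*} [NormedAddCommGroup X] [InnerProductSpace ℂ X]
    [Nontrivial X] (e : HilbertBasis ι ℂ X) : Nonempty ι := by
  by_contra hι
  rw [not_nonempty_iff] at hι
  obtain ⟨x, hx⟩ := exists_ne (0 : X)
  exact hx (e.repr.injective (lp.ext (funext isEmptyElim)))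

namespace IsDiracModel

variable {G V : Type*} [NormedAddCommGroup V] [InnerProductSpace ℂ V]
  [FiniteDimensional ℂ V] [CompleteSpace V] {ℓ : G → selfAdjoint (V →L[ℂ] V)}
  {X : Type*} [NormedAddCommGroup X] [InnerProductSpace ℂ X] [CompleteSpace X]
  {E : Type*} [NormedAddCommGroup E] [InnerProductSpace ℂ E] [CompleteSpace E]
  {D : X →ₗ.[ℂ] X} {J : X →L[ℂ] X} {T : E →ₗ.[ℂ] E} {U : E ≃ₗᵢ[ℂ] L2 G (X ⊗[ℂ] V)}

theorem exists_zeta_eq_zetaSum.{u} {X : Type u} [NormedAddCommGroup X] [InnerProductSpace ℂ X]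
    [CompleteSpace X] {D : X →ₗ.[ℂ] X} {J : X →L[ℂ] X} {U : E ≃ₗᵢ[ℂ] L2 G (X ⊗[ℂ] V)}
    [Nontrivial X] [Nontrivial V] (hT : IsDiracModel ℓ D J T U) (hJ : IsAnticommuting D J)
    (hD : IsSelfAdjoint D) (hc : IsCompactOperator (invOneAddSq D ^ (1 / 2 : ℝ))) :
    ∃ (ι : Type u) (κ : ι → ℝ) (μ : G → Fin (Module.finrank ℂ V) → ℝ),
      Nonempty ι ∧ (∀ i, 0 ≤ κ i) ∧ (∀ t, 0 < t → zeta D t = zetaSum κ t) ∧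
      (∀ t, 0 < t → zeta T t = zetaSum (fun k : ι × G × _ => κ k.1 + μ k.2.1 k.2.2 ^ 2) t) ∧
      ∀ N, ball ℓ N = eigenBall μ N := by
  obtain ⟨ι, e, κ, he⟩ := TwistedTriple.exists_isSqDiagonal hD hc
  choose v μ hv using fun y => exists_eigenbasis (ℓ y)
  have := Fin.pos_iff_nonempty.1 (Module.finrank_pos (R := ℂ) (M := V))
  obtain ⟨w, hw⟩ := hT.exists_isSqDiagonal hJ he hv
  exact ⟨ι, κ, μ, nonempty_of_hilbertBasis e, he.nonneg, fun t ht => he.zeta_eq ht,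
    fun t ht => hw.zeta_eq ht, ball_eq_eigenBall hv⟩

variable [Group G]

theorem isSelfAdjoint_and_isCompactOperator (hT : IsDiracModel ℓ D J T U)
    (hJ : IsAnticommuting D J) (hD : IsSelfAdjoint D)
    (hc : IsCompactOperator (invOneAddSq D ^ (1 / 2 : ℝ))) (hℓ : IsProperLength ℓ) :
    IsSelfAdjoint T ∧ IsCompactOperator (invOneAddSq T ^ (1 / 2 : ℝ)) := by
  obtain ⟨ι, e, κ, he⟩ := TwistedTriple.exists_isSqDiagonal hD hc
  choose v μ hv using fun y => exists_eigenbasis (ℓ y)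
  obtain ⟨w, hw⟩ := hT.exists_isSqDiagonal hJ he hv
  refine ⟨hw.isSelfAdjoint, hw.isCompactOperator_iff.2 ?_⟩
  exact tendsto_add_prod_cofinite_atTop he.nonneg (fun k : G × _ => sq_nonneg (μ k.1 k.2))
    (he.isCompactOperator_iff.1 hc) (hℓ.tendsto_sq_eigenvalue hv)

variable [Nontrivial V] [Nontrivial X] (hT : IsDiracModel ℓ D J T U) (hJ : IsAnticommuting D J)
  (hD : IsSelfAdjoint D) (hc : IsCompactOperator (invOneAddSq D ^ (1 / 2 : ℝ)))
  (hℓ : IsProperLength ℓ) (hpg : PolynomialGrowth ℓ)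

include hT hJ hD hc hℓ hpg

theorem zeta_add_lt_top {p q : ℝ} (hp : 0 < p) (hz : zeta D p < ∞) (hq : growth ℓ < q) :
    zeta T (p + q) < ∞ := by
  obtain ⟨ι, κ, μ, -, hκ, hzD, hzT, hball⟩ := hT.exists_zeta_eq_zetaSum hJ hD hc
  have hq0 : 0 < q := (growth_nonneg hℓ hpg).trans_lt hq
  obtain ⟨q', hgq', hq'q⟩ := exists_between hq
  have := Fin.pos_iff_nonempty.1 (Module.finrank_pos (R := ℂ) (M := V))
  have hlen : zetaSum (fun k : G × _ => μ k.1 k.2 ^ 2) q < ∞ := by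
    refine zetaSum_sq_lt_top (fun N hN => hball N ▸ hpg.finite_ball hN) hq0 hq'q ?_
    simpa only [hball] using eventually_ncard_ball_le hℓ hpg hgq'
  rw [hzT _ (by linarith)]
  refine (zetaSum_prod_le_mul hκ (fun k : G × _ => sq_nonneg (μ k.1 k.2)) hp.le hq0.le).trans_lt ?_
  exact ENNReal.mul_lt_top (hzD p hp ▸ hz) hlen

theorem finitelySummable (hfs : FinitelySummable D) : FinitelySummable T := by
  obtain ⟨p, hp, hz⟩ := hfs
  have hg := growth_nonneg hℓ hpg
  exact ⟨p + (growth ℓ + 1), by linarith,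
    hT.zeta_add_lt_top hJ hD hc hℓ hpg hp hz (lt_add_one _)⟩

theorem abscissa_le_add (hfs : FinitelySummable D) : abscissa T ≤ abscissa D + growth ℓ := by
  refine le_of_forall_pos_le_add fun ε hε => ?_
  have hg := growth_nonneg hℓ hpg
  obtain ⟨p, hp, hz, hlt⟩ := hfs.exists_lt_abscissa_add (half_pos hε)
  have hle : abscissa T ≤ p + (growth ℓ + ε / 2) := abscissa_le (by linarith)
    (hT.zeta_add_lt_top hJ hD hc hℓ hpg hp hz (by linarith))
  linarith

theorem growth_le_of_zeta_lt_top
    (hL : Tendsto (fun N : ℕ => Real.log (ball ℓ N).ncard / Real.log N) atTop (𝓝 (growth ℓ)))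
    {t : ℝ} (ht : 0 < t) (hz : zeta T t < ∞) : growth ℓ ≤ t := by
  obtain ⟨ι, κ, μ, ⟨i⟩, hκ, -, hzT, hball⟩ := hT.exists_zeta_eq_zetaSum hJ hD hc
  rw [hzT t ht, zetaSum_prod κ fun k : G × _ => μ k.1 k.2 ^ 2] at hz
  refine le_of_forall_lt_imp_le_of_dense fun d hd => ?_
  have hlow := eventually_le_ncard_ball hℓ hpg hL hd
  simp only [hball] at hlow
  exact le_of_zetaSum_lt_top (hκ i) ht.le hlow ((ENNReal.le_tsum i).trans_lt hz)

theorem abscissa_le_sub {d t : ℝ} (hd : 0 ≤ d) (hdt : d < t) (hz : zeta T t < ∞)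
    (hlow : ∀ᶠ N : ℕ in atTop, (N : ℝ) ^ d ≤ (ball ℓ N).ncard) : abscissa D ≤ t - d := by
  obtain ⟨ι, κ, μ, -, hκ, hzD, hzT, hball⟩ := hT.exists_zeta_eq_zetaSum hJ hD hc
  obtain ⟨c, hc, hcN⟩ := exists_forall_mul_rpow_le (one_le_ncard_ball hℓ hpg) hd hlow
  simp only [hball] at hcN
  rw [hzT t (by linarith)] at hz
  refine abscissa_le (by linarith) ?_
  rw [hzD _ (by linarith)]
  exact zetaSum_lt_top_of_prod hκ (by linarith) hd hc hcN hz

theorem abscissa_eq_add (hfs : FinitelySummable D)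
    (hL : ∃ L : ℝ, Tendsto (fun N : ℕ => Real.log (ball ℓ N).ncard / Real.log N) atTop (𝓝 L)) :
    abscissa T = abscissa D + growth ℓ := by
  replace hL : Tendsto (fun N : ℕ => Real.log (ball ℓ N).ncard / Real.log N) atTop
      (𝓝 (growth ℓ)) := by
    obtain ⟨L, hL⟩ := hL
    rwa [show growth ℓ = L from hL.limsup_eq]
  refine le_antisymm (hT.abscissa_le_add hJ hD hc hℓ hpg hfs)
    (le_csInf (hT.finitelySummable hJ hD hc hℓ hpg hfs) ?_)
  rintro t ⟨ht, hz⟩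
  have hgt := hT.growth_le_of_zeta_lt_top hJ hD hc hℓ hpg hL ht hz
  rcases (growth_nonneg hℓ hpg).eq_or_lt with hzero | hpos
  · have hlow : ∀ᶠ N : ℕ in atTop, (N : ℝ) ^ (0 : ℝ) ≤ (ball ℓ N).ncard := by
      filter_upwards [eventually_ge_atTop 1] with N hN
      simpa using one_le_ncard_ball hℓ hpg N hN
    linarith [hT.abscissa_le_sub hJ hD hc hℓ hpg le_rfl ht hz hlow]
  · refine le_of_forall_pos_le_add fun ε hε => ?_
    have hmax : max (growth ℓ - ε) 0 < growth ℓ := max_lt (by linarith) hpos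
    linarith [le_max_left (growth ℓ - ε) 0, hT.abscissa_le_sub hJ hD hc hℓ hpg (le_max_right _ _)
      (hmax.trans_le hgt) hz (eventually_le_ncard_ball hℓ hpg hL hmax)]

end IsDiracModel

/-! ### Multiples of a representation -/

section Multiples

open ContinuousLinearMap (adjoint)

variable {E F F' : Type*} [NormedAddCommGroup E] [InnerProductSpace ℂ E] [CompleteSpace E]
  [NormedAddCommGroup F] [InnerProductSpace ℂ F] [CompleteSpace F]
  [NormedAddCommGroup F'] [InnerProductSpace ℂ F'] [CompleteSpace F']
  {n m : Type*} [Fintype n] [Fintype m]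

/-- `F` is the orthogonal sum of copies of `E`, embedded by the isometries `W k`. It is phrased with
adjoints, `Wⱼ* Wₖ = δⱼₖ` and `∑ₖ Wₖ Wₖ* = 1`, to transport operators from `E` to `F`. -/
structure IsOrthogonalDecomposition (W : n → E →L[ℂ] F) : Prop where
  adjoint_apply_self : ∀ k ξ, adjoint (W k) (W k ξ) = ξ
  adjoint_apply_of_ne : ∀ j k, j ≠ k → ∀ ξ, adjoint (W j) (W k ξ) = 0
  sum_apply_adjoint : ∀ η, ∑ k, W k (adjoint (W k) η) = η

namespace IsOrthogonalDecomposition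

theorem comp {W' : m → F →L[ℂ] F'} {W : n → E →L[ℂ] F} (hW' : IsOrthogonalDecomposition W')
    (hW : IsOrthogonalDecomposition W) :
    IsOrthogonalDecomposition fun k : m × n => W' k.1 ∘L W k.2 where
  adjoint_apply_self k ξ := by
    simp only [ContinuousLinearMap.adjoint_comp, ContinuousLinearMap.comp_apply,
      hW'.adjoint_apply_self, hW.adjoint_apply_self]
  adjoint_apply_of_ne j k hjk ξ := by
    simp only [ContinuousLinearMap.adjoint_comp, ContinuousLinearMap.comp_apply]
    rcases eq_or_ne j.1 k.1 with hfst | hfst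
    · rw [hfst, hW'.adjoint_apply_self,
        hW.adjoint_apply_of_ne _ _ fun hsnd => hjk (Prod.ext hfst hsnd)]
    · rw [hW'.adjoint_apply_of_ne _ _ hfst, map_zero]
  sum_apply_adjoint η := by
    simp only [ContinuousLinearMap.adjoint_comp, ContinuousLinearMap.comp_apply,
      Fintype.sum_prod_type, ← map_sum, hW.sum_apply_adjoint, hW'.sum_apply_adjoint]

theorem symm_comp {W : n → E →L[ℂ] F} (hW : IsOrthogonalDecomposition W) (U : F' ≃ₗᵢ[ℂ] F) :
    IsOrthogonalDecomposition fun k => (U.symm : F →L[ℂ] F') ∘L W k := by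
  have hadj (k : n) (η : F') :
      adjoint ((U.symm : F →L[ℂ] F') ∘L W k) η = adjoint (W k) (U η) := by
    rw [ContinuousLinearMap.adjoint_comp]
    exact congrArg (fun S : F' →L[ℂ] F => adjoint (W k) (S η)) U.symm.adjoint_eq_symm
  constructor
  · intro k ξ
    rw [hadj]
    simpa using hW.adjoint_apply_self k ξ
  · intro j k hjk ξ
    rw [hadj]
    simpa using hW.adjoint_apply_of_ne j k hjk ξ
  · intro η
    refine U.injective ?_
    simp only [hadj]
    simpa using hW.sum_apply_adjoint (U η)

end IsOrthogonalDecomposition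

/-- The representation `S ↦ ∑ₖ Wₖ S Wₖ*` on an orthogonal sum of copies of `E`, that is a multiple
of the identity representation of the bounded operators on `E`. -/
def multipleRep (W : n → E →L[ℂ] F) (hW : IsOrthogonalDecomposition W) :
    (E →L[ℂ] E) →⋆ₐ[ℂ] (F →L[ℂ] F) where
  toFun S := ∑ k, W k ∘L S ∘L adjoint (W k)
  map_one' := by
    ext η
    simpa [sum_apply] using hW.sum_apply_adjoint η
  map_mul' S T := by
    ext η
    simp only [sum_apply, mul_apply_eq_comp, ContinuousLinearMap.comp_apply, map_sum]
    refine Finset.sum_congr rfl fun j _ => ?_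
    rw [Finset.sum_eq_single j
      (fun k _ hk => by rw [hW.adjoint_apply_of_ne k j hk, map_zero, map_zero])
      (fun hj => absurd (Finset.mem_univ j) hj), hW.adjoint_apply_self]
  map_zero' := by simp
  map_add' S T := by
    simp only [ContinuousLinearMap.add_comp, ContinuousLinearMap.comp_add, Finset.sum_add_distrib]
  commutes' c := by
    ext η
    simpa [sum_apply, Algebra.algebraMap_eq_smul_one, ← Finset.smul_sum]
      using congrArg (c • ·) (hW.sum_apply_adjoint η)
  map_star' S := by
    simp only [star_sum, ContinuousLinearMap.star_eq_adjoint, ContinuousLinearMap.adjoint_comp,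
      ContinuousLinearMap.adjoint_adjoint, ContinuousLinearMap.comp_assoc]

variable {W : n → E →L[ℂ] F} (hW : IsOrthogonalDecomposition W)

theorem multipleRep_apply (S : E →L[ℂ] E) (η : F) :
    multipleRep W hW S η = ∑ k, W k (S (adjoint (W k) η)) :=
  sum_apply _ _ _

theorem multipleRep_apply_apply (S : E →L[ℂ] E) (k : n) (ξ : E) :
    multipleRep W hW S (W k ξ) = W k (S ξ) := by
  rw [multipleRep_apply, Finset.sum_eq_single k
    (fun j _ hj => by rw [hW.adjoint_apply_of_ne j k hj, map_zero, map_zero])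
    (fun hk => absurd (Finset.mem_univ k) hk), hW.adjoint_apply_self]

theorem multipleRep_eq {S : E →L[ℂ] E} {S' : F →L[ℂ] F} (h : ∀ k ξ, S' (W k ξ) = W k (S ξ)) :
    multipleRep W hW S = S' := by
  ext η
  simp only [multipleRep_apply, ← h]
  rw [← map_sum, hW.sum_apply_adjoint]

theorem multipleRep_injective [Nonempty n] : Function.Injective (multipleRep W hW) := by
  obtain ⟨k⟩ := ‹Nonempty n›
  intro S S' hS
  ext ξ
  rw [← hW.adjoint_apply_self k (S ξ), ← hW.adjoint_apply_self k (S' ξ),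
    ← multipleRep_apply_apply hW, ← multipleRep_apply_apply hW, hS]

end Multiples

/-! ### Smooth elements of the crossed product -/

section Smooth

variable {A : Type*} [CStarAlgebra A] {G : Type*} [Group G] {α : TwistedAction G A}
  {K : Type*} [NormedAddCommGroup K] [InnerProductSpace ℂ K] [CompleteSpace K]
  {π : A →⋆ₐ[ℂ] (K →L[ℂ] K)} {𝒜 : StarSubalgebra ℂ A}

theorem norm_regSingle_le (x : G) (a : A) : ‖regSingle α π x a‖ ≤ ‖a‖ :=
  (regSingle α π x a).opNorm_le_bound (norm_nonneg a)
    (norm_wshift_le x _ ‖a‖ (norm_coeff_le α π a x))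

theorem continuous_regSingle (x : G) : Continuous (regSingle α π x) := by
  let Φ : A →ₗ[ℂ] (L2 G K →L[ℂ] L2 G K) :=
    { toFun := regSingle α π x
      map_add' := regSingle_add α π x
      map_smul' := regSingle_smul α π x }
  exact AddMonoidHomClass.continuous_of_bound Φ 1
    fun a => (norm_regSingle_le x a).trans_eq (one_mul _).symm

theorem regSingle_mem_topologicalClosure (hα : α.IsSmooth 𝒜) (h𝒜 : Dense (𝒜 : Set A)) (x : G)
    (a : A) : regSingle α π x a ∈ (convAlgebra α π 𝒜 hα).topologicalClosure := by
  classical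
  refine map_mem_closure (continuous_regSingle x) (h𝒜 a) fun b hb => ?_
  refine ⟨Finsupp.single x b, fun y => ?_, (regRep_single α π x b).symm⟩
  rw [Finsupp.single_apply]
  split_ifs
  exacts [hb, zero_mem 𝒜]

theorem dense_smoothCrossed (hα : α.IsSmooth 𝒜) (h𝒜 : Dense (𝒜 : Set A)) :
    Dense (smoothCrossed α π 𝒜 hα : Set (crossedProduct α π)) := by
  have hle : crossedProduct α π ≤ (convAlgebra α π 𝒜 hα).topologicalClosure := by
    refine StarSubalgebra.topologicalClosure_minimal ?_
      (StarSubalgebra.isClosed_topologicalClosure _)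
    rintro _ ⟨f, -, rfl⟩
    exact sum_mem fun x _ => regSingle_mem_topologicalClosure hα h𝒜 x (f x)
  rintro ⟨T, hT⟩
  rw [Topology.IsInducing.subtypeVal.closure_eq_preimage_closure_image]
  refine closure_mono ?_ (hle hT)
  rintro _ ⟨f, hf, rfl⟩
  exact ⟨toCrossed α π f, ⟨f, hf, rfl⟩, rfl⟩

theorem exists_of_mem_smoothCrossed {hα : α.IsSmooth 𝒜} {S : crossedProduct α π}
    (h : S ∈ smoothCrossed α π 𝒜 hα) : ∃ f : G →₀ A, (∀ x, f x ∈ 𝒜) ∧ S = toCrossed α π f := by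
  obtain ⟨f, hf, hS⟩ := h
  exact ⟨f, hf, Subtype.ext hS⟩

theorem toCrossed_eq_algebraMap {f : G →₀ A} (hf : ∀ y, y ≠ 1 → f y = 0) {c : ℂ}
    (hc : f 1 = algebraMap ℂ A c) :
    toCrossed α π f = algebraMap ℂ (crossedProduct α π) c := by
  classical
  refine Subtype.ext ?_
  change regRep α π f = algebraMap ℂ (L2 G K →L[ℂ] L2 G K) c
  have hsingle : f = Finsupp.single 1 (f 1) := by
    ext y
    rcases eq_or_ne y 1 with rfl | hy
    · rw [Finsupp.single_eq_same]
    · rw [hf y hy, Finsupp.single_eq_of_ne hy]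
  rw [hsingle, regRep_single, hc, regSingle_algebraMap]

theorem isCommutator_algebraMap {B : Type*} [CStarAlgebra B] {E : Type*} [NormedAddCommGroup E]
    [InnerProductSpace ℂ E] [CompleteSpace E] (ϖ : B →⋆ₐ[ℂ] (E →L[ℂ] E)) (T : E →ₗ.[ℂ] E) (c : ℂ) :
    IsCommutator T (ϖ (algebraMap ℂ B c)) 0 := by
  rw [isCommutator_iff]
  intro x x' hx
  rw [AlgHomClass.commutes, Algebra.algebraMap_eq_smul_one]
  simpa using T.graph.smul_mem c hx

theorem continuous_starAlgHom {B : Type*} [CStarAlgebra B] {E : Type*} [NormedAddCommGroup E]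
    [InnerProductSpace ℂ E] [CompleteSpace E] (ϖ : B →⋆ₐ[ℂ] (E →L[ℂ] E)) : Continuous ϖ :=
  AddMonoidHomClass.continuous_of_bound ϖ 1
    fun b => (NonUnitalStarAlgHom.norm_apply_le ϖ b).trans_eq (one_mul _).symm

theorem commute_of_forall_toCrossed {E : Type*} [NormedAddCommGroup E] [InnerProductSpace ℂ E]
    [CompleteSpace E] {Rep : crossedProduct α π →⋆ₐ[ℂ] (E →L[ℂ] E)} {χ : E →L[ℂ] E}
    (h : ∀ f : G →₀ A, Rep (toCrossed α π f) * χ = χ * Rep (toCrossed α π f))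
    (S : crossedProduct α π) : Rep S * χ = χ * Rep S := by
  have hclosed : IsClosed {S : crossedProduct α π | Rep S * χ = χ * Rep S} :=
    isClosed_eq ((continuous_starAlgHom Rep).mul continuous_const)
      (continuous_const.mul (continuous_starAlgHom Rep))
  have hdense := dense_smoothCrossed (π := π) α.isSmooth_top (by simp [dense_univ])
  refine hclosed.closure_subset_iff.2 (fun S' hS' => ?_) (hdense S)
  obtain ⟨f, -, rfl⟩ := exists_of_mem_smoothCrossed hS'
  exact h f

end Smooth

/-! ### The regular representation as a multiple -/

section MultipleRegRep

open ContinuousLinearMap (adjoint)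

variable {X Y V : Type*} [NormedAddCommGroup X] [InnerProductSpace ℂ X]
  [NormedAddCommGroup Y] [InnerProductSpace ℂ Y] [NormedAddCommGroup V] [InnerProductSpace ℂ V]

/-- The operator `x ↦ x ⊗ v`, which embeds a copy of `X` into `X ⊗ V`. -/
def tmulRight (v : V) : X →L[ℂ] X ⊗[ℂ] V := (TensorProduct.mkL ℂ X V).flip v

theorem tmulRight_apply (v : V) (x : X) : tmulRight v x = x ⊗ₜ[ℂ] v := rfl

variable [CompleteSpace X] [CompleteSpace Y] [FiniteDimensional ℂ V]

theorem adjoint_tmulRight [CompleteSpace V] (v : V) :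
    adjoint (tmulRight v : X →L[ℂ] X ⊗[ℂ] V) = slice v := by
  symm
  rw [ContinuousLinearMap.eq_adjoint_iff]
  intro z x
  rw [← inner_conj_symm (slice v z) x, ← inner_tmul_left_eq]
  exact inner_conj_symm (𝕜 := ℂ) z (x ⊗ₜ[ℂ] v)

theorem adjoint_lmap {G : Type*} (S : X →L[ℂ] Y) :
    adjoint (lmap S : L2 G X →L[ℂ] L2 G Y) = lmap (adjoint S) := by
  symm
  rw [ContinuousLinearMap.eq_adjoint_iff]
  intro η ξ
  rw [inner_lmap, ContinuousLinearMap.adjoint_adjoint]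

theorem isOrthogonalDecomposition_tmulRight [CompleteSpace V] {n : Type*} [Fintype n]
    (b : OrthonormalBasis n ℂ V) :
    IsOrthogonalDecomposition fun i => (tmulRight (b i) : X →L[ℂ] X ⊗[ℂ] V) where
  adjoint_apply_self i x := by
    rw [adjoint_tmulRight, tmulRight_apply, slice_tmul, b.inner_eq_one, one_smul]
  adjoint_apply_of_ne i j hij x := by
    rw [adjoint_tmulRight, tmulRight_apply, slice_tmul, b.inner_eq_zero hij, zero_smul]
  sum_apply_adjoint z := by
    simp only [adjoint_tmulRight, tmulRight_apply, sum_slice_tmul]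

theorem IsOrthogonalDecomposition.lmap {G n : Type*} [Fintype n] {w : n → X →L[ℂ] Y}
    (hw : IsOrthogonalDecomposition w) :
    IsOrthogonalDecomposition fun k => (lmap (w k) : L2 G X →L[ℂ] L2 G Y) where
  adjoint_apply_self k ξ := by
    ext y
    simp only [adjoint_lmap, lmap_apply, hw.adjoint_apply_self]
  adjoint_apply_of_ne j k hjk ξ := by
    ext y
    simp only [adjoint_lmap, lmap_apply, hw.adjoint_apply_of_ne j k hjk, lp.coeFn_zero,
      Pi.zero_apply]
  sum_apply_adjoint η := by
    ext y
    simp only [adjoint_lmap, lp.coeFn_sum, Finset.sum_apply, lmap_apply, hw.sum_apply_adjoint]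

variable {A : Type*} [CStarAlgebra A] {G : Type*} [Group G]
  {πX : A →⋆ₐ[ℂ] (X →L[ℂ] X)} {πY : A →⋆ₐ[ℂ] (Y →L[ℂ] Y)}

theorem regRep_lmap (α : TwistedAction G A) {w : X →L[ℂ] Y}
    (hw : ∀ a x, πY a (w x) = w (πX a x)) (f : G →₀ A) (ξ : L2 G X) :
    regRep α πY f (lmap w ξ) = lmap w (regRep α πX f ξ) := by
  simp only [regRep, Finsupp.sum, sum_apply, map_sum]
  refine Finset.sum_congr rfl fun x _ => ?_
  ext y
  exact hw _ (ξ (x⁻¹ * y))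

theorem exists_injective_eq_conjBy_regRep [CompleteSpace V] [Nontrivial V] {s : Type*} [Fintype s]
    [Nonempty s] {E : Type*} [NormedAddCommGroup E] [InnerProductSpace ℂ E] [CompleteSpace E]
    (U : E ≃ₗᵢ[ℂ] L2 G (Y ⊗[ℂ] V)) (α : TwistedAction G A) {ι : s → X →L[ℂ] Y}
    (hι : IsOrthogonalDecomposition ι) (hπ : ∀ k a x, πY a (ι k x) = ι k (πX a x)) :
    ∃ Rep : crossedProduct α πX →⋆ₐ[ℂ] (E →L[ℂ] E), Function.Injective Rep ∧
      ∀ f : G →₀ A, Rep (toCrossed α πX f) = conjBy U (regRep α (ampl V πY) f) := by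
  have hindex : Nonempty (Fin (Module.finrank ℂ V)) := ⟨⟨0, Module.finrank_pos⟩⟩
  have hw := (isOrthogonalDecomposition_tmulRight (stdOrthonormalBasis ℂ V)).comp hι
  have hW := (hw.lmap (G := G)).symm_comp U
  refine ⟨(multipleRep _ hW).comp (crossedProduct α πX).subtype,
    (multipleRep_injective hW).comp Subtype.val_injective, fun f =>
    multipleRep_eq hW fun k ξ => ?_⟩
  rw [conjBy_apply]
  change U.symm (regRep α (ampl V πY) f (U (U.symm (lmap _ ξ)))) = U.symm (lmap _ _)
  rw [U.apply_symm_apply, regRep_lmap (πX := πX)]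
  · rfl
  · exact fun a x => congrArg (· ⊗ₜ[ℂ] _) (hπ k.2 a x)

end MultipleRegRep

/-! ### The spectral triple of a Dirac model -/

namespace IsDiracModel

variable {A : Type*} [CStarAlgebra A] {G : Type*} [Group G] {α : TwistedAction G A}
  {X₀ : Type*} [NormedAddCommGroup X₀] [InnerProductSpace ℂ X₀] [CompleteSpace X₀]
  {X : Type*} [NormedAddCommGroup X] [InnerProductSpace ℂ X] [CompleteSpace X]
  {V : Type*} [NormedAddCommGroup V] [InnerProductSpace ℂ V] [FiniteDimensional ℂ V]
  [CompleteSpace V]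
  {E : Type*} [NormedAddCommGroup E] [InnerProductSpace ℂ E] [CompleteSpace E]
  {π₀ : A →⋆ₐ[ℂ] (X₀ →L[ℂ] X₀)} {π : A →⋆ₐ[ℂ] (X →L[ℂ] X)}
  {D : X →ₗ.[ℂ] X} {J : X →L[ℂ] X} {ℓ : G → selfAdjoint (V →L[ℂ] V)} {T : E →ₗ.[ℂ] E}
  {U : E ≃ₗᵢ[ℂ] L2 G (X ⊗[ℂ] V)} {𝒜 : StarSubalgebra ℂ A}
  {Rep : crossedProduct α π₀ →⋆ₐ[ℂ] (E →L[ℂ] E)}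

theorem isSpectralTriple (hT : IsDiracModel ℓ D J T U) (hJ : IsAnticommuting D J)
    (hD : IsSelfAdjoint D) (hc : IsCompactOperator (invOneAddSq D ^ (1 / 2 : ℝ)))
    (hℓp : IsProperLength ℓ) (hℓb : TranslationBounded ℓ) (hπ : ∀ a, π a * J = J * π a)
    (hα : α.IsSmooth 𝒜) (h𝒜 : Dense (𝒜 : Set A)) (hub : UniformlyBounded α π 𝒜 D)
    (hRep : ∀ f : G →₀ A, Rep (toCrossed α π₀ f) = conjBy U (regRep α (ampl V π) f)) :
    IsSpectralTriple (smoothCrossed α π₀ 𝒜 hα) Rep T where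
  dense := dense_smoothCrossed hα h𝒜
  dense_domain := (hT.isSelfAdjoint_and_isCompactOperator hJ hD hc hℓp).1.dense_domain
  isSelfAdjoint := (hT.isSelfAdjoint_and_isCompactOperator hJ hD hc hℓp).1
  compact := (hT.isSelfAdjoint_and_isCompactOperator hJ hD hc hℓp).2
  commutator S hS := by
    obtain ⟨f, hf, rfl⟩ := exists_of_mem_smoothCrossed hS
    rw [hRep]
    exact hT.exists_isCommutator_regRep hπ hℓb hub hf

theorem isNondegenerate [Nontrivial V] (hT : IsDiracModel ℓ D J T U) (hJ : IsAnticommuting D J)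
    (hD : Dense (D.domain : Set X)) (hℓ : ∀ g, ℓ g = 0 ↔ g = 1) (hπ : ∀ a, π a * J = J * π a)
    (hinj : Function.Injective π) (hα : α.IsSmooth 𝒜)
    (hnd : ∀ a ∈ 𝒜, IsCommutator D (π a) 0 → ∃ c : ℂ, a = algebraMap ℂ A c)
    (hRinj : Function.Injective Rep)
    (hRep : ∀ f : G →₀ A, Rep (toCrossed α π₀ f) = conjBy U (regRep α (ampl V π) f)) :
    IsNondegenerate (smoothCrossed α π₀ 𝒜 hα) Rep T := by
  have hℓ₁ : ℓ 1 = 0 := (hℓ 1).2 rfl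
  refine ⟨hRinj, fun S hS => ⟨fun hcomm => ?_, ?_⟩⟩
  · obtain ⟨f, hf, rfl⟩ := exists_of_mem_smoothCrossed hS
    rw [hRep] at hcomm
    obtain ⟨c, hc⟩ := hnd _ (hf 1) (hT.isCommutator_apply_one_zero hℓ₁ hcomm)
    exact ⟨c, toCrossed_eq_algebraMap (fun y hy => hT.apply_eq_zero_of_isCommutator_zero hJ hπ hinj
      hD hℓ₁ hcomm fun hzero => hy ((hℓ y).1 hzero)) hc⟩
  · rintro ⟨c, rfl⟩
    exact isCommutator_algebraMap Rep T c

end IsDiracModel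

/-! ### Operators on direct sums -/

theorem withLp_prod_ext {E F : Type*} {x y : WithLp 2 (E × F)} (hfst : x.fst = y.fst)
    (hsnd : x.snd = y.snd) : x = y :=
  WithLp.ofLp_injective 2 (Prod.ext hfst hsnd)

section Graphs

variable {E F : Type*} [NormedAddCommGroup E] [InnerProductSpace ℂ E]
  [NormedAddCommGroup F] [InnerProductSpace ℂ F]

theorem exists_apply_eq_of_mem_graph {f : E →ₗ.[ℂ] F} {x : E} {y : F} (h : (x, y) ∈ f.graph) :
    ∃ hx : x ∈ f.domain, f ⟨x, hx⟩ = y := by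
  obtain ⟨⟨_, hx⟩, rfl, hy⟩ := (LinearPMap.mem_graph_iff _).1 h
  exact ⟨hx, hy⟩

theorem mem_graph_blockOp {a : E →ₗ.[ℂ] E} {b : F →ₗ.[ℂ] E} {c : E →ₗ.[ℂ] F} {d : F →ₗ.[ℂ] F}
    {x x' : WithLp 2 (E × F)} :
    (x, x') ∈ (blockOp a b c d).graph ↔ ∃ p q r s, (x.fst, p) ∈ a.graph ∧ (x.snd, q) ∈ b.graph ∧
      (x.fst, r) ∈ c.graph ∧ (x.snd, s) ∈ d.graph ∧ x'.fst = p + q ∧ x'.snd = r + s := by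
  constructor
  · intro h
    obtain ⟨⟨z, hz⟩, rfl, rfl⟩ := (LinearPMap.mem_graph_iff _).1 h
    exact ⟨a ⟨z.fst, hz.1.1⟩, b ⟨z.snd, hz.2.1⟩, c ⟨z.fst, hz.1.2⟩, d ⟨z.snd, hz.2.2⟩,
      a.mem_graph ⟨z.fst, hz.1.1⟩, b.mem_graph ⟨z.snd, hz.2.1⟩, c.mem_graph ⟨z.fst, hz.1.2⟩,
      d.mem_graph ⟨z.snd, hz.2.2⟩, rfl, rfl⟩
  · rintro ⟨p, q, r, s, hp, hq, hr, hs, hfst, hsnd⟩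
    obtain ⟨hxa, rfl⟩ := exists_apply_eq_of_mem_graph hp
    obtain ⟨hxb, rfl⟩ := exists_apply_eq_of_mem_graph hq
    obtain ⟨hxc, rfl⟩ := exists_apply_eq_of_mem_graph hr
    obtain ⟨hxd, rfl⟩ := exists_apply_eq_of_mem_graph hs
    exact (LinearPMap.mem_graph_iff _).2
      ⟨⟨x, ⟨hxa, hxc⟩, ⟨hxb, hxd⟩⟩, rfl, withLp_prod_ext hfst.symm hsnd.symm⟩

theorem mem_graph_zero {x : E} {y : F} : (x, y) ∈ (0 : E →ₗ.[ℂ] F).graph ↔ y = 0 := by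
  rw [LinearPMap.mem_graph_iff]
  constructor
  · rintro ⟨z, -, rfl⟩
    rfl
  · rintro rfl
    exact ⟨⟨x, trivial⟩, rfl, rfl⟩

theorem mem_graph_blockOp_offDiag {b : F →ₗ.[ℂ] E} {c : E →ₗ.[ℂ] F} {x x' : WithLp 2 (E × F)} :
    (x, x') ∈ (blockOp 0 b c 0).graph ↔
      (x.snd, x'.fst) ∈ b.graph ∧ (x.fst, x'.snd) ∈ c.graph := by
  rw [mem_graph_blockOp]
  simp only [mem_graph_zero]
  constructor
  · rintro ⟨_, q, r, _, rfl, hq, hr, rfl, hfst, hsnd⟩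
    rw [hfst, hsnd, zero_add, add_zero]
    exact ⟨hq, hr⟩
  · rintro ⟨hb, hc⟩
    exact ⟨0, _, _, 0, rfl, hb, hc, rfl, (zero_add _).symm, (add_zero _).symm⟩

theorem mem_graph_smul {f : E →ₗ.[ℂ] F} {c : ℂ} {x : E} {y : F} :
    (x, y) ∈ (c • f).graph ↔ ∃ p, (x, p) ∈ f.graph ∧ c • p = y := by
  simp [LinearPMap.smul_graph, -LinearPMap.mem_graph_iff]

theorem mem_graph_neg {f : E →ₗ.[ℂ] F} {x : E} {y : F} :
    (x, y) ∈ (-f).graph ↔ ∃ p, (x, p) ∈ f.graph ∧ -p = y := by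
  simp [LinearPMap.neg_graph, -LinearPMap.mem_graph_iff]

theorem mem_graph_add {f g : E →ₗ.[ℂ] F} {x : E} {y : F} :
    (x, y) ∈ (f + g).graph ↔ ∃ p q, (x, p) ∈ f.graph ∧ (x, q) ∈ g.graph ∧ p + q = y := by
  constructor
  · intro h
    obtain ⟨⟨z, hz⟩, rfl, rfl⟩ := (LinearPMap.mem_graph_iff _).1 h
    exact ⟨f ⟨z, hz.1⟩, g ⟨z, hz.2⟩, f.mem_graph ⟨z, hz.1⟩, g.mem_graph ⟨z, hz.2⟩, rfl⟩
  · rintro ⟨p, q, hp, hq, rfl⟩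
    obtain ⟨hxf, rfl⟩ := exists_apply_eq_of_mem_graph hp
    obtain ⟨hxg, rfl⟩ := exists_apply_eq_of_mem_graph hq
    exact (LinearPMap.mem_graph_iff _).2 ⟨⟨_, hxf, hxg⟩, rfl, rfl⟩

theorem mem_graph_diagOp {G : Type*} {T : G → E →ₗ.[ℂ] F} {ξ : L2 G E} {η : L2 G F} :
    (ξ, η) ∈ (diagOp T).graph ↔ ∀ y, (ξ y, η y) ∈ (T y).graph := by
  rw [diagOp, Submodule.toLinearPMap_graph_eq]
  · rfl
  · intro p hp hzero
    ext y
    exact (T y).graph_fst_eq_zero_snd (hp y) (by rw [hzero]; rfl)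

theorem mem_graph_lengthOp {G : Type*} [Group G] {V : Type*} [NormedAddCommGroup V]
    [InnerProductSpace ℂ V] [CompleteSpace V] {ℓ : G → selfAdjoint (V →L[ℂ] V)}
    {ξ m : L2 G (E ⊗[ℂ] V)} :
    (ξ, m) ∈ (lengthOp ℓ E).graph ↔ ∀ y, m y = (ℓ y : V →L[ℂ] V).lTensor E (ξ y) := by
  rw [lengthOp, mem_graph_diagOp]
  refine forall_congr' fun y => ?_
  rw [LinearPMap.mem_graph_iff]
  constructor
  · rintro ⟨z, hz, hm⟩
    simp only at hz hm
    rw [← hz, ← hm]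
    rfl
  · exact fun hm => ⟨⟨ξ y, trivial⟩, rfl, hm.symm⟩

end Graphs

section Inclusions

variable (E F : Type*) [NormedAddCommGroup E] [InnerProductSpace ℂ E]
  [NormedAddCommGroup F] [InnerProductSpace ℂ F]

/-- The inclusion of the first summand of `E ⊕ F`, companion of `WithLp.fstL`. -/
def inlL : E →L[ℂ] WithLp 2 (E × F) :=
  ((WithLp.prodContinuousLinearEquiv 2 ℂ E F).symm : E × F →L[ℂ] WithLp 2 (E × F)) ∘L
    ContinuousLinearMap.inl ℂ E F

/-- The inclusion of the second summand of `E ⊕ F`, companion of `WithLp.sndL`. -/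
def inrL : F →L[ℂ] WithLp 2 (E × F) :=
  ((WithLp.prodContinuousLinearEquiv 2 ℂ E F).symm : E × F →L[ℂ] WithLp 2 (E × F)) ∘L
    ContinuousLinearMap.inr ℂ E F

variable {E F}

theorem inlL_apply (x : E) : inlL E F x = WithLp.toLp 2 (x, 0) := rfl

theorem inrL_apply (y : F) : inrL E F y = WithLp.toLp 2 (0, y) := rfl

theorem inlL_add_inrL (x : E) (y : F) : inlL E F x + inrL E F y = WithLp.toLp 2 (x, y) :=
  withLp_prod_ext (add_zero x) (zero_add y)

theorem adjoint_inlL [CompleteSpace E] [CompleteSpace F] :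
    ContinuousLinearMap.adjoint (inlL E F) = WithLp.fstL 2 ℂ E F := by
  symm
  rw [ContinuousLinearMap.eq_adjoint_iff]
  intro x y
  simp [WithLp.prod_inner_apply, inlL_apply]

theorem adjoint_inrL [CompleteSpace E] [CompleteSpace F] :
    ContinuousLinearMap.adjoint (inrL E F) = WithLp.sndL 2 ℂ E F := by
  symm
  rw [ContinuousLinearMap.eq_adjoint_iff]
  intro x y
  simp [WithLp.prod_inner_apply, inrL_apply]

variable {G V : Type*} [NormedAddCommGroup V] [InnerProductSpace ℂ V] [FiniteDimensional ℂ V]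

theorem eq_of_forall_slice_eq {z z' : E ⊗[ℂ] V} (h : ∀ v, slice v z = slice v z') : z = z' :=
  sub_eq_zero.1 (eq_zero_of_forall_slice_eq_zero fun v => by rw [map_sub, h, sub_self])

theorem fstL_rTensor_inlL_add_inrL (z : E ⊗[ℂ] V) (z' : F ⊗[ℂ] V) :
    (WithLp.fstL 2 ℂ E F).rTensor V ((inlL E F).rTensor V z + (inrL E F).rTensor V z') = z :=
  eq_of_forall_slice_eq fun v => by
    rw [slice_rTensor, map_add, slice_rTensor, slice_rTensor, inlL_add_inrL, WithLp.fstL_apply,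
      WithLp.toLp_fst]

theorem sndL_rTensor_inlL_add_inrL (z : E ⊗[ℂ] V) (z' : F ⊗[ℂ] V) :
    (WithLp.sndL 2 ℂ E F).rTensor V ((inlL E F).rTensor V z + (inrL E F).rTensor V z') = z' :=
  eq_of_forall_slice_eq fun v => by
    rw [slice_rTensor, map_add, slice_rTensor, slice_rTensor, inlL_add_inrL, WithLp.sndL_apply,
      WithLp.toLp_snd]

theorem inlL_rTensor_fstL_add_inrL_rTensor_sndL (z : WithLp 2 (E × F) ⊗[ℂ] V) :
    (inlL E F).rTensor V ((WithLp.fstL 2 ℂ E F).rTensor V z)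
      + (inrL E F).rTensor V ((WithLp.sndL 2 ℂ E F).rTensor V z) = z :=
  eq_of_forall_slice_eq fun v => by
    rw [map_add]
    simp only [slice_rTensor]
    rw [inlL_add_inrL]
    rfl

variable [CompleteSpace E] [CompleteSpace F] [CompleteSpace V]

variable (E F G V) in
/-- The unitary `(E ⊗ ℓ²(G) ⊗ V) ⊕ (F ⊗ ℓ²(G) ⊗ V) ≃ (E ⊕ F) ⊗ ℓ²(G) ⊗ V`, which brings both Dirac
operators of the theorem into the form of a Dirac model. -/
def sumUnitary : WithLp 2 (L2 G (E ⊗[ℂ] V) × L2 G (F ⊗[ℂ] V)) ≃ₗᵢ[ℂ]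
    L2 G (WithLp 2 (E × F) ⊗[ℂ] V) :=
  LinearEquiv.isometryOfInner
    { toFun := fun ξ => lmap ((inlL E F).rTensor V) ξ.fst + lmap ((inrL E F).rTensor V) ξ.snd
      invFun := fun η => WithLp.toLp 2
        (lmap ((WithLp.fstL 2 ℂ E F).rTensor V) η, lmap ((WithLp.sndL 2 ℂ E F).rTensor V) η)
      map_add' := fun ξ η => by
        rw [WithLp.add_fst, WithLp.add_snd, map_add, map_add]
        abel
      map_smul' := fun c ξ => by
        rw [WithLp.smul_fst, WithLp.smul_snd, map_smul, map_smul, smul_add]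
        rfl
      left_inv := fun ξ => withLp_prod_ext
        (lp.ext <| funext fun y => fstL_rTensor_inlL_add_inrL (ξ.fst y) (ξ.snd y))
        (lp.ext <| funext fun y => sndL_rTensor_inlL_add_inrL (ξ.fst y) (ξ.snd y))
      right_inv := fun η =>
        lp.ext <| funext fun y => inlL_rTensor_fstL_add_inrL_rTensor_sndL (η y) }
    fun ξ η => by
      change inner ℂ (lmap ((inlL E F).rTensor V) ξ.fst + lmap ((inrL E F).rTensor V) ξ.snd)
        (lmap ((inlL E F).rTensor V) η.fst + lmap ((inrL E F).rTensor V) η.snd) = _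
      rw [inner_add_left, inner_lmap, inner_lmap, ContinuousLinearMap.adjoint_rTensor,
        ContinuousLinearMap.adjoint_rTensor, adjoint_inlL, adjoint_inrL, WithLp.prod_inner_apply]
      congr 2 <;> ext y
      · exact fstL_rTensor_inlL_add_inrL (η.fst y) (η.snd y)
      · exact sndL_rTensor_inlL_add_inrL (η.fst y) (η.snd y)

theorem sumUnitary_apply (ξ : WithLp 2 (L2 G (E ⊗[ℂ] V) × L2 G (F ⊗[ℂ] V))) :
    sumUnitary E F G V ξ
      = lmap ((inlL E F).rTensor V) ξ.fst + lmap ((inrL E F).rTensor V) ξ.snd := rfl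

theorem slice_sumUnitary (v : V) (ξ : WithLp 2 (L2 G (E ⊗[ℂ] V) × L2 G (F ⊗[ℂ] V))) (y : G) :
    slice v (sumUnitary E F G V ξ y)
      = WithLp.toLp 2 (slice v (ξ.fst y), slice v (ξ.snd y)) := by
  rw [sumUnitary_apply, lp.coeFn_add, Pi.add_apply, map_add, lmap_apply, lmap_apply, slice_rTensor,
    slice_rTensor, inlL_add_inrL]

theorem dsum_regRep {A : Type*} [CStarAlgebra A] [Group G] (α : TwistedAction G A)
    (πp : A →⋆ₐ[ℂ] (E →L[ℂ] E)) (πm : A →⋆ₐ[ℂ] (F →L[ℂ] F)) (f : G →₀ A) :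
    dsum (regRep α (ampl V πp) f) (regRep α (ampl V πm) f)
      = conjBy (sumUnitary E F G V) (regRep α (ampl V (repSum πp πm)) f) := by
  have hinl (a : A) (z : E ⊗[ℂ] V) : ampl V (repSum πp πm) a ((inlL E F).rTensor V z)
      = (inlL E F).rTensor V (ampl V πp a z) :=
    eq_of_forall_slice_eq fun v => by
      change slice v ((repSum πp πm a).rTensor V _)
        = slice v ((inlL E F).rTensor V ((πp a).rTensor V z))
      simp only [slice_rTensor]
      exact withLp_prod_ext rfl (map_zero (πm a))
  have hinr (a : A) (z : F ⊗[ℂ] V) : ampl V (repSum πp πm) a ((inrL E F).rTensor V z)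
      = (inrL E F).rTensor V (ampl V πm a z) :=
    eq_of_forall_slice_eq fun v => by
      change slice v ((repSum πp πm a).rTensor V _)
        = slice v ((inrL E F).rTensor V ((πm a).rTensor V z))
      simp only [slice_rTensor]
      exact withLp_prod_ext (map_zero (πp a)) rfl
  ext1 ξ
  rw [conjBy_apply, LinearIsometryEquiv.eq_symm_apply, sumUnitary_apply, sumUnitary_apply, map_add,
    regRep_lmap α hinl, regRep_lmap α hinr]
  rfl

section DiracModel

variable [Group G] {ℓ : G → selfAdjoint (V →L[ℂ] V)} {Dp : E →ₗ.[ℂ] F} {Dm : F →ₗ.[ℂ] E}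

theorem sumUnitary_mem_diracTriples {ξ u m : WithLp 2 (L2 G (E ⊗[ℂ] V) × L2 G (F ⊗[ℂ] V))} :
    (sumUnitary E F G V ξ, sumUnitary E F G V u, sumUnitary E F G V m)
        ∈ diracTriples ℓ (blockOp 0 Dm Dp 0) ↔
      ((ξ.fst, u.snd) ∈ (liftOp G V Dp).graph ∧ (ξ.snd, u.fst) ∈ (liftOp G V Dm).graph) ∧
      (ξ.fst, m.fst) ∈ (lengthOp ℓ E).graph ∧ (ξ.snd, m.snd) ∈ (lengthOp ℓ F).graph := by
  rw [mem_diracTriples]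
  refine and_congr ?_ ?_
  · simp only [liftOp, mem_graph_diagOp, mem_graph_tensorOp, slice_sumUnitary,
      mem_graph_blockOp_offDiag, ← forall_and]
    exact forall₂_congr fun y v => and_comm
  · rw [mem_graph_lengthOp, mem_graph_lengthOp, ← forall_and]
    refine forall_congr' fun y => ⟨fun hm => ?_, fun ⟨hfst, hsnd⟩ => ?_⟩
    · have hslice (v : V) := congrArg (slice v) hm
      simp only [slice_lTensor, slice_sumUnitary] at hslice
      exact ⟨eq_of_forall_slice_eq fun v => by
          rw [slice_lTensor]; exact congrArg WithLp.fst (hslice v),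
        eq_of_forall_slice_eq fun v => by
          rw [slice_lTensor]; exact congrArg WithLp.snd (hslice v)⟩
    · refine eq_of_forall_slice_eq fun v => ?_
      simp only [slice_lTensor, slice_sumUnitary, hfst, hsnd]

theorem isDiracModel_sumUnitary {J : WithLp 2 (E × F) →L[ℂ] WithLp 2 (E × F)}
    {J' : WithLp 2 (L2 G (E ⊗[ℂ] V) × L2 G (F ⊗[ℂ] V)) →L[ℂ]
      WithLp 2 (L2 G (E ⊗[ℂ] V) × L2 G (F ⊗[ℂ] V))}
    {T : WithLp 2 (L2 G (E ⊗[ℂ] V) × L2 G (F ⊗[ℂ] V)) →ₗ.[ℂ]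
      WithLp 2 (L2 G (E ⊗[ℂ] V) × L2 G (F ⊗[ℂ] V))}
    (hJ : ∀ m, lmap (J.rTensor V) (sumUnitary E F G V m) = sumUnitary E F G V (J' m))
    (hT : ∀ ξ ξ', (ξ, ξ') ∈ T.graph ↔ ∃ u m : WithLp 2 (L2 G (E ⊗[ℂ] V) × L2 G (F ⊗[ℂ] V)),
      (((ξ.fst, u.snd) ∈ (liftOp G V Dp).graph ∧ (ξ.snd, u.fst) ∈ (liftOp G V Dm).graph) ∧
        (ξ.fst, m.fst) ∈ (lengthOp ℓ E).graph ∧ (ξ.snd, m.snd) ∈ (lengthOp ℓ F).graph) ∧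
      ξ' = u + J' m) :
    IsDiracModel ℓ (blockOp 0 Dm Dp 0) J T (sumUnitary E F G V) := by
  intro ξ ξ'
  rw [hT, (sumUnitary E F G V).surjective.exists]
  refine exists_congr fun u => ?_
  rw [(sumUnitary E F G V).surjective.exists]
  refine exists_congr fun m => ?_
  rw [sumUnitary_mem_diracTriples, hJ, ← map_add, (sumUnitary E F G V).injective.eq_iff]

end DiracModel

end Inclusions

/-! ### The two Dirac operators of the theorem -/

section Instances

variable {E F : Type*} [NormedAddCommGroup E] [InnerProductSpace ℂ E]
  [NormedAddCommGroup F] [InnerProductSpace ℂ F]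

theorem dsum_one_neg_one_mul_self :
    (dsum 1 (-1) * dsum 1 (-1) : WithLp 2 (E × F) →L[ℂ] WithLp 2 (E × F)) = 1 := by
  ext1 x
  exact withLp_prod_ext rfl (neg_neg x.snd)

theorem dsum_mul_dsum_one_neg_one (S : E →L[ℂ] E) (T : F →L[ℂ] F) :
    dsum S T * dsum 1 (-1) = dsum 1 (-1) * dsum S T := by
  ext1 x
  exact withLp_prod_ext rfl (map_neg T x.snd)

variable (E) in
/-- The operator `(0, -i; i, 0)` on `E ⊕ E`. It anticommutes with `(0, D; D, 0)`, and it is the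
coefficient of `M_ℓ` in the Dirac operator built from an odd spectral triple. -/
def rotation : WithLp 2 (E × E) →L[ℂ] WithLp 2 (E × E) :=
  inlL E E ∘L ((-Complex.I) • WithLp.sndL 2 ℂ E E) + inrL E E ∘L (Complex.I • WithLp.fstL 2 ℂ E E)

theorem rotation_fst (x : WithLp 2 (E × E)) : (rotation E x).fst = -Complex.I • x.snd :=
  add_zero _

theorem rotation_snd (x : WithLp 2 (E × E)) : (rotation E x).snd = Complex.I • x.fst :=
  zero_add _

variable [CompleteSpace E] [CompleteSpace F]

theorem adjoint_dsum_one_neg_one : ContinuousLinearMap.adjoint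
    (dsum 1 (-1) : WithLp 2 (E × F) →L[ℂ] WithLp 2 (E × F)) = dsum 1 (-1) := by
  symm
  rw [ContinuousLinearMap.eq_adjoint_iff]
  intro x y
  rw [WithLp.prod_inner_apply, WithLp.prod_inner_apply]
  change inner ℂ x.fst y.fst + inner ℂ (-x.snd) y.snd
    = inner ℂ x.fst y.fst + inner ℂ x.snd (-y.snd)
  rw [inner_neg_left, inner_neg_right]

theorem adjoint_rotation : ContinuousLinearMap.adjoint (rotation E) = rotation E := by
  symm
  rw [ContinuousLinearMap.eq_adjoint_iff]
  intro x y
  rw [WithLp.prod_inner_apply, WithLp.prod_inner_apply]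
  change inner ℂ (rotation E x).fst y.fst + inner ℂ (rotation E x).snd y.snd
    = inner ℂ x.fst (rotation E y).fst + inner ℂ x.snd (rotation E y).snd
  rw [rotation_fst, rotation_fst, rotation_snd, rotation_snd]
  simp only [inner_smul_left, inner_smul_right, map_neg, Complex.conj_I]
  ring

theorem isAnticommuting_dsum (b : F →ₗ.[ℂ] E) (c : E →ₗ.[ℂ] F) :
    IsAnticommuting (blockOp 0 b c 0) (dsum 1 (-1)) where
  adjoint := adjoint_dsum_one_neg_one
  sq x := congrArg (fun S => S x) dsum_one_neg_one_mul_self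
  anticomm x x' h := by
    rw [mem_graph_blockOp_offDiag] at h ⊢
    exact ⟨b.graph.neg_mem h.1, by simpa [dsum] using h.2⟩

theorem isAnticommuting_rotation (D : E →ₗ.[ℂ] E) :
    IsAnticommuting (blockOp 0 D D 0) (rotation E) where
  adjoint := adjoint_rotation
  sq x := by
    refine withLp_prod_ext ?_ ?_
    · rw [rotation_fst, rotation_snd, smul_smul, neg_mul, Complex.I_mul_I, neg_neg, one_smul]
    · rw [rotation_snd, rotation_fst, smul_smul, mul_neg, Complex.I_mul_I, neg_neg, one_smul]
  anticomm x x' h := by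
    rw [mem_graph_blockOp_offDiag] at h ⊢
    have hfst := D.graph.smul_mem Complex.I h.2
    have hsnd := D.graph.smul_mem (-Complex.I) h.1
    simp only [WithLp.neg_fst, WithLp.neg_snd, rotation_fst, rotation_snd]
    exact ⟨by simpa using hfst, by simpa using hsnd⟩

theorem IsAnticommuting.exists_apply_eq_neg {D : E →ₗ.[ℂ] E} {J : E →L[ℂ] E}
    (h : IsAnticommuting D J) (ξ : D.domain) :
    ∃ hξ : J ξ ∈ D.domain, D ⟨J ξ, hξ⟩ = -J (D ξ) :=
  exists_apply_eq_of_mem_graph (h.anticomm _ _ (D.mem_graph ξ))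

theorem repSum_mul_rotation {A : Type*} [CStarAlgebra A] (π : A →⋆ₐ[ℂ] (E →L[ℂ] E)) (a : A) :
    repSum π π a * rotation E = rotation E * repSum π π a := by
  ext1 x
  refine withLp_prod_ext ?_ ?_
  · change π a (rotation E x).fst = (rotation E (repSum π π a x)).fst
    rw [rotation_fst, rotation_fst, map_smul]
    rfl
  · change π a (rotation E x).snd = (rotation E (repSum π π a x)).snd
    rw [rotation_snd, rotation_snd, map_smul]
    rfl

variable {G V : Type*} [NormedAddCommGroup V] [InnerProductSpace ℂ V] [FiniteDimensional ℂ V]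
  [CompleteSpace V]

theorem lmap_dsum_sumUnitary (m : WithLp 2 (L2 G (E ⊗[ℂ] V) × L2 G (F ⊗[ℂ] V))) :
    lmap ((dsum 1 (-1)).rTensor V) (sumUnitary E F G V m)
      = sumUnitary E F G V (dsum 1 (-1) m) := by
  ext y
  refine eq_of_forall_slice_eq fun v => ?_
  rw [lmap_apply, slice_rTensor, slice_sumUnitary, slice_sumUnitary]
  exact withLp_prod_ext rfl (map_neg (slice v) (m.snd y)).symm

theorem lmap_rotation_sumUnitary (m : WithLp 2 (L2 G (E ⊗[ℂ] V) × L2 G (E ⊗[ℂ] V))) :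
    lmap ((rotation E).rTensor V) (sumUnitary E E G V m)
      = sumUnitary E E G V (rotation (L2 G (E ⊗[ℂ] V)) m) := by
  ext y
  refine eq_of_forall_slice_eq fun v => ?_
  rw [lmap_apply, slice_rTensor, slice_sumUnitary, slice_sumUnitary, rotation_fst, rotation_snd]
  refine withLp_prod_ext ?_ ?_
  · rw [rotation_fst]
    exact (map_smul (slice v) (-Complex.I) (m.snd y)).symm
  · rw [rotation_snd]
    exact (map_smul (slice v) Complex.I (m.fst y)).symm

variable [Group G] (ℓ : G → selfAdjoint (V →L[ℂ] V))

theorem isDiracModel_diracEvenToOdd (Dp : E →ₗ.[ℂ] F) (Dm : F →ₗ.[ℂ] E) :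
    IsDiracModel ℓ (blockOp 0 Dm Dp 0) (dsum 1 (-1)) (diracEvenToOdd ℓ Dp Dm)
      (sumUnitary E F G V) := by
  refine isDiracModel_sumUnitary lmap_dsum_sumUnitary fun ξ ξ' => ?_
  rw [diracEvenToOdd, mem_graph_blockOp]
  simp only [mem_graph_neg]
  constructor
  · rintro ⟨p, q, r, _, hp, hq, hr, ⟨s, hs, rfl⟩, hfst, hsnd⟩
    exact ⟨WithLp.toLp 2 (q, r), WithLp.toLp 2 (p, s), ⟨⟨hr, hq⟩, hp, hs⟩,
      withLp_prod_ext (hfst.trans (add_comm p q)) hsnd⟩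
  · rintro ⟨u, m, ⟨⟨hr, hq⟩, hp, hs⟩, rfl⟩
    exact ⟨m.fst, u.fst, u.snd, _, hp, hq, hr, ⟨m.snd, hs, rfl⟩, add_comm u.fst m.fst, rfl⟩

theorem isDiracModel_diracOddToEven (D : E →ₗ.[ℂ] E) :
    IsDiracModel ℓ (blockOp 0 D D 0) (rotation E) (diracOddToEven ℓ D) (sumUnitary E E G V) := by
  refine isDiracModel_sumUnitary lmap_rotation_sumUnitary fun ξ ξ' => ?_
  rw [diracOddToEven, mem_graph_blockOp_offDiag, sub_eq_add_neg, mem_graph_add, mem_graph_add]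
  simp only [mem_graph_neg, mem_graph_smul]
  constructor
  · rintro ⟨⟨p, _, hp, ⟨_, ⟨q, hq, rfl⟩, rfl⟩, hfst⟩, ⟨r, _, hr, ⟨s, hs, rfl⟩, hsnd⟩⟩
    refine ⟨WithLp.toLp 2 (p, r), WithLp.toLp 2 (s, q), ⟨⟨hr, hp⟩, hs, hq⟩,
      withLp_prod_ext ?_ ?_⟩
    · rw [← hfst, WithLp.add_fst, rotation_fst, neg_smul, WithLp.toLp_fst, WithLp.toLp_snd]
    · rw [← hsnd, WithLp.add_snd, rotation_snd, WithLp.toLp_fst, WithLp.toLp_snd]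
  · rintro ⟨u, m, ⟨⟨hr, hp⟩, hs, hq⟩, rfl⟩
    refine ⟨⟨u.fst, _, hp, ⟨_, ⟨m.snd, hq, rfl⟩, rfl⟩, ?_⟩, ⟨u.snd, _, hr, ⟨m.fst, hs, rfl⟩, ?_⟩⟩
    · rw [WithLp.add_fst, rotation_fst, neg_smul]
    · rw [WithLp.add_snd, rotation_snd]

end Instances

/-! ### The double of an odd spectral triple -/

section HilbertBasis

variable {E F : Type*} [NormedAddCommGroup E] [InnerProductSpace ℂ E]
  [NormedAddCommGroup F] [InnerProductSpace ℂ F]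

theorem eq_zero_of_forall_inner_hilbertBasis_eq_zero {ι : Type*} (w : HilbertBasis ι ℂ E) {x : E}
    (hx : ∀ k, inner ℂ (w k) x = 0) : x = 0 := by
  refine w.repr.injective (lp.ext (funext fun k => ?_))
  rw [w.repr_apply_apply, hx, map_zero]
  rfl

theorem inner_inlL_left (a : E) (x : WithLp 2 (E × F)) :
    inner ℂ (inlL E F a) x = inner ℂ a x.fst := by
  simp [WithLp.prod_inner_apply, inlL_apply]

theorem inner_inrL_left (b : F) (x : WithLp 2 (E × F)) :
    inner ℂ (inrL E F b) x = inner ℂ b x.snd := by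
  simp [WithLp.prod_inner_apply, inrL_apply]

theorem exists_hilbertBasis_prod [CompleteSpace E] [CompleteSpace F] {ι κ : Type*}
    (w : HilbertBasis ι ℂ E) (z : HilbertBasis κ ℂ F) :
    ∃ b : HilbertBasis (ι ⊕ κ) ℂ (WithLp 2 (E × F)),
      (∀ k, b (Sum.inl k) = inlL E F (w k)) ∧ ∀ k, b (Sum.inr k) = inrL E F (z k) := by
  classical
  let v : ι ⊕ κ → WithLp 2 (E × F) := Sum.elim (fun k => inlL E F (w k)) fun k => inrL E F (z k)
  have hv : Orthonormal ℂ v := by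
    rw [orthonormal_iff_ite]
    rintro (j | j) (k | k) <;>
      simp [v, inlL_apply, inrL_apply, orthonormal_iff_ite.1 w.orthonormal,
        orthonormal_iff_ite.1 z.orthonormal]
  have hperp : (Submodule.span ℂ (Set.range v))ᗮ = ⊥ := by
    rw [Submodule.eq_bot_iff]
    intro x hx
    have hx (k) : inner ℂ (v k) x = 0 :=
      (Submodule.mem_orthogonal _ _).1 hx _ (Submodule.subset_span ⟨k, rfl⟩)
    exact withLp_prod_ext
      (eq_zero_of_forall_inner_hilbertBasis_eq_zero w fun k =>
        (inner_inlL_left (w k) x).symm.trans (hx (Sum.inl k)))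
      (eq_zero_of_forall_inner_hilbertBasis_eq_zero z fun k =>
        (inner_inrL_left (z k) x).symm.trans (hx (Sum.inr k)))
  refine ⟨HilbertBasis.mkOfOrthogonalEqBot hv hperp, fun k => ?_, fun k => ?_⟩ <;>
    rw [HilbertBasis.coe_mkOfOrthogonalEqBot] <;> rfl

end HilbertBasis

theorem zetaSum_sumElim {ι ι' : Type*} (κ : ι → ℝ) (κ' : ι' → ℝ) (t : ℝ) :
    zetaSum (Sum.elim κ κ') t = zetaSum κ t + zetaSum κ' t :=
  Summable.tsum_sum ENNReal.summable ENNReal.summable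

section Double

variable {E : Type*} [NormedAddCommGroup E] [InnerProductSpace ℂ E] {D : E →ₗ.[ℂ] E}

theorem isFormalAdjoint_blockOp_double (hD : D.IsFormalAdjoint D) :
    (blockOp 0 D D 0).IsFormalAdjoint (blockOp 0 D D 0) := by
  refine isFormalAdjoint_of_forall_mem_graph fun x x' y y' hx hy => ?_
  rw [mem_graph_blockOp_offDiag] at hx hy
  rw [WithLp.prod_inner_apply, WithLp.prod_inner_apply]
  change inner ℂ x'.fst y.fst + inner ℂ x'.snd y.snd
    = inner ℂ x.fst y'.fst + inner ℂ x.snd y'.snd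
  rw [inner_eq_of_mem_graph hD hx.1 hy.2, inner_eq_of_mem_graph hD hx.2 hy.1, add_comm]

theorem isClosed_blockOp_double (hD : D.IsClosed) : (blockOp 0 D D 0).IsClosed := by
  have hgraph : ((blockOp 0 D D 0).graph : Set (WithLp 2 (E × E) × WithLp 2 (E × E)))
      = (fun p => (WithLp.sndL 2 ℂ E E p.1, WithLp.fstL 2 ℂ E E p.2)) ⁻¹' (D.graph : Set (E × E))
        ∩ (fun p => (WithLp.fstL 2 ℂ E E p.1, WithLp.sndL 2 ℂ E E p.2)) ⁻¹'
          (D.graph : Set (E × E)) := by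
    ext ⟨x, x'⟩
    exact mem_graph_blockOp_offDiag
  rw [LinearPMap.IsClosed, hgraph]
  exact (IsClosed.preimage (by fun_prop) hD).inter (IsClosed.preimage (by fun_prop) hD)

theorem IsSqDiagonal.exists_double [CompleteSpace E] {ι : Type*} {w : HilbertBasis ι ℂ E}
    {κ : ι → ℝ} (h : IsSqDiagonal D w κ) :
    ∃ b : HilbertBasis (ι ⊕ ι) ℂ (WithLp 2 (E × E)),
      IsSqDiagonal (blockOp 0 D D 0) b (Sum.elim κ κ) := by
  obtain ⟨b, hinl, hinr⟩ := exists_hilbertBasis_prod w w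
  refine ⟨b, isFormalAdjoint_blockOp_double h.symm, isClosed_blockOp_double h.closed, ?_⟩
  rintro (k | k) <;> obtain ⟨u, hwu, huw⟩ := h.sq k
  · refine ⟨inrL E E u, ?_, ?_⟩ <;> rw [hinl, mem_graph_blockOp_offDiag]
    · exact ⟨D.graph.zero_mem, hwu⟩
    · rw [Sum.elim_inl, ← map_smul]
      exact ⟨huw, D.graph.zero_mem⟩
  · refine ⟨inlL E E u, ?_, ?_⟩ <;> rw [hinr, mem_graph_blockOp_offDiag]
    · exact ⟨hwu, D.graph.zero_mem⟩
    · rw [Sum.elim_inr, ← map_smul]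
      exact ⟨D.graph.zero_mem, huw⟩

section Spectrum

variable [CompleteSpace E] (hD : IsSelfAdjoint D)
  (hc : IsCompactOperator (invOneAddSq D ^ (1 / 2 : ℝ)))

include hD hc

theorem isSelfAdjoint_blockOp_double : IsSelfAdjoint (blockOp 0 D D 0) := by
  obtain ⟨ι, w, κ, h⟩ := exists_isSqDiagonal hD hc
  obtain ⟨b, hb⟩ := h.exists_double
  exact hb.isSelfAdjoint

theorem isCompactOperator_invOneAddSq_double :
    IsCompactOperator (invOneAddSq (blockOp 0 D D 0) ^ (1 / 2 : ℝ)) := by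
  obtain ⟨ι, w, κ, h⟩ := exists_isSqDiagonal hD hc
  obtain ⟨b, hb⟩ := h.exists_double
  refine hb.isCompactOperator_iff.2 fun s hs => ?_
  have hfin : {k | κ k ∉ s}.Finite := h.isCompactOperator_iff.1 hc hs
  refine ((hfin.image Sum.inl).union (hfin.image Sum.inr)).subset ?_
  rintro (k | k) hk
  · exact Or.inl ⟨k, hk, rfl⟩
  · exact Or.inr ⟨k, hk, rfl⟩

theorem zeta_double_lt_top_iff {t : ℝ} (ht : 0 < t) :
    zeta (blockOp 0 D D 0) t < ∞ ↔ zeta D t < ∞ := by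
  obtain ⟨ι, w, κ, h⟩ := exists_isSqDiagonal hD hc
  obtain ⟨b, hb⟩ := h.exists_double
  rw [hb.zeta_eq ht, h.zeta_eq ht, zetaSum_sumElim, ENNReal.add_lt_top, and_self]

theorem finitelySummable_double (hfs : FinitelySummable D) :
    FinitelySummable (blockOp 0 D D 0) := by
  obtain ⟨t, ht, h⟩ := hfs
  exact ⟨t, ht, (zeta_double_lt_top_iff hD hc ht).2 h⟩

theorem abscissa_double : abscissa (blockOp 0 D D 0) = abscissa D :=
  congrArg sInf (Set.ext fun _ => and_congr_right fun ht => zeta_double_lt_top_iff hD hc ht)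

end Spectrum

variable {A : Type*} [CStarAlgebra A] [CompleteSpace E] {π : A →⋆ₐ[ℂ] (E →L[ℂ] E)}

theorem isCommutator_double {a : A} {T : E →L[ℂ] E} (h : IsCommutator D (π a) T) :
    IsCommutator (blockOp 0 D D 0) (repSum π π a)
      (inlL E E ∘L T ∘L WithLp.sndL 2 ℂ E E + inrL E E ∘L T ∘L WithLp.fstL 2 ℂ E E) := by
  rw [isCommutator_iff] at h ⊢
  intro x x' hx
  rw [mem_graph_blockOp_offDiag] at hx ⊢
  have hfst := h _ _ hx.1
  have hsnd := h _ _ hx.2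
  rw [← add_zero (T x.snd)] at hfst
  rw [← zero_add (T x.fst)] at hsnd
  exact ⟨hfst, hsnd⟩

theorem isCommutator_zero_of_double {a : A}
    (h : IsCommutator (blockOp 0 D D 0) (repSum π π a) 0) : IsCommutator D (π a) 0 := by
  rw [isCommutator_iff] at h ⊢
  intro x x' hx
  have hinl := h (inlL E E x) (inrL E E x') (mem_graph_blockOp_offDiag.2 ⟨D.graph.zero_mem, hx⟩)
  exact (mem_graph_blockOp_offDiag.1 hinl).2

theorem UniformlyBounded.double {G : Type*} [Group G] {α : TwistedAction G A}
    {𝒜 : StarSubalgebra ℂ A} (h : UniformlyBounded α π 𝒜 D) :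
    UniformlyBounded α (repSum π π) 𝒜 (blockOp 0 D D 0) := by
  intro a ha y
  obtain ⟨C, hC⟩ := h a ha y
  refine ⟨‖inlL E E‖ * (C * ‖WithLp.sndL 2 ℂ E E‖) + ‖inrL E E‖ * (C * ‖WithLp.fstL 2 ℂ E E‖),
    fun x => ?_⟩
  obtain ⟨T, hT, hTC⟩ := hC x
  have hcomp {P Q : Type _} [NormedAddCommGroup P] [NormedSpace ℂ P] [NormedAddCommGroup Q]
      [NormedSpace ℂ Q] (i : E →L[ℂ] Q) (p : P →L[ℂ] E) : ‖i ∘L T ∘L p‖ ≤ ‖i‖ * (C * ‖p‖) :=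
    (i.opNorm_comp_le _).trans <| by
      gcongr
      exact (T.opNorm_comp_le p).trans (by gcongr)
  exact ⟨_, isCommutator_double hT, (norm_add_le _ _).trans (add_le_add (hcomp _ _) (hcomp _ _))⟩

theorem repSum_self_injective (hπ : Function.Injective π) : Function.Injective (repSum π π) :=
  fun a b h => hπ <| by
    ext x
    exact congrArg (fun S => (S (inlL E E x)).fst) h

theorem isOrthogonalDecomposition_inlL_inrL :
    IsOrthogonalDecomposition fun k : Bool => if k then inlL E E else inrL E E where
  adjoint_apply_self := by
    rintro (_ | _) ξ
    · exact congrArg (fun S => S (inrL E E ξ)) adjoint_inrL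
    · exact congrArg (fun S => S (inlL E E ξ)) adjoint_inlL
  adjoint_apply_of_ne := by
    rintro (_ | _) (_ | _) hjk ξ
    · exact (hjk rfl).elim
    · exact congrArg (fun S => S (inlL E E ξ)) adjoint_inrL
    · exact congrArg (fun S => S (inrL E E ξ)) adjoint_inlL
    · exact (hjk rfl).elim
  sum_apply_adjoint η := by
    rw [Fintype.sum_bool]
    simp only [if_true, if_false, adjoint_inlL, adjoint_inrL, Bool.false_eq_true]
    exact inlL_add_inrL η.fst η.snd

end Double

theorem isOrthogonalDecomposition_one {E : Type*} [NormedAddCommGroup E] [InnerProductSpace ℂ E]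
    [CompleteSpace E] : IsOrthogonalDecomposition fun _ : Unit => (1 : E →L[ℂ] E) where
  adjoint_apply_self _ _ := by rw [ContinuousLinearMap.adjoint_one]; rfl
  adjoint_apply_of_ne _ _ hjk := (hjk rfl).elim
  sum_apply_adjoint _ := by rw [Fintype.sum_unique, ContinuousLinearMap.adjoint_one]; rfl

/-! ### The spectral triples on the crossed product -/

section Triples

variable {A G V E F : Type*} [CStarAlgebra A] [Group G]
  [NormedAddCommGroup V] [InnerProductSpace ℂ V] [FiniteDimensional ℂ V] [CompleteSpace V]
  [NormedAddCommGroup E] [InnerProductSpace ℂ E] [CompleteSpace E]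
  [NormedAddCommGroup F] [InnerProductSpace ℂ F] [CompleteSpace F]

theorem nontrivial_of_injective_rep [Nontrivial A] {π : A →⋆ₐ[ℂ] (E →L[ℂ] E)}
    (hπ : Function.Injective π) : Nontrivial E := by
  by_contra hE
  rw [not_nontrivial_iff_subsingleton] at hE
  exact one_ne_zero (α := A) (hπ (ContinuousLinearMap.ext fun x => Subsingleton.elim _ _))

variable (V) in
theorem exists_injective_eq_dsum_regRep_self [Nontrivial V] (α : TwistedAction G A)
    (π : A →⋆ₐ[ℂ] (E →L[ℂ] E)) :
    ∃ Rep : crossedProduct α π →⋆ₐ[ℂ] (WithLp 2 (L2 G (E ⊗[ℂ] V) × L2 G (E ⊗[ℂ] V)) →L[ℂ]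
        WithLp 2 (L2 G (E ⊗[ℂ] V) × L2 G (E ⊗[ℂ] V))), Function.Injective Rep ∧
      ∀ f : G →₀ A, Rep (toCrossed α π f)
        = dsum (regRep α (ampl V π) f) (regRep α (ampl V π) f) := by
  simp only [dsum_regRep]
  refine exists_injective_eq_conjBy_regRep (sumUnitary E E G V) α
    isOrthogonalDecomposition_inlL_inrL ?_
  rintro (_ | _) a x
  · exact withLp_prod_ext (map_zero (π a)) rfl
  · exact withLp_prod_ext rfl (map_zero (π a))

variable (V) in
theorem exists_injective_eq_dsum_regRep [Nontrivial V] (α : TwistedAction G A)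
    (πp : A →⋆ₐ[ℂ] (E →L[ℂ] E)) (πm : A →⋆ₐ[ℂ] (F →L[ℂ] F)) :
    ∃ Rep : crossedProduct α (repSum πp πm) →⋆ₐ[ℂ]
        (WithLp 2 (L2 G (E ⊗[ℂ] V) × L2 G (F ⊗[ℂ] V)) →L[ℂ]
          WithLp 2 (L2 G (E ⊗[ℂ] V) × L2 G (F ⊗[ℂ] V))), Function.Injective Rep ∧
      ∀ f : G →₀ A, Rep (toCrossed α (repSum πp πm) f)
        = dsum (regRep α (ampl V πp) f) (regRep α (ampl V πm) f) := by
  simp only [dsum_regRep]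
  exact exists_injective_eq_conjBy_regRep (sumUnitary E F G V) α isOrthogonalDecomposition_one
    fun _ _ _ => rfl

variable {𝒜 : StarSubalgebra ℂ A} {α : TwistedAction G A} {ℓ : G → selfAdjoint (V →L[ℂ] V)}
  {π : A →⋆ₐ[ℂ] (E →L[ℂ] E)} {D : E →ₗ.[ℂ] E}
  {Rep : crossedProduct α π →⋆ₐ[ℂ] (WithLp 2 (L2 G (E ⊗[ℂ] V) × L2 G (E ⊗[ℂ] V)) →L[ℂ]
    WithLp 2 (L2 G (E ⊗[ℂ] V) × L2 G (E ⊗[ℂ] V)))}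

theorem isEvenSpectralTriple_diracOddToEven (hα : α.IsSmooth 𝒜) (hℓp : IsProperLength ℓ)
    (hℓb : TranslationBounded ℓ) (hD : IsSpectralTriple 𝒜 π D) (hub : UniformlyBounded α π 𝒜 D)
    (hRep : ∀ f : G →₀ A, Rep (toCrossed α π f)
      = dsum (regRep α (ampl V π) f) (regRep α (ampl V π) f)) :
    IsEvenSpectralTriple (smoothCrossed α π 𝒜 hα) Rep (diracOddToEven ℓ D) (dsum 1 (-1)) where
  toIsSpectralTriple := (isDiracModel_diracOddToEven ℓ D).isSpectralTriple
    (isAnticommuting_rotation D) (isSelfAdjoint_blockOp_double hD.isSelfAdjoint hD.compact)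
    (isCompactOperator_invOneAddSq_double hD.isSelfAdjoint hD.compact) hℓp hℓb
    (repSum_mul_rotation π) hα hD.dense hub.double fun f => (hRep f).trans (dsum_regRep α π π f)
  grading_selfAdjoint := adjoint_dsum_one_neg_one
  grading_sq := dsum_one_neg_one_mul_self
  grading_comm := commute_of_forall_toCrossed fun f => by rw [hRep, dsum_mul_dsum_one_neg_one]
  grading_anticomm := (isAnticommuting_dsum _ _).exists_apply_eq_neg

theorem isNondegenerate_diracOddToEven [Nontrivial V] (hα : α.IsSmooth 𝒜)
    (hℓ : ∀ g, ℓ g = 0 ↔ g = 1) (hD : IsSpectralTriple 𝒜 π D) (hnd : IsNondegenerate 𝒜 π D)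
    (hRinj : Function.Injective Rep)
    (hRep : ∀ f : G →₀ A, Rep (toCrossed α π f)
      = dsum (regRep α (ampl V π) f) (regRep α (ampl V π) f)) :
    IsNondegenerate (smoothCrossed α π 𝒜 hα) Rep (diracOddToEven ℓ D) :=
  (isDiracModel_diracOddToEven ℓ D).isNondegenerate (isAnticommuting_rotation D)
    (isSelfAdjoint_blockOp_double hD.isSelfAdjoint hD.compact).dense_domain hℓ
    (repSum_mul_rotation π) (repSum_self_injective hnd.1) hα
    (fun a ha h => (hnd.2 a ha).1 (isCommutator_zero_of_double h)) hRinj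
    fun f => (hRep f).trans (dsum_regRep α π π f)

end Triples

end TwistedTriple

end

open TwistedTriple in
theorem theorem3p4
    {A : Type*} [CStarAlgebra A] [Nontrivial A] {G : Type*} [Group G]
    {V : Type*} [NormedAddCommGroup V] [InnerProductSpace ℂ V] [FiniteDimensional ℂ V]
    [CompleteSpace V] [Nontrivial V]
    {H : Type*} [NormedAddCommGroup H] [InnerProductSpace ℂ H] [CompleteSpace H]
    {Hp : Type*} [NormedAddCommGroup Hp] [InnerProductSpace ℂ Hp] [CompleteSpace Hp]
    {Hm : Type*} [NormedAddCommGroup Hm] [InnerProductSpace ℂ Hm] [CompleteSpace Hm]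
    (𝒜 : StarSubalgebra ℂ A) (α : TwistedAction G A) (hα : α.IsSmooth 𝒜)
    (ℓ : G → selfAdjoint (V →L[ℂ] V)) (hℓb : TranslationBounded ℓ) (hℓp : IsProperLength ℓ) :
    -- odd to even
    (∀ (π : A →⋆ₐ[ℂ] (H →L[ℂ] H)) (D : H →ₗ.[ℂ] H),
      IsSpectralTriple 𝒜 π D → Function.Injective π → UniformlyBounded α π 𝒜 D →
      ∃ Rep : crossedProduct α π →⋆ₐ[ℂ]
          (WithLp 2 (L2 G (H ⊗[ℂ] V) × L2 G (H ⊗[ℂ] V)) →L[ℂ]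
            WithLp 2 (L2 G (H ⊗[ℂ] V) × L2 G (H ⊗[ℂ] V))),
        (∀ f : G →₀ A, Rep (toCrossed α π f)
          = dsum (regRep α (ampl V π) f) (regRep α (ampl V π) f)) ∧
        IsEvenSpectralTriple (smoothCrossed α π 𝒜 hα) Rep (diracOddToEven ℓ D) (dsum 1 (-1)) ∧
        (IsNondegenerate 𝒜 π D →
          IsNondegenerate (smoothCrossed α π 𝒜 hα) Rep (diracOddToEven ℓ D)) ∧
        (FinitelySummable D → PolynomialGrowth ℓ →
          FinitelySummable (diracOddToEven ℓ D) ∧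
          abscissa (diracOddToEven ℓ D) ≤ abscissa D + growth ℓ ∧
          ((∃ L : ℝ, Tendsto (fun n : ℕ => Real.log (ball ℓ n).ncard / Real.log n) atTop (𝓝 L)) →
            abscissa (diracOddToEven ℓ D) = abscissa D + growth ℓ))) ∧
    -- even to odd, with `H = Hp ⊕ Hm`, `π = πp ⊕ πm` and `D = (0 Dm; Dp 0)`
    (∀ (πp : A →⋆ₐ[ℂ] (Hp →L[ℂ] Hp)) (πm : A →⋆ₐ[ℂ] (Hm →L[ℂ] Hm))
      (Dp : Hp →ₗ.[ℂ] Hm) (Dm : Hm →ₗ.[ℂ] Hp),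
      IsEvenSpectralTriple 𝒜 (repSum πp πm) (blockOp 0 Dm Dp 0) (dsum 1 (-1)) →
      Function.Injective (repSum πp πm) →
      UniformlyBounded α (repSum πp πm) 𝒜 (blockOp 0 Dm Dp 0) →
      ∃ Rep : crossedProduct α (repSum πp πm) →⋆ₐ[ℂ]
          (WithLp 2 (L2 G (Hp ⊗[ℂ] V) × L2 G (Hm ⊗[ℂ] V)) →L[ℂ]
            WithLp 2 (L2 G (Hp ⊗[ℂ] V) × L2 G (Hm ⊗[ℂ] V))),
        (∀ f : G →₀ A, Rep (toCrossed α (repSum πp πm) f)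
          = dsum (regRep α (ampl V πp) f) (regRep α (ampl V πm) f)) ∧
        IsSpectralTriple (smoothCrossed α (repSum πp πm) 𝒜 hα) Rep (diracEvenToOdd ℓ Dp Dm) ∧
        (IsNondegenerate 𝒜 (repSum πp πm) (blockOp 0 Dm Dp 0) →
          IsNondegenerate (smoothCrossed α (repSum πp πm) 𝒜 hα) Rep (diracEvenToOdd ℓ Dp Dm)) ∧
        (FinitelySummable (blockOp 0 Dm Dp 0) → PolynomialGrowth ℓ →
          FinitelySummable (diracEvenToOdd ℓ Dp Dm) ∧
          abscissa (diracEvenToOdd ℓ Dp Dm) ≤ abscissa (blockOp 0 Dm Dp 0) + growth ℓ ∧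
          ((∃ L : ℝ, Tendsto (fun n : ℕ => Real.log (ball ℓ n).ncard / Real.log n) atTop (𝓝 L)) →
            abscissa (diracEvenToOdd ℓ Dp Dm) = abscissa (blockOp 0 Dm Dp 0) + growth ℓ))) := by
  refine ⟨fun π D hD hπ hub => ?_, fun πp πm Dp Dm hD hπ hub => ?_⟩
  · have : Nontrivial (WithLp 2 (H × H)) :=
      nontrivial_of_injective_rep (repSum_self_injective hπ)
    obtain ⟨Rep, hRinj, hRep⟩ := exists_injective_eq_dsum_regRep_self V α π
    refine ⟨Rep, hRep, isEvenSpectralTriple_diracOddToEven hα hℓp hℓb hD hub hRep,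
      fun hnd => isNondegenerate_diracOddToEven hα hℓp.eq_zero_iff hD hnd hRinj hRep,
      fun hfs hpg => ?_⟩
    have hT := isDiracModel_diracOddToEven ℓ D
    have hJ := isAnticommuting_rotation D
    have hsa := isSelfAdjoint_blockOp_double hD.isSelfAdjoint hD.compact
    have hc := isCompactOperator_invOneAddSq_double hD.isSelfAdjoint hD.compact
    replace hfs := finitelySummable_double hD.isSelfAdjoint hD.compact hfs
    rw [← abscissa_double hD.isSelfAdjoint hD.compact]
    exact ⟨hT.finitelySummable hJ hsa hc hℓp hpg hfs, hT.abscissa_le_add hJ hsa hc hℓp hpg hfs,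
      hT.abscissa_eq_add hJ hsa hc hℓp hpg hfs⟩
  · have : Nontrivial (WithLp 2 (Hp × Hm)) := nontrivial_of_injective_rep hπ
    obtain ⟨Rep, hRinj, hRep⟩ := exists_injective_eq_dsum_regRep V α πp πm
    have hRep' := fun f => (hRep f).trans (dsum_regRep α πp πm f)
    have hT := isDiracModel_diracEvenToOdd ℓ Dp Dm
    have hJ := isAnticommuting_dsum Dm Dp
    have hcomm := fun a => dsum_mul_dsum_one_neg_one (πp a) (πm a)
    have hsa := hD.isSelfAdjoint
    refine ⟨Rep, hRep, hT.isSpectralTriple hJ hsa hD.compact hℓp hℓb hcomm hα hD.dense hub hRep',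
      fun hnd => hT.isNondegenerate hJ hD.dense_domain hℓp.eq_zero_iff hcomm hπ hα
        (fun a ha => (hnd.2 a ha).1) hRinj hRep',
      fun hfs hpg => ⟨hT.finitelySummable hJ hsa hD.compact hℓp hpg hfs,
        hT.abscissa_le_add hJ hsa hD.compact hℓp hpg hfs,
        hT.abscissa_eq_add hJ hsa hD.compact hℓp hpg hfs⟩⟩
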